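/- Let $m\ge 1$ be an integer, $s\in(0,1]$, $p\in[1,+\infty)$, and let $\mathcal N$ be a connected (smooth, second countable, boundaryless) Riemannian manifold with geodesic distance $d_{\mathcal N}$. Write $\mathbb B^m_r=\{x\in\mathbb R^m : |x|<r\}$ and $\mathbb B^m=\mathbb B^m_1$. For an open set $A\subseteq\mathbb R^m$ and a Lebesgue measurable map $u:A\to\mathcal N$ define the Sobolev energy, if $s<1$, by $$\mathcal E_{s,p}(u,A)=\int_A\int_A\frac{d_{\mathcal N}(u(x),u(y))^p}{|x-y|^{m+sp}}\,dx\,dy\in[0,+\infty],$$ and, if $s=1$, by $\mathcal E_{1,p}(u,A)=\int_A|D(\iota\circ u)|^p$ when $\iota\circ u$ is weakly differentiable on $A$ and $\mathcal E_{1,p}(u,A)=+\infty$ otherwise. Here $\iota:\mathcal N\to\mathbb R^\nu$ is any fixed smooth isometric embedding in the Riemannian sense (such embeddings exist by Nash's theorem) and $|\cdot|$ is the operator norm of linear maps. An energy over $\mathbb R^m$ with state space $\mathcal N$ is a map $\mathcal G$ that assigns to every open set $A\subseteq\mathbb R^m$ and every measurable $u:A\to\mathcal N$ a value $\mathcal G(u,A)\in[0,+\infty]$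 in such a way that $\mathcal G(u|_A,A)\le\mathcal G(u,B)$ whenever $A\subseteq B$ are open and $u:B\to\mathcal N$ is measurable; for $A\subseteq B$ we write $\mathcal G(u,A)$ for $\mathcal G(u|_A,A)$. Let $\mathcal G$ be such an energy and assume that for every measurable map $u:\mathbb R^m\to\mathcal N$: (i) (superadditivity) $\mathcal G(u,A\cup B)\ge\mathcal G(u,A)+\mathcal G(u,B)$ for all open sets $A,B\subseteq\mathbb R^m$ with disjoint closures; (ii) (scaling) $\mathcal G(u,h+\lambda A)=\lambda^{m-sp}\,\mathcal G(u(h+\lambda\,\cdot),A)$ for all $\lambda>0$, $h\in\mathbb R^m$ and open $A\subseteq\mathbb R^m$. Let $(u_n)_{n\in\mathbb N}$ be a sequence of measurable maps $\mathbb B^m\to\mathcal N$ such that for every $n$, $\mathcal E_{s,p}(u_n,\mathbb B^m)>0$ and $\mathcal G(u_n,\mathbb B^m)<+\infty$, and such that $$\lim_{n\to\infty}\frac{\mathcal G(u_n,\mathbb B^m)}{\mathcal E_{s,p}(u_n,\mathbb B^m)}=+\infty .$$ Subcritical case. If $sp<m$, then for every $b_*\in\mathcal N$ and every $\varepsilon>0$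 there is a measurable map $u:\mathbb R^m\to\mathcal N$ such that $\mathcal E_{s,p}(u,\mathbb R^m)\le\varepsilon$, $u=b_*$ in $\mathbb R^m\setminus\mathbb B^m_{1/2}$ and $\mathcal G(u,\mathbb B^m)=+\infty$. Critical case. If $sp=m$, $s<m$ and $\lim_{n\to\infty}\mathcal E_{s,p}(u_n,\mathbb B^m)=0$, then for every $b_*\in\mathcal N$ and every $\varepsilon>0$ there is a measurable map $u:\mathbb R^m\to\mathcal N$ such that $\mathcal E_{s,p}(u,\mathbb R^m)\le\varepsilon$, $u=b_*$ in $\mathbb R^m\setminus\mathbb B^m_{1/2}$ and $\mathcal G(u,\mathbb B^m)=+\infty$. Supercritical case. If $sp>m$ or $s=p=m=1$, if $\mathcal N$ is compact and $\lim_{n\to\infty}\mathcal E_{s,p}(u_n,\mathbb B^m)=0$, then for every $\varepsilon>0$ there are a point $b_*\in\mathcal N$ and a measurable map $u:\mathbb R^m\to\mathcal N$ such that $\mathcal E_{s,p}(u,\mathbb R^m)\le\varepsilon$, $u=b_*$ in $\mathbb R^m\setminus\mathbb B^m_{1/2}$ and $\mathcal G(u,\mathbb B^m)=+\infty$. -/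

import Mathlib

open MeasureTheory Set Filter Topology Manifold Bundle
open scoped ENNReal ContDiff

noncomputable section

/-- The Euclidean space `ℝ^m`. -/
abbrev Euc (m : ℕ) : Type := EuclideanSpace ℝ (Fin m)

/-- The open ball of `ℝ^m` with centre `0` and radius `r`. -/
def oball (m : ℕ) (r : ℝ) : Set (Euc m) := Metric.ball (0 : Euc m) r

/-- The map `u : ℝ^m → N` is (Lebesgue) measurable on the set `A`. -/
def MeasOn {m : ℕ} {N : Type*} [MeasurableSpace N] (u : Euc m → N) (A : Set (Euc m)) : Prop :=
  AEMeasurable u (volume.restrict A)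

/-! ### Sobolev energies -/

/-- The Gagliardo energy
`∫_A ∫_A d(u x, u y)^p / |x - y|^(m + s p) dx dy`, for `0 < s < 1`. -/
def gagliardoEnergy {m : ℕ} {N : Type*} [EDist N] (s p : ℝ) (u : Euc m → N)
    (A : Set (Euc m)) : ℝ≥0∞ :=
  ∫⁻ x in A, ∫⁻ y in A, edist (u x) (u y) ^ p / edist x y ^ ((m : ℝ) + s * p)

/-- `D` is a weak derivative of `f : A → F` on the open set `A ⊆ ℝ^m`: both are locally integrable
on `A`, and `∫_A ∂_v φ f = - ∫_A φ D v` for all test functions `φ ∈ C_c^∞(A)` and directions `v`. -/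
def HasWeakDerivOn {m : ℕ} {F : Type*} [NormedAddCommGroup F] [NormedSpace ℝ F]
    (f : Euc m → F) (D : Euc m → Euc m →L[ℝ] F) (A : Set (Euc m)) : Prop :=
  LocallyIntegrableOn f A volume ∧ LocallyIntegrableOn D A volume ∧
    ∀ φ : Euc m → ℝ, ContDiff ℝ ∞ φ → HasCompactSupport φ → tsupport φ ⊆ A →
      ∀ v : Euc m, ∫ x in A, (fderiv ℝ φ x v) • f x = - ∫ x in A, φ x • D x v

/-- The energy `∫_A |D f|^p` of `f : A → F`, equal to `+∞` when `f` is not weakly differentiable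
on `A`. The weak derivative is unique up to null subsets of `A`, so that the infimum
below runs over at most one value. -/
def dirichletEnergy {m : ℕ} {F : Type*} [NormedAddCommGroup F] [NormedSpace ℝ F]
    (p : ℝ) (f : Euc m → F) (A : Set (Euc m)) : ℝ≥0∞ :=
  ⨅ (D : Euc m → Euc m →L[ℝ] F) (_ : HasWeakDerivOn f D A), ∫⁻ x in A, ‖D x‖ₑ ^ p

/-- The map `ι : N → ℝ^ν` is an isometric embedding in the sense of Riemannian geometry:
a smooth embedding whose differential preserves the lengths of tangent vectors. -/
structure IsIsometricEmbedding {d ν : ℕ} {N : Type*} [TopologicalSpace N]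
    [ChartedSpace (Euc d) N] [RiemannianBundle (fun x : N ↦ TangentSpace (𝓡 d) x)]
    (ι : N → Euc ν) : Prop where
  contMDiff : ContMDiff (𝓡 d) 𝓘(ℝ, Euc ν) ∞ ι
  isEmbedding : IsEmbedding ι
  norm_mfderiv : ∀ (x : N) (v : TangentSpace (𝓡 d) x),
    ‖mfderiv (𝓡 d) 𝓘(ℝ, Euc ν) ι x v‖ = ‖v‖

/-- The Sobolev energy `ℰ_{s,p}(u, A)` of `u : A → N`, for `0 < s ≤ 1`: the Gagliardo energy
for the distance of `N` when `s < 1`, and `∫_A |D u|^p` when `s = 1`, where `N` is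
seen as a submanifold of `ℝ^ν` through `ι` (which plays no role when `s < 1`). -/
def sobolevEnergy {m ν : ℕ} {N : Type*} [EDist N] (ι : N → Euc ν) (s p : ℝ)
    (u : Euc m → N) (A : Set (Euc m)) : ℝ≥0∞ :=
  open Classical in
  if s = 1 then dirichletEnergy p (ι ∘ u) A else gagliardoEnergy s p u A

/-! ### Energies over `ℝ^m` with state space `N` -/

/-- An energy over `ℝ^m` with state space `N`: to each open set `A ⊆ ℝ^m` and each measurable map
`u : A → N` it assigns a value in `[0, +∞]`, which does not increase under restriction to a smaller
open set. (Values at sets that are not open or at maps that are not measurable play no role.) -/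
structure MapEnergy (m : ℕ) (N : Type*) [MeasurableSpace N] where
  toFun : (A : Set (Euc m)) → (A → N) → ℝ≥0∞
  mono : ∀ (A B : Set (Euc m)) (hAB : A ⊆ B), IsOpen A → IsOpen B →
    ∀ u : B → N, AEMeasurable u (volume.comap Subtype.val) →
      toFun A (u ∘ Set.inclusion hAB) ≤ toFun B u

namespace MapEnergy

variable {m : ℕ} {N : Type*} [MeasurableSpace N]

/-- `G.on u A` is the energy on `A` of the restriction of `u` to `A`. -/
def on (G : MapEnergy m N) (u : Euc m → N) (A : Set (Euc m)) : ℝ≥0∞ :=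
  G.toFun A (fun x : A ↦ u x)

/-- Superadditivity on pairs of open sets with disjoint closures. -/
def Superadditive (G : MapEnergy m N) : Prop :=
  ∀ u : Euc m → N, MeasOn u univ → ∀ A B : Set (Euc m), IsOpen A → IsOpen B →
    Disjoint (closure A) (closure B) → G.on u A + G.on u B ≤ G.on u (A ∪ B)

/-- The scaling law `G(u, h + r A) = r^(m - s p) G(u(h + r ·), A)`. -/
def Scaling (G : MapEnergy m N) (s p : ℝ) : Prop :=
  ∀ u : Euc m → N, MeasOn u univ → ∀ r : ℝ, 0 < r → ∀ (h : Euc m) (A : Set (Euc m)), IsOpen A →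
    G.on u ((fun x ↦ h + r • x) '' A) =
      ENNReal.ofReal (r ^ ((m : ℝ) - s * p)) * G.on (fun x ↦ u (h + r • x)) A

end MapEnergy

end

/-!
The energy `G` is superadditive and behaves under dilations by a factor `r` like the Sobolev energy,
which is multiplied by `r ^ (m - s p)`. Rescaled copies of maps inserted in disjoint balls therefore
add up both energies. Say that a value `b` attains `(e, g)` (`Attains`) when some map equal to `b` off
the ball of radius `1 / 2` has Sobolev energy at most `e` and energy `G` at least `g` on the unit ball.
If `b` attains `(e, g)` for all `e > 0` and `g < ∞`, then a sequence of such maps, inserted in a sequence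
of disjoint balls with summable Sobolev energies, gives a map with small Sobolev energy and
infinite `G` (`exists_on_eq_top`). The Sobolev energy of such a glued map is bounded by
`sobolevEnergy_glue_le`: in the nonlocal case through a pointwise triangle inequality, and for `s = 1`
by summing weak derivatives, with a Poincaré inequality giving the convergence of the series in `L¹`.

The maps `u n` have no prescribed behaviour near the boundary of the unit ball. They are turned into
maps which are constant near infinity by an opening: `opening h` is the identity on the unit ball, is
constant far away, and maps the whole space to the closed unit ball. It is obtained by translating and
pinching, followed by folding along the inversion in the unit sphere. For a fixed `h` the map
`u ∘ opening h` can have infinite energy, because `opening h` is constant on large sets and the constant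
is a value of `u` at a single point; on average over `h` in the unit ball, the energy is at most a constant
times that of `u` on the unit ball (`lintegral_opening_le`, `lintegral_gagliardoEnergy_opening_le`,
`lintegral_dirichletEnergy_opening_le`). A good choice of `h` thus costs a constant factor only
(`exists_eqOn_oball_sobolevEnergy_le`). Copies in the cells of a grid with `j ^ m` cells multiply both
energies by `j ^ (s p)`, up to constants (`exists_attains_grid`), so that, when `G` is much larger than the
Sobolev energy, one gets maps with a prescribed small Sobolev energy and large `G`
(`exists_attains_of_ratio`); the value at infinity is still out of control.

The value at infinity is changed by a transition: a Lipschitz path in the manifold, of constant any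
number larger than the distance of its end points (`exists_lipschitzOnWith_path`), is composed with a
cutoff function (`Attains.transition`). The three cases differ in the cost of this transition.
* When `s p < m`, the cost is finite, it is negligible with respect to the energy of a large number of
  copies, and the resulting map is shrunk, which makes its energy small (`attains_of_subcritical`).
* When `s p = m` and `s < m`, points have vanishing capacity: averaging `k` dilations of a cutoff function,
  at scales so separated that the increments hardly interact, multiplies its energy by about `k ^ (1 - p)`,
  and `p > 1` (`exists_isCutoff_scalarEnergy_le`). The cost is arbitrarily small (`attains_of_critical`).
* In the remaining case the values at infinity have a cluster point by compactness, and the transition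
  from a close value is cheap (`exists_attains_of_compactSpace`).
-/

/-! ### Folding and opening maps -/

lemma mem_oball {m : ℕ} {r : ℝ} {x : Euc m} : x ∈ oball m r ↔ ‖x‖ < r := mem_ball_zero_iff

lemma isOpen_oball {m : ℕ} {r : ℝ} : IsOpen (oball m r) := Metric.isOpen_ball

lemma measurableSet_oball {m : ℕ} {r : ℝ} : MeasurableSet (oball m r) :=
  isOpen_oball.measurableSet

lemma volume_oball_ne_top {m : ℕ} {r : ℝ} : volume (oball m r) ≠ ⊤ := measure_ball_lt_top.ne

/-- A Lipschitz map of `ℝ^m` increases the volume at most by the factor `K ^ m`. -/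
lemma volume_image_le_of_lipschitzOnWith {m : ℕ} {K : NNReal} {f : Euc m → Euc m} {S : Set (Euc m)}
    (hf : LipschitzOnWith K f S) : volume (f '' S) ≤ (K : ℝ≥0∞) ^ m * volume S := by
  have h := hf.hausdorffMeasure_image_le (d := (m : ℝ)) (by positivity)
  have hfr : Module.finrank ℝ (Euc m) = m := by simp
  have hH : Measure.IsAddHaarMeasure (Measure.hausdorffMeasure (X := Euc m) (m : ℝ)) := by
    have := MeasureTheory.isAddHaarMeasure_hausdorffMeasure (E := Euc m)
    rwa [hfr] at this
  rw [Measure.isAddLeftInvariant_eq_smul (volume : Measure (Euc m)) (Measure.hausdorffMeasure (m : ℝ))]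
  simp only [Measure.smul_apply, ENNReal.rpow_natCast] at h ⊢
  calc _ ≤ (Measure.addHaarScalarFactor volume (Measure.hausdorffMeasure (X := Euc m) (m : ℝ))) •
        ((K : ℝ≥0∞) ^ m * Measure.hausdorffMeasure (m : ℝ) S) := by gcongr
    _ = _ := by simp only [ENNReal.smul_def, smul_eq_mul]; ring

/-- The folding of `ℝ^m` onto the closed unit ball along the inversion in the unit sphere. -/
noncomputable def fold {m : ℕ} (z : Euc m) : Euc m :=
  open Classical in if ‖z‖ ≤ 1 then z else EuclideanGeometry.inversion 0 1 z

lemma fold_of_le {m : ℕ} {z : Euc m} (h : ‖z‖ ≤ 1) : fold z = z := if_pos h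

lemma fold_of_ge {m : ℕ} {z : Euc m} (h : 1 ≤ ‖z‖) :
    fold z = EuclideanGeometry.inversion 0 1 z := by
  rcases h.eq_or_lt with h | h
  · rw [fold_of_le h.symm.le, EuclideanGeometry.inversion_of_mem_sphere]
    simp [h.symm]
  · exact if_neg h.not_ge

lemma norm_inversion {m : ℕ} (z : Euc m) : ‖EuclideanGeometry.inversion 0 1 z‖ = 1 / ‖z‖ := by
  have := EuclideanGeometry.dist_inversion_center (0 : Euc m) z 1
  simpa using this

lemma norm_fold_le {m : ℕ} (z : Euc m) : ‖fold z‖ ≤ 1 := by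
  rcases le_total ‖z‖ 1 with h | h
  · rwa [fold_of_le h]
  · rw [fold_of_ge h, norm_inversion, div_le_one (by positivity)]
    exact h

/-- Inversion of a point outside the unit ball brings it closer to the points of the ball. -/
lemma norm_sub_fold_le {m : ℕ} {x y : Euc m} (hx : ‖x‖ ≤ 1) (hy : 1 ≤ ‖y‖) :
    ‖x - fold y‖ ≤ ‖x - y‖ := by
  have hy0 : ‖y‖ ≠ 0 := by positivity
  have hf : fold y = (‖y‖ ^ 2)⁻¹ • y := by
    rw [fold_of_ge hy]; simp [EuclideanGeometry.inversion]
  rw [hf]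
  refine le_of_sq_le_sq ?_ (norm_nonneg _) 
  rw [norm_sub_sq_real, norm_sub_sq_real, norm_smul, inner_smul_right]
  have hi : inner ℝ x y ≤ ‖y‖ := by
    calc inner ℝ x y ≤ ‖x‖ * ‖y‖ := real_inner_le_norm x y
      _ ≤ 1 * ‖y‖ := by gcongr
      _ = _ := one_mul _
  have h1 : (‖y‖ ^ 2)⁻¹ ≤ 1 := inv_le_one_of_one_le₀ (by nlinarith)
  have h2 : (‖y‖ ^ 2)⁻¹ * ‖y‖ ^ 2 = 1 := inv_mul_cancel₀ (by positivity)
  set a := (‖y‖ ^ 2)⁻¹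
  have h0 : 0 ≤ a := by positivity
  rw [norm_inv, norm_pow, norm_norm]
  change _ - 2 * (a * _) + (a * ‖y‖) ^ 2 ≤ _
  have : (a * ‖y‖) ^ 2 = a := by
    calc (a * ‖y‖) ^ 2 = a * (a * ‖y‖ ^ 2) := by ring
      _ = a := by rw [h2, mul_one]
  rw [this]
  nlinarith [mul_nonneg (sub_nonneg.2 h1) (by nlinarith [sq_nonneg (‖y‖ - 1)] :
    0 ≤ ‖y‖ ^ 2 + 1 - 2 * inner ℝ x y)]

lemma lipschitzWith_fold {m : ℕ} : LipschitzWith 1 (fold : Euc m → Euc m) := by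
  refine LipschitzWith.of_dist_le_mul fun x y ↦ ?_
  rw [NNReal.coe_one, one_mul]
  rcases le_total ‖x‖ 1 with hx | hx <;> rcases le_total ‖y‖ 1 with hy | hy
  · rw [fold_of_le hx, fold_of_le hy]
  · rw [fold_of_le hx, dist_eq_norm, dist_eq_norm]; exact norm_sub_fold_le hx hy
  · rw [fold_of_le hy, dist_comm, dist_comm x, dist_eq_norm, dist_eq_norm]
    exact norm_sub_fold_le hy hx
  · have hx0 : x ≠ 0 := fun h ↦ by simp [h] at hx; linarith
    have hy0 : y ≠ 0 := fun h ↦ by simp [h] at hy; linarith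
    rw [fold_of_ge hx, fold_of_ge hy, EuclideanGeometry.dist_inversion_inversion hx0 hy0]
    simp only [one_pow, dist_zero_right]
    refine mul_le_of_le_one_left dist_nonneg ?_
    rw [div_le_one (by positivity)]
    nlinarith

lemma measurable_fold {m : ℕ} : Measurable (fold : Euc m → Euc m) :=
  lipschitzWith_fold.continuous.measurable

lemma volume_closedBall_diff_oball {m : ℕ} (hm : 1 ≤ m) (S : Set (Euc m)) :
    volume (S ∩ Metric.closedBall 0 1) = volume (S ∩ oball m 1) := by
  have : Nonempty (Fin m) := ⟨⟨0, hm⟩⟩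
  have : Nontrivial (Euc m) := inferInstance
  refine le_antisymm ?_ (measure_mono (inter_subset_inter_right _ Metric.ball_subset_closedBall))
  rw [← Metric.ball_union_sphere, inter_union_distrib_left]
  refine (measure_union_le _ _).trans ?_
  rw [measure_mono_null inter_subset_right (Measure.addHaar_sphere volume (0 : Euc m) 1), add_zero]
  rfl

/-- Bounded sets are folded with bounded multiplicity: the inversion is Lipschitz away from `0`. -/
lemma map_fold_le {m : ℕ} (hm : 1 ≤ m) (K : ℝ) : ∃ C : ℝ≥0∞, C ≠ ⊤ ∧
    Measure.map fold (volume.restrict (oball m K)) ≤ C • volume.restrict (oball m 1) := by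
  set L : NNReal := (max K 1).toNNReal ^ 2
  refine ⟨1 + (L : ℝ≥0∞) ^ m, by finiteness, Measure.le_iff.2 fun S hS ↦ ?_⟩
  rw [Measure.map_apply measurable_fold hS, Measure.restrict_apply (measurable_fold hS),
    Measure.smul_apply, Measure.restrict_apply hS, ← volume_closedBall_diff_oball hm, smul_eq_mul,
    add_mul, one_mul]
  set I : Euc m → Euc m := EuclideanGeometry.inversion 0 1
  set A : Set (Euc m) := {z | (max K 1)⁻¹ ≤ ‖z‖}
  have hK : 0 < max K 1 := by positivity
  have hsub : fold ⁻¹' S ∩ oball m K ⊆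
      (S ∩ Metric.closedBall 0 1) ∪ I '' (S ∩ Metric.closedBall 0 1 ∩ A) := by
    rintro z ⟨hz, hzK⟩
    have hzK' : ‖z‖ < K := mem_oball.1 hzK
    rcases le_total ‖z‖ 1 with h | h
    · left
      rw [mem_preimage, fold_of_le h] at hz
      exact ⟨hz, by simpa using h⟩
    · right
      have hf := norm_fold_le z
      rw [mem_preimage] at hz
      rw [fold_of_ge h] at hz hf
      refine ⟨I z, ⟨⟨hz, by simpa using hf⟩, ?_⟩, EuclideanGeometry.inversion_inversion _ one_ne_zero _⟩
      change _ ≤ ‖I z‖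
      rw [norm_inversion, one_div]
      exact inv_anti₀ (by positivity) (hzK'.le.trans (le_max_left _ _))
  have hlip : LipschitzOnWith L I (S ∩ Metric.closedBall 0 1 ∩ A) := by
    refine LipschitzOnWith.of_dist_le_mul fun x hx y hy ↦ ?_
    have hxA : (max K 1)⁻¹ ≤ ‖x‖ := hx.2
    have hyA : (max K 1)⁻¹ ≤ ‖y‖ := hy.2
    have hpos : 0 < (max K 1)⁻¹ := by positivity
    have hx0 : x ≠ 0 := fun h ↦ by simp [h] at hxA; linarith
    have hy0 : y ≠ 0 := fun h ↦ by simp [h] at hyA; linarith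
    rw [EuclideanGeometry.dist_inversion_inversion hx0 hy0]
    simp only [one_pow, dist_zero_right]
    gcongr
    have : (L : ℝ) = (max K 1) ^ 2 := by
      simp [L, Real.coe_toNNReal _ hK.le]
    rw [this, div_le_iff₀ (by positivity)]
    calc (1 : ℝ) = (max K 1) ^ 2 * ((max K 1)⁻¹ * (max K 1)⁻¹) := by field_simp
      _ ≤ _ := by gcongr
  calc _ ≤ _ := measure_mono hsub
    _ ≤ _ := measure_union_le _ _
    _ ≤ _ := by
      gcongr
      exact (volume_image_le_of_lipschitzOnWith hlip).trans 
        (mul_le_mul_right (measure_mono inter_subset_left) _)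

/-- The retraction equal to the identity on the ball of radius `2` and to `0` off the
ball of radius `4`. -/
noncomputable def pinch {m : ℕ} (y : Euc m) : Euc m := max 0 (min 1 (2 - ‖y‖ / 2)) • y

lemma pinch_of_le {m : ℕ} {y : Euc m} (h : ‖y‖ ≤ 2) : pinch y = y := by
  rw [pinch, min_eq_left (by linarith), max_eq_right zero_le_one, one_smul]

lemma pinch_of_ge {m : ℕ} {y : Euc m} (h : 4 ≤ ‖y‖) : pinch y = 0 := by
  rw [pinch, max_eq_left, zero_smul]
  exact (min_le_right _ _).trans (by linarith)

lemma norm_pinch_le {m : ℕ} (y : Euc m) : ‖pinch y‖ ≤ 4 := by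
  rcases le_total 4 ‖y‖ with h | h
  · simp [pinch_of_ge h]
  · rw [pinch, norm_smul, Real.norm_of_nonneg (le_max_left _ _)]
    have : max 0 (min 1 (2 - ‖y‖ / 2)) ≤ 1 := max_le zero_le_one (min_le_left _ _)
    nlinarith [norm_nonneg y]

lemma lipschitzWith_pinch {m : ℕ} : LipschitzWith 3 (pinch : Euc m → Euc m) := by
  have key : ∀ x y : Euc m, ‖y‖ ≤ 4 → ‖pinch x - pinch y‖ ≤ 3 * ‖x - y‖ := by
    intro x y hy
    set a : Euc m → ℝ := fun y ↦ max 0 (min 1 (2 - ‖y‖ / 2))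
    have ha : |a x - a y| ≤ ‖x - y‖ / 2 := by
      have h1 : |a x - a y| ≤ |(2 - ‖x‖ / 2) - (2 - ‖y‖ / 2)| := by
        have h2 := abs_min_sub_min_le_max 1 (2 - ‖x‖ / 2) 1 (2 - ‖y‖ / 2)
        have h3 := abs_max_sub_max_le_max 0 (min 1 (2 - ‖x‖ / 2)) 0 (min 1 (2 - ‖y‖ / 2))
        simp only [sub_self, abs_zero, abs_nonneg, max_eq_right] at h2 h3
        exact h3.trans h2
      refine h1.trans ?_
      have := abs_norm_sub_norm_le x y
      rw [show (2 - ‖x‖ / 2) - (2 - ‖y‖ / 2) = -((‖x‖ - ‖y‖) / 2) by ring, abs_neg, abs_div,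
        abs_two]
      gcongr
    have ha1 : |a x| ≤ 1 := by
      rw [abs_of_nonneg (le_max_left _ _)]
      exact max_le zero_le_one (min_le_left _ _)
    have : pinch x - pinch y = a x • (x - y) + (a x - a y) • y := by
      simp only [pinch, a]; module
    rw [this]
    calc _ ≤ |a x| * ‖x - y‖ + |a x - a y| * ‖y‖ := by
          refine (norm_add_le _ _).trans ?_
          simp [norm_smul]
      _ ≤ 1 * ‖x - y‖ + ‖x - y‖ / 2 * 4 := by gcongr
      _ = _ := by ring
  refine LipschitzWith.of_dist_le_mul fun x y ↦ ?_
  rw [dist_eq_norm, dist_eq_norm]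
  change _ ≤ 3 * _
  rcases le_total ‖y‖ 4 with h | h
  · exact key x y h
  rcases le_total ‖x‖ 4 with h' | h'
  · rw [norm_sub_rev, norm_sub_rev x]; exact key y x h'
  · rw [pinch_of_ge h, pinch_of_ge h']; simp

/-- The opening map with parameter `h`: it has its values in the closed unit ball, is
the identity on the unit ball, and is constant off the ball of radius `5`. -/
noncomputable def opening {m : ℕ} (h x : Euc m) : Euc m := fold (pinch (x - h) + h)

lemma continuous_opening {m : ℕ} : Continuous fun q : Euc m × Euc m ↦ opening q.1 q.2 := by
  have h1 : Continuous (fold : Euc m → Euc m) := lipschitzWith_fold.continuous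
  have h2 : Continuous (pinch : Euc m → Euc m) := lipschitzWith_pinch.continuous
  unfold opening
  fun_prop

lemma lipschitzWith_opening {m : ℕ} (h : Euc m) : LipschitzWith 3 (opening h) := by
  have h1 : LipschitzWith 1 fun x : Euc m ↦ x - h := by
    refine LipschitzWith.of_dist_le_mul fun x y ↦ by simp
  have h2 : LipschitzWith 1 fun x : Euc m ↦ x + h := by
    refine LipschitzWith.of_dist_le_mul fun x y ↦ by simp
  have := lipschitzWith_fold.comp (h2.comp (lipschitzWith_pinch.comp h1))
  simpa using! this

lemma norm_opening_le {m : ℕ} (h x : Euc m) : ‖opening h x‖ ≤ 1 := norm_fold_le _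

lemma opening_of_lt {m : ℕ} {h x : Euc m} (hh : ‖h‖ < 1) (hx : ‖x‖ ≤ 1) : opening h x = x := by
  rw [opening, pinch_of_le ((norm_sub_le _ _).trans (by linarith)), sub_add_cancel, fold_of_le hx]

lemma opening_of_ge {m : ℕ} {h x : Euc m} (hh : ‖h‖ < 1) (hx : 5 ≤ ‖x‖) : opening h x = h := by
  have : ‖x‖ - ‖h‖ ≤ ‖x - h‖ := norm_sub_norm_le x h
  rw [opening, pinch_of_ge (by linarith), zero_add, fold_of_le hh.le]

/-- Bounded multiplicity of the folding, for integrals. -/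
lemma lintegral_fold_le {m : ℕ} (hm : 1 ≤ m) (K : ℝ) : ∃ C : ℝ≥0∞, C ≠ ⊤ ∧
    ∀ F : Euc m → ℝ≥0∞, Measurable F →
      ∫⁻ x in oball m K, F (fold x) ≤ C * ∫⁻ x in oball m 1, F x := by
  obtain ⟨C, hC, h⟩ := map_fold_le hm K
  refine ⟨C, hC, fun F hF ↦ ?_⟩
  rw [← lintegral_map hF measurable_fold]
  refine (lintegral_mono' h le_rfl).trans ?_
  rw [lintegral_smul_measure, smul_eq_mul]

/-- Although a single opening map may collapse sets of positive measure, the opening maps with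
parameters in the unit ball compress bounded sets by a bounded factor on average. -/
lemma lintegral_opening_le {m : ℕ} (hm : 1 ≤ m) (K : ℝ) : ∃ C : ℝ≥0∞, C ≠ ⊤ ∧
    ∀ F : Euc m → ℝ≥0∞, Measurable F →
      ∫⁻ h in oball m 1, ∫⁻ x in oball m K, F (opening h x) ≤ C * ∫⁻ x in oball m 1, F x := by
  obtain ⟨C, hC, hF⟩ := lintegral_fold_le hm 5
  have hB : volume (oball m (K + 1)) ≠ ⊤ := volume_oball_ne_top
  refine ⟨volume (oball m (K + 1)) * C, by finiteness, fun F hFm ↦ ?_⟩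
  have hO : Measurable fun q : Euc m × Euc m ↦ F (fold (pinch q.2 + q.1)) := by
    have h1 : Measurable (fold : Euc m → Euc m) := measurable_fold
    have h2 : Measurable (pinch : Euc m → Euc m) := lipschitzWith_pinch.continuous.measurable
    fun_prop
  calc ∫⁻ h in oball m 1, ∫⁻ x in oball m K, F (opening h x)
      ≤ ∫⁻ h in oball m 1, ∫⁻ y in oball m (K + 1), F (fold (pinch y + h)) := by
        refine setLIntegral_mono' measurableSet_oball fun h hh ↦ ?_
        rw [← lintegral_indicator measurableSet_oball,
          ← lintegral_indicator measurableSet_oball,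
          ← lintegral_sub_right_eq_self (fun y ↦ (oball m (K + 1)).indicator _ y) h]
        refine lintegral_mono fun x ↦ ?_
        by_cases hx : x ∈ oball m K
        · have : x - h ∈ oball m (K + 1) := by
            rw [mem_oball] at hx hh ⊢
            exact (norm_sub_le _ _).trans_lt (by linarith)
          simp only [indicator_of_mem this, indicator_of_mem hx, opening, le_refl]
        · simp [indicator_of_notMem hx]
    _ = ∫⁻ y in oball m (K + 1), ∫⁻ h in oball m 1, F (fold (pinch y + h)) :=
        lintegral_lintegral_swap hO.aemeasurable
    _ ≤ ∫⁻ y in oball m (K + 1), C * ∫⁻ x in oball m 1, F x := by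
        refine lintegral_mono fun y ↦ (hF F hFm).trans' ?_
        rw [← lintegral_indicator measurableSet_oball,
          ← lintegral_indicator measurableSet_oball,
          ← lintegral_add_left_eq_self (fun y ↦ (oball m 5).indicator _ y) (pinch y)]
        refine lintegral_mono fun h ↦ ?_
        by_cases hh : h ∈ oball m 1
        · have : pinch y + h ∈ oball m 5 := by
            rw [mem_oball] at hh ⊢
            exact (norm_add_le _ _).trans_lt (by linarith [norm_pinch_le y])
          simp only [indicator_of_mem this, indicator_of_mem hh, le_refl]
        · simp [indicator_of_notMem hh]
    _ = _ := by rw [setLIntegral_const]; ring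

/-! ### The Gagliardo energy of opened maps -/

lemma lintegral_comp_add_smul {m : ℕ} (f : Euc m → ℝ≥0∞) (a : Euc m) {r : ℝ} (hr : 0 < r) :
    ∫⁻ x, f (a + r • x) = (ENNReal.ofReal r ^ m)⁻¹ * ∫⁻ x, f x := by
  have h1 : ∫⁻ x, f (a + r • x) = ∫⁻ x, f (a + x) ∂(Measure.map (r • ·) volume) := by
    exact ((Homeomorph.smulOfNeZero r hr.ne').toMeasurableEquiv.measurableEmbedding.lintegral_map
      (fun x ↦ f (a + x))).symm
  rw [h1, Measure.map_addHaar_smul volume hr.ne', lintegral_smul_measure,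
    lintegral_add_left_eq_self f a, smul_eq_mul]
  simp only [finrank_euclideanSpace, Fintype.card_fin]
  rw [abs_of_pos (by positivity), ENNReal.ofReal_inv_of_pos (by positivity),
    ENNReal.ofReal_pow hr.le]

/-- The tails of the integral of `|w| ^ (-α)`, for `α > m`, computed by scaling. -/
lemma lintegral_tail_le {m : ℕ} {α : ℝ} (hα : (m : ℝ) < α) : ∃ T : ℝ≥0∞, T ≠ ⊤ ∧
    ∀ ρ : ℝ, 0 < ρ → ∫⁻ w in {w : Euc m | ρ < ‖w‖}, (‖w‖ₑ ^ α)⁻¹ ≤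
      T * (ENNReal.ofReal ρ ^ (α - m))⁻¹ := by
  have hα0 : 0 < α := lt_of_le_of_lt (Nat.cast_nonneg m) hα
  have hmeas : ∀ ρ : ℝ, MeasurableSet {w : Euc m | ρ < ‖w‖} := fun ρ ↦
    measurableSet_lt measurable_const measurable_norm
  refine ⟨∫⁻ w in {w : Euc m | 1 < ‖w‖}, (‖w‖ₑ ^ α)⁻¹, ?_, fun ρ hρ ↦ ?_⟩
  · have hfin := finite_integral_one_add_norm (E := Euc m) (μ := volume) (r := α) (by simpa using hα)
    refine ne_top_of_le_ne_top (ENNReal.mul_ne_top (ENNReal.ofReal_ne_top (r := 2 ^ α)) hfin.ne) ?_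
    rw [← lintegral_const_mul' _ _ ENNReal.ofReal_ne_top]
    refine (setLIntegral_mono' (hmeas 1) fun w hw ↦ ?_).trans (setLIntegral_le_lintegral _ _)
    have hw1 : 1 < ‖w‖ := hw
    rw [← ENNReal.ofReal_mul (by positivity), ← ofReal_norm,
      ENNReal.ofReal_rpow_of_pos (by positivity), ← ENNReal.ofReal_inv_of_pos (by positivity)]
    refine ENNReal.ofReal_le_ofReal ?_
    rw [Real.rpow_neg (by positivity), ← div_eq_mul_inv, ← Real.div_rpow (by positivity) (by positivity),
      ← Real.inv_rpow (by positivity)]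
    refine Real.rpow_le_rpow (by positivity) ?_ hα0.le
    rw [inv_eq_one_div, div_le_div_iff₀ (by positivity) (by positivity)]
    linarith
  · set f : Euc m → ℝ≥0∞ := {w : Euc m | ρ < ‖w‖}.indicator fun w ↦ (‖w‖ₑ ^ α)⁻¹
    have h0 : ENNReal.ofReal ρ ≠ 0 := by simpa using hρ
    have h := lintegral_comp_add_smul f 0 hρ
    have h2 : ∫⁻ w, f w = ENNReal.ofReal ρ ^ m * ∫⁻ w, f (0 + ρ • w) := by
      rw [h, ← mul_assoc, ENNReal.mul_inv_cancel (by positivity) (by finiteness), one_mul]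
    rw [← lintegral_indicator (hmeas ρ), h2, ← lintegral_indicator (hmeas 1)]
    have h3 : ∀ w : Euc m, f (0 + ρ • w) =
        (ENNReal.ofReal ρ ^ α)⁻¹ * {w : Euc m | 1 < ‖w‖}.indicator (fun w ↦ (‖w‖ₑ ^ α)⁻¹) w := by
      intro w
      have hn : ‖0 + ρ • w‖ = ρ * ‖w‖ := by rw [zero_add, norm_smul, Real.norm_of_nonneg hρ.le]
      have hn' : ‖0 + ρ • w‖ₑ = ENNReal.ofReal ρ * ‖w‖ₑ := by
        rw [← ofReal_norm, hn, ENNReal.ofReal_mul hρ.le, ofReal_norm]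
      by_cases hw : 1 < ‖w‖
      · have : ρ < ‖0 + ρ • w‖ := by rw [hn]; nlinarith
        simp only [f]
        rw [indicator_of_mem (show 0 + ρ • w ∈ {w : Euc m | ρ < ‖w‖} from this),
          indicator_of_mem (show w ∈ {w : Euc m | 1 < ‖w‖} from hw), hn',
          ENNReal.mul_rpow_of_nonneg _ _ hα0.le, ENNReal.mul_inv]
        · left; positivity
        · left; finiteness
      · have : ¬ ρ < ‖0 + ρ • w‖ := by rw [hn]; nlinarith
        simp only [f]
        rw [indicator_of_notMem (show 0 + ρ • w ∉ {w : Euc m | ρ < ‖w‖} from this),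
          indicator_of_notMem (show w ∉ {w : Euc m | 1 < ‖w‖} from hw), mul_zero]
    simp_rw [h3]
    rw [lintegral_const_mul' _ _ (by simp [h0]), ← mul_assoc, mul_comm]
    gcongr
    rw [ENNReal.rpow_sub _ _ h0 ENNReal.ofReal_ne_top, ENNReal.rpow_natCast, ENNReal.inv_div]
    · rw [div_eq_mul_inv]
    · left; finiteness
    · left; positivity

section

variable {m : ℕ} {N : Type*} [MetricSpace N] [MeasurableSpace N] [BorelSpace N]
  [SecondCountableTopology N]

lemma edist_rpow_le {N : Type*} [PseudoEMetricSpace N] {p : ℝ} (hp : 1 ≤ p) (a b c : N) :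
    edist a c ^ p ≤ 2 ^ (p - 1) * (edist a b ^ p + edist b c ^ p) :=
  (ENNReal.rpow_le_rpow (edist_triangle a b c) (by linarith)).trans
    (ENNReal.rpow_add_le_mul_rpow_add_rpow _ _ hp)

/-- The energy of increments of `v` by the vector `k`, over the ball of radius `5`. -/
noncomputable def incrementEnergy (p : ℝ) (v : Euc m → N) (k : Euc m) : ℝ≥0∞ :=
  ∫⁻ z in oball m 5, edist (v z) (v (z + k)) ^ p

lemma measurable_incrementEnergy {v : Euc m → N} (hv : Measurable v) (p : ℝ) :
    Measurable (incrementEnergy p v) := by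
  unfold incrementEnergy
  refine Measurable.lintegral_prod_right' (f := fun q : Euc m × Euc m ↦
    edist (v q.2) (v (q.2 + q.1)) ^ p) ?_
  fun_prop

omit [MeasurableSpace N] [BorelSpace N] [SecondCountableTopology N] in
lemma lintegral_translate_le_incrementEnergy (p : ℝ) (v : Euc m → N) {a : Euc m} (ha : ‖a‖ ≤ 4)
    (k : Euc m) :
    ∫⁻ h in oball m 1, edist (v (a + h)) (v (a + h + k)) ^ p ≤ incrementEnergy p v k := by
  unfold incrementEnergy
  rw [← lintegral_indicator measurableSet_oball, ← lintegral_indicator measurableSet_oball,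
    ← lintegral_add_left_eq_self (fun y ↦ (oball m 5).indicator _ y) a]
  refine lintegral_mono fun h ↦ ?_
  by_cases hh : h ∈ oball m 1
  · have : a + h ∈ oball m 5 := by
      rw [mem_oball] at hh ⊢
      exact (norm_add_le _ _).trans_lt (by linarith)
    simp only [indicator_of_mem this, indicator_of_mem hh, le_refl]
  · simp [indicator_of_notMem hh]

/-- Averaged over translations, the distance between the values of `v` at two points is controlled
by the increments of `v` at comparable scales, by averaging over intermediate points. -/
lemma lintegral_edist_translate_le {p : ℝ} (hp : 1 ≤ p) {v : Euc m → N} (hv : Measurable v)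
    {a b : Euc m} (ha : ‖a‖ ≤ 4) (hb : ‖b‖ ≤ 4) {r : ℝ} (hab : ‖a - b‖ ≤ 8 * r) :
    volume (oball m r) * ∫⁻ h in oball m 1, edist (v (a + h)) (v (b + h)) ^ p ≤
      2 ^ p * ∫⁻ k in oball m (9 * r), incrementEnergy p v k := by
  rcases le_or_gt r 0 with hr | hr
  · simp [oball, Metric.ball_eq_empty.2 hr]
  have h1 : ∫⁻ k in oball m r, incrementEnergy p v k ≤
      ∫⁻ k in oball m (9 * r), incrementEnergy p v k :=
    lintegral_mono_set (Metric.ball_subset_ball (by linarith))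
  have h2 : ∫⁻ k in oball m r, incrementEnergy p v (a - b + k) ≤
      ∫⁻ k in oball m (9 * r), incrementEnergy p v k := by
    rw [← lintegral_indicator measurableSet_oball, ← lintegral_indicator measurableSet_oball,
      ← lintegral_add_left_eq_self (fun y ↦ (oball m (9 * r)).indicator _ y) (a - b)]
    refine lintegral_mono fun h ↦ ?_
    by_cases hh : h ∈ oball m r
    · have : a - b + h ∈ oball m (9 * r) := by
        rw [mem_oball] at hh ⊢
        exact (norm_add_le _ _).trans_lt (by linarith)
      simp only [indicator_of_mem this, indicator_of_mem hh, le_refl]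
    · simp [indicator_of_notMem hh]
  calc volume (oball m r) * ∫⁻ h in oball m 1, edist (v (a + h)) (v (b + h)) ^ p
      = ∫⁻ k in oball m r, ∫⁻ h in oball m 1, edist (v (a + h)) (v (b + h)) ^ p := by
        rw [setLIntegral_const, mul_comm]
    _ ≤ ∫⁻ k in oball m r, 2 ^ (p - 1) *
          (incrementEnergy p v k + incrementEnergy p v (a - b + k)) := by
        refine lintegral_mono fun k ↦ ?_
        calc ∫⁻ h in oball m 1, edist (v (a + h)) (v (b + h)) ^ p
            ≤ ∫⁻ h in oball m 1, 2 ^ (p - 1) * (edist (v (a + h)) (v (a + h + k)) ^ p +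
                edist (v (b + h)) (v (b + h + (a - b + k))) ^ p) := by
              refine lintegral_mono fun h ↦ ?_
              have := edist_rpow_le hp (v (a + h)) (v (a + h + k)) (v (b + h))
              rw [edist_comm (v (a + h + k))] at this
              rwa [show b + h + (a - b + k) = a + h + k by abel]
          _ ≤ _ := by
              rw [lintegral_const_mul _ (by fun_prop), lintegral_add_left (by fun_prop)]
              gcongr
              · exact lintegral_translate_le_incrementEnergy p v ha k
              · exact lintegral_translate_le_incrementEnergy p v hb _
    _ = 2 ^ (p - 1) * ((∫⁻ k in oball m r, incrementEnergy p v k) +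
          ∫⁻ k in oball m r, incrementEnergy p v (a - b + k)) := by
        have hmi := measurable_incrementEnergy hv p
        rw [lintegral_const_mul _ (by fun_prop), lintegral_add_left (by fun_prop)]
    _ ≤ 2 ^ (p - 1) * ((∫⁻ k in oball m (9 * r), incrementEnergy p v k) +
          ∫⁻ k in oball m (9 * r), incrementEnergy p v k) := by gcongr _ * (?_ + ?_)
    _ = _ := by
        rw [← two_mul, ← mul_assoc]
        congr 1
        conv_lhs => rw [← ENNReal.rpow_one 2, ← ENNReal.rpow_mul, one_mul]
        rw [← ENNReal.rpow_add _ _ two_ne_zero ENNReal.ofNat_ne_top, sub_add_cancel]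


/-- The Gagliardo energy of increments controls the average over `h` of the energies of the maps
`v (pinch · + h)`, up to the position of the base point. -/
lemma lintegral_kernel_le (hm : 1 ≤ m) {s p : ℝ} (hs : 0 < s) (hp : 1 ≤ p) : ∃ C : ℝ≥0∞, C ≠ ⊤ ∧
    ∀ v : Euc m → N, Measurable v → ∀ x : Euc m,
      ∫⁻ y, ∫⁻ h in oball m 1,
          edist (v (pinch x + h)) (v (pinch y + h)) ^ p / edist x y ^ ((m : ℝ) + s * p) ≤
        C * ∫⁻ k in oball m 9, incrementEnergy p v k / ‖k‖ₑ ^ ((m : ℝ) + s * p) := by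
  have : Nonempty (Fin m) := ⟨⟨0, hm⟩⟩
  set α : ℝ := (m : ℝ) + s * p with hα
  have hsp : 0 < s * p := by positivity
  have hα0 : 0 < α := by positivity
  have hαm : α - m = s * p := by rw [hα]; ring
  obtain ⟨T, hT, hTail⟩ := lintegral_tail_le (m := m) (α := α) (by rw [hα]; linarith)
  set c₁ := volume (oball m 1)
  have hc₁0 : c₁ ≠ 0 := (Metric.measure_ball_pos volume _ one_pos).ne'
  have hc₁ : c₁ ≠ ⊤ := volume_oball_ne_top
  refine ⟨2 ^ p * c₁⁻¹ * (9 ^ α * T), by finiteness, fun v hv x ↦ ?_⟩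
  have hF := measurable_incrementEnergy hv p
  set F := incrementEnergy p v
  -- the set of pairs `(w, k)` such that `k` is at most comparable to the vector `w` and bounded
  set S : Set (Euc m × Euc m) := {q | ‖q.2‖ < 9 * min ‖q.1‖ 1}
  have hS : MeasurableSet S := measurableSet_lt (by fun_prop) (by fun_prop)
  set W : Euc m → Euc m → ℝ≥0∞ := fun w k ↦ (‖w‖ₑ ^ α)⁻¹ *
    (S.indicator (fun q ↦ (9 / ‖q.2‖ₑ) ^ m * F q.2) (w, k))
  have hWm : Measurable (Function.uncurry W) :=
    Measurable.mul (by fun_prop) (Measurable.indicator (by fun_prop) hS)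
  have hstep : ∀ y, ∫⁻ h in oball m 1,
      edist (v (pinch x + h)) (v (pinch y + h)) ^ p / edist x y ^ α ≤
        2 ^ p * c₁⁻¹ * ∫⁻ k, W (y - x) k := by
    intro y
    rcases eq_or_ne x y with rfl | hxy
    · simp [hα0, show 0 < p by linarith]
    set w := y - x
    have hw : 0 < ‖w‖ := norm_pos_iff.2 (sub_ne_zero.2 hxy.symm)
    have hd : edist x y = ‖w‖ₑ := by rw [edist_comm, edist_eq_enorm_sub]
    set r := min ‖w‖ 1
    have hr : 0 < r := lt_min hw one_pos
    have hab : ‖pinch x - pinch y‖ ≤ 8 * r := by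
      have h1 := lipschitzWith_pinch.dist_le_mul x y
      rw [dist_eq_norm, dist_comm, dist_eq_norm] at h1
      have h2 : ‖pinch x - pinch y‖ ≤ 4 + 4 :=
        (norm_sub_le _ _).trans (add_le_add (norm_pinch_le x) (norm_pinch_le y))
      change _ ≤ 3 * ‖w‖ at h1
      rcases min_cases ‖w‖ 1 with h | h <;> simp only [r, h] <;> linarith
    have key := lintegral_edist_translate_le hp hv (norm_pinch_le x) (norm_pinch_le y) hab
    have hvol : volume (oball m r) = ENNReal.ofReal r ^ m * c₁ := by
      have := Measure.addHaar_ball (volume : Measure (Euc m)) 0 hr.le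
      simpa [ENNReal.ofReal_pow hr.le] using! this
    have hr0 : ENNReal.ofReal r ≠ 0 := by simpa using hr
    rw [hvol, mul_comm, ← ENNReal.le_div_iff_mul_le (by left; positivity) (by left; finiteness)] at key
    simp_rw [div_eq_mul_inv, hd]
    rw [lintegral_mul_const _ (by fun_prop)]
    simp only [W]
    rw [lintegral_const_mul _ (by exact (Measurable.indicator (by fun_prop) hS).comp (by fun_prop))]
    calc _ ≤ 2 ^ p * (∫⁻ k in oball m (9 * r), F k) / (ENNReal.ofReal r ^ m * c₁) * (‖w‖ₑ ^ α)⁻¹ := by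
          gcongr
      _ = 2 ^ p * c₁⁻¹ * ((‖w‖ₑ ^ α)⁻¹ * ((ENNReal.ofReal r ^ m)⁻¹ * (∫⁻ k in oball m (9 * r), F k))) := by
          rw [div_eq_mul_inv, ENNReal.mul_inv (by right; exact hc₁) (by right; exact hc₁0)]
          ring
      _ ≤ _ := by
          gcongr
          rw [← lintegral_const_mul _ hF, ← lintegral_indicator measurableSet_oball]
          refine lintegral_mono fun k ↦ ?_
          by_cases hk : k ∈ oball m (9 * r)
          · have hk' : (w, k) ∈ S := mem_oball.1 hk
            rw [indicator_of_mem hk, indicator_of_mem hk']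
            gcongr
            rw [ENNReal.inv_pow]
            change _ ≤ (9 / ‖k‖ₑ) ^ m
            gcongr
            rw [← ofReal_norm, ← ENNReal.inv_div (by simp) (by simp)]
            gcongr
            refine ENNReal.div_le_of_le_mul ?_
            rw [show (9 : ℝ≥0∞) = ENNReal.ofReal 9 by simp, ← ENNReal.ofReal_mul hr.le]
            exact ENNReal.ofReal_le_ofReal (by linarith [mem_oball.1 hk])
          · simp [indicator_of_notMem hk]
  calc _ ≤ ∫⁻ y, 2 ^ p * c₁⁻¹ * ∫⁻ k, W (y - x) k := lintegral_mono hstep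
    _ = 2 ^ p * c₁⁻¹ * ∫⁻ y, ∫⁻ k, W (y - x) k :=
        lintegral_const_mul' _ _ (by finiteness)
    _ = 2 ^ p * c₁⁻¹ * ∫⁻ w, ∫⁻ k, W w k := by
        rw [lintegral_sub_right_eq_self (fun w ↦ ∫⁻ k, W w k) x]
    _ = 2 ^ p * c₁⁻¹ * ∫⁻ k, ∫⁻ w, W w k := by
        rw [lintegral_lintegral_swap hWm.aemeasurable]
    _ ≤ 2 ^ p * c₁⁻¹ * ∫⁻ k, (oball m 9).indicator (fun k ↦ 9 ^ α * T * (F k / ‖k‖ₑ ^ α)) k := by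
        gcongr with k
        rcases eq_or_ne k 0 with rfl | hk
        · have hF0 : F 0 = 0 := by simp [F, incrementEnergy, show 0 < p by linarith]
          simp [W, hF0, indicator]
        by_cases hk9 : k ∈ oball m 9
        swap
        · rw [indicator_of_notMem hk9, lintegral_eq_zero_of_ae_eq_zero]
          refine Eventually.of_forall fun w ↦ ?_
          have : (w, k) ∉ S := fun h ↦ hk9 (mem_oball.2 (lt_of_lt_of_le h (by
            have := min_le_right ‖w‖ 1
            simp only
            linarith)))
          simp [W, indicator_of_notMem this]
        have hk0 : 0 < ‖k‖ := norm_pos_iff.2 hk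
        rw [indicator_of_mem hk9]
        calc ∫⁻ w, W w k ≤ ∫⁻ w, (9 / ‖k‖ₑ) ^ m * F k *
              {w : Euc m | ‖k‖ / 9 < ‖w‖}.indicator (fun w ↦ (‖w‖ₑ ^ α)⁻¹) w := by
              refine lintegral_mono fun w ↦ ?_
              by_cases hwk : (w, k) ∈ S
              · have : w ∈ {w : Euc m | ‖k‖ / 9 < ‖w‖} := by
                  have h1 : ‖k‖ < 9 * min ‖w‖ 1 := hwk
                  have h2 := min_le_left ‖w‖ 1
                  rw [mem_ofPred_eq]
                  linarith
                rw [indicator_of_mem this]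
                simp only [W]
                rw [indicator_of_mem hwk, mul_comm]
              · simp [W, indicator_of_notMem hwk]
          _ = (9 / ‖k‖ₑ) ^ m * F k * ∫⁻ w in {w : Euc m | ‖k‖ / 9 < ‖w‖}, (‖w‖ₑ ^ α)⁻¹ := by
              have hms : MeasurableSet {w : Euc m | ‖k‖ / 9 < ‖w‖} :=
                measurableSet_lt measurable_const measurable_norm
              rw [lintegral_const_mul _ (Measurable.indicator (by fun_prop) hms),
                lintegral_indicator hms]
          _ ≤ (9 / ‖k‖ₑ) ^ m * F k * (T * (ENNReal.ofReal (‖k‖ / 9) ^ (α - m))⁻¹) := by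
              gcongr
              exact hTail _ (by positivity)
          _ = _ := by
              have e1 : ENNReal.ofReal (‖k‖ / 9) = (9 / ‖k‖ₑ)⁻¹ := by
                rw [ENNReal.ofReal_div_of_pos (by norm_num), ofReal_norm,
                  ENNReal.inv_div (by simp) (by simp)]
                simp
              have hq : 9 / ‖k‖ₑ ≠ ⊤ := ENNReal.div_ne_top (by simp) (by simpa using hk)
              have hq0 : 9 / ‖k‖ₑ ≠ 0 := (ENNReal.div_pos (by simp) (by simp)).ne'
              have e2 : (9 / ‖k‖ₑ) ^ m * (9 / ‖k‖ₑ) ^ (α - m) = 9 ^ α / ‖k‖ₑ ^ α := by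
                rw [← ENNReal.div_rpow_of_nonneg _ _ hα0.le, ← ENNReal.rpow_natCast,
                  ← ENNReal.rpow_add _ _ hq0 hq]
                congr 1; ring
              rw [e1, ENNReal.inv_rpow, inv_inv]
              calc _ = ((9 / ‖k‖ₑ) ^ m * (9 / ‖k‖ₑ) ^ (α - m)) * F k * T := by ring
                _ = _ := by rw [e2, div_eq_mul_inv, div_eq_mul_inv]; ring
    _ = _ := by
        rw [lintegral_indicator measurableSet_oball, lintegral_const_mul' _ _ (by finiteness)]
        ring

/-- A symmetric double integral whose integrand vanishes off `S` is controlled by the pairs of points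
the first of which is in `S`. -/
lemma lintegral_lintegral_le_two_mul {X : Type*} [MeasurableSpace X] {μ : Measure X} [SFinite μ]
    {G : X → X → ℝ≥0∞} (hG : Measurable (Function.uncurry G)) (hsymm : ∀ x y, G x y = G y x)
    {S : Set X} (hS : MeasurableSet S) (h0 : ∀ x ∉ S, ∀ y ∉ S, G x y = 0) :
    ∫⁻ x, ∫⁻ y, G x y ∂μ ∂μ ≤ 2 * ∫⁻ x in S, ∫⁻ y, G x y ∂μ ∂μ := by
  set H : X → X → ℝ≥0∞ := fun x y ↦ S.indicator (fun x ↦ G x y) x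
  have hH : Measurable (Function.uncurry H) :=
    Measurable.indicator (s := {q : X × X | q.1 ∈ S}) hG (measurable_fst hS)
  have hle : ∀ x y, G x y ≤ H x y + H y x := by
    intro x y
    by_cases hx : x ∈ S
    · simp [H, indicator_of_mem hx]
    by_cases hy : y ∈ S
    · simp [H, indicator_of_mem hy, hsymm x y]
    simp [h0 x hx y hy]
  have hI : ∫⁻ x, ∫⁻ y, H x y ∂μ ∂μ = ∫⁻ x in S, ∫⁻ y, G x y ∂μ ∂μ := by
    rw [← lintegral_indicator hS]
    refine lintegral_congr fun x ↦ ?_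
    by_cases hx : x ∈ S <;> simp [H, hx]
  have hI' : ∫⁻ x, ∫⁻ y, H y x ∂μ ∂μ = ∫⁻ x in S, ∫⁻ y, G x y ∂μ ∂μ := by
    rw [← hI]
    exact lintegral_lintegral_swap (hH.comp measurable_swap).aemeasurable
  calc _ ≤ ∫⁻ x, ∫⁻ y, (H x y + H y x) ∂μ ∂μ := by gcongr; exact hle _ _
    _ = ∫⁻ x, ((∫⁻ y, H x y ∂μ) + ∫⁻ y, H y x ∂μ) ∂μ :=
        lintegral_congr fun x ↦ lintegral_add_left (hH.comp measurable_prodMk_left) _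
    _ = (∫⁻ x, ∫⁻ y, H x y ∂μ ∂μ) + ∫⁻ x, ∫⁻ y, H y x ∂μ ∂μ :=
        lintegral_add_left hH.lintegral_prod_right' _
    _ = _ := by rw [hI, hI', two_mul]

/-- The increments of a folded map are controlled by its Gagliardo energy. -/
lemma lintegral_incrementEnergy_fold_le (hm : 1 ≤ m) {s p : ℝ} (hs : 0 < s) (hp : 1 ≤ p) :
    ∃ C : ℝ≥0∞, C ≠ ⊤ ∧ ∀ u : Euc m → N, Measurable u →
      ∫⁻ k in oball m 9, incrementEnergy p (u ∘ fold) k / ‖k‖ₑ ^ ((m : ℝ) + s * p) ≤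
        C * gagliardoEnergy s p u (oball m 1) := by
  obtain ⟨D, hD, hfold⟩ := lintegral_fold_le hm 14
  set α : ℝ := (m : ℝ) + s * p with hα
  have hα0 : 0 < α := by positivity
  have hp0 : 0 < p := by linarith
  refine ⟨D * D, by finiteness, fun u hu ↦ ?_⟩
  have hfm : Measurable (fold : Euc m → Euc m) := measurable_fold
  set v := u ∘ (fold : Euc m → Euc m)
  have hv : Measurable v := hu.comp hfm
  calc ∫⁻ k in oball m 9, incrementEnergy p v k / ‖k‖ₑ ^ α
      = ∫⁻ k in oball m 9, ∫⁻ z in oball m 5, edist (v z) (v (z + k)) ^ p / ‖k‖ₑ ^ α := by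
        refine lintegral_congr fun k ↦ ?_
        simp only [incrementEnergy, div_eq_mul_inv]
        rw [lintegral_mul_const _ (by fun_prop)]
    _ = ∫⁻ z in oball m 5, ∫⁻ k in oball m 9, edist (v z) (v (z + k)) ^ p / ‖k‖ₑ ^ α :=
        lintegral_lintegral_swap (by fun_prop)
    _ ≤ ∫⁻ z in oball m 5, ∫⁻ y in oball m 14, edist (v z) (v y) ^ p / edist z y ^ α := by
        refine setLIntegral_mono' measurableSet_oball fun z hz ↦ ?_
        rw [← lintegral_indicator measurableSet_oball, ← lintegral_indicator measurableSet_oball,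
          ← lintegral_add_left_eq_self (fun y ↦ (oball m 14).indicator _ y) z]
        refine lintegral_mono fun k ↦ ?_
        by_cases hk : k ∈ oball m 9
        · have : z + k ∈ oball m 14 := by
            rw [mem_oball] at hz hk ⊢
            exact (norm_add_le _ _).trans_lt (by linarith)
          rw [indicator_of_mem this, indicator_of_mem hk, edist_comm z, edist_eq_enorm_sub (z + k),
            add_sub_cancel_left]
        · simp [indicator_of_notMem hk]
    _ ≤ ∫⁻ z in oball m 14, ∫⁻ y in oball m 14, edist (v z) (v y) ^ p / edist z y ^ α :=
        lintegral_mono_set (Metric.ball_subset_ball (by norm_num))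
    _ ≤ ∫⁻ z in oball m 14, ∫⁻ y in oball m 14,
          edist (u (fold z)) (u (fold y)) ^ p / edist (fold z) (fold y) ^ α := by
        gcongr with z y
        · exact le_rfl
        · simpa using lipschitzWith_fold.edist_le_mul z y
    _ ≤ ∫⁻ z in oball m 14, D * ∫⁻ y in oball m 1,
          edist (u (fold z)) (u y) ^ p / edist (fold z) y ^ α := by
        gcongr with z
        exact hfold (fun y ↦ edist (u (fold z)) (u y) ^ p / edist (fold z) y ^ α) (by fun_prop)
    _ = D * ∫⁻ z in oball m 14, ∫⁻ y in oball m 1,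
          edist (u (fold z)) (u y) ^ p / edist (fold z) y ^ α :=
        lintegral_const_mul' _ _ hD
    _ ≤ D * (D * gagliardoEnergy s p u (oball m 1)) := by
        gcongr
        refine hfold (fun z ↦ ∫⁻ y in oball m 1, edist (u z) (u y) ^ p / edist z y ^ α) ?_
        exact Measurable.lintegral_prod_right' (f := fun q : Euc m × Euc m ↦
          edist (u q.1) (u q.2) ^ p / edist q.1 q.2 ^ α) (by fun_prop)
    _ = _ := by rw [mul_assoc]

/-- On average over the parameter, opening a map multiplies its Gagliardo energy at most by a
constant. -/
lemma lintegral_gagliardoEnergy_opening_le (hm : 1 ≤ m) {s p : ℝ} (hs : 0 < s) (hp : 1 ≤ p) :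
    ∃ C : ℝ≥0∞, C ≠ ⊤ ∧ ∀ u : Euc m → N, Measurable u →
      ∫⁻ h in oball m 1, gagliardoEnergy s p (u ∘ opening h) univ ≤
        C * gagliardoEnergy s p u (oball m 1) := by
  obtain ⟨C, hC, hker⟩ := lintegral_kernel_le (N := N) hm hs hp
  obtain ⟨D, hD, hinc⟩ := lintegral_incrementEnergy_fold_le (N := N) hm hs hp
  obtain ⟨α, hα⟩ : ∃ α, (m : ℝ) + s * p = α := ⟨_, rfl⟩
  simp only [hα] at hker hinc
  have hp0 : 0 < p := by linarith
  refine ⟨2 * (volume (oball m 4) * (C * D)),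
    by have := volume_oball_ne_top (m := m) (r := 4); finiteness, fun u hu ↦ ?_⟩
  have hfm : Measurable (fold : Euc m → Euc m) := measurable_fold
  have hv : Measurable (u ∘ (fold : Euc m → Euc m)) := hu.comp hfm
  have hA' : ∀ h x, (u ∘ opening h) x = (u ∘ fold) (pinch (x - h) + h) := fun h x ↦ rfl
  have hincu := hinc u hu
  generalize u ∘ (fold : Euc m → Euc m) = v at hv hA' hincu
  have hpm : Measurable (pinch : Euc m → Euc m) := lipschitzWith_pinch.continuous.measurable
  obtain ⟨G, hGdef⟩ : ∃ G : Euc m → Euc m → Euc m → ℝ≥0∞, ∀ h x y, G h x y =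
    edist (v (pinch x + h)) (v (pinch y + h)) ^ p / edist x y ^ α := ⟨_, fun _ _ _ ↦ rfl⟩
  have hG : Measurable fun q : Euc m × Euc m × Euc m ↦ G q.1 q.2.1 q.2.2 := by
    simp only [hGdef]; fun_prop
  have hA : ∀ h, gagliardoEnergy s p (u ∘ opening h) univ = ∫⁻ x, ∫⁻ y, G h x y := by
    intro h
    simp only [gagliardoEnergy, Measure.restrict_univ]
    rw [← lintegral_sub_right_eq_self (fun x ↦ ∫⁻ y, G h x y) h]
    refine lintegral_congr fun x ↦ ?_
    rw [← lintegral_sub_right_eq_self (fun y ↦ G h (x - h) y) h]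
    simp only [hGdef, hA', hα, edist_sub_right]
  have hB : ∀ h, ∫⁻ x, ∫⁻ y, G h x y ≤ 2 * ∫⁻ x in oball m 4, ∫⁻ y, G h x y := by
    intro h
    refine lintegral_lintegral_le_two_mul (G := G h)
      (hG.comp (f := fun q : Euc m × Euc m ↦ (h, q.1, q.2)) (by fun_prop)) (fun x y ↦ ?_)
      measurableSet_oball fun x hx y hy ↦ ?_
    · rw [hGdef, hGdef, edist_comm, edist_comm x]
    · rw [mem_oball, not_lt] at hx hy
      simp [hGdef, pinch_of_ge hx, pinch_of_ge hy, hp0]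
  calc ∫⁻ h in oball m 1, gagliardoEnergy s p (u ∘ opening h) univ
      ≤ ∫⁻ h in oball m 1, 2 * ∫⁻ x in oball m 4, ∫⁻ y, G h x y :=
        lintegral_mono fun h ↦ (hA h).trans_le (hB h)
    _ = 2 * ∫⁻ x in oball m 4, ∫⁻ h in oball m 1, ∫⁻ y, G h x y := by
        rw [lintegral_const_mul' _ _ (by simp), lintegral_lintegral_swap]
        exact (Measurable.lintegral_prod_right' (f := fun q : (Euc m × Euc m) × Euc m ↦
          G q.1.1 q.1.2 q.2)
          (hG.comp (f := fun q : (Euc m × Euc m) × Euc m ↦ (q.1.1, q.1.2, q.2))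
            (by fun_prop))).aemeasurable
    _ = 2 * ∫⁻ x in oball m 4, ∫⁻ y, ∫⁻ h in oball m 1, G h x y := by
        congr 1
        refine lintegral_congr fun x ↦ ?_
        exact lintegral_lintegral_swap (hG.comp (f := fun q : Euc m × Euc m ↦ (q.1, x, q.2))
          (by fun_prop)).aemeasurable
    _ ≤ 2 * ∫⁻ x in oball m 4, C * ∫⁻ k in oball m 9, incrementEnergy p v k / ‖k‖ₑ ^ α := by
        gcongr with x
        simp only [hGdef]
        exact hker v hv x
    _ = 2 * (volume (oball m 4) * (C * ∫⁻ k in oball m 9, incrementEnergy p v k / ‖k‖ₑ ^ α)) := by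
        rw [setLIntegral_const]; ring
    _ ≤ 2 * (volume (oball m 4) * (C * (D * gagliardoEnergy s p u (oball m 1)))) := by
        gcongr
    _ = _ := by ring

end

/-! ### Weak derivatives -/

section

variable {m : ℕ} {F : Type*} [NormedAddCommGroup F] [NormedSpace ℝ F]

lemma MeasureTheory.LocallyIntegrableOn.clm_apply {D : Euc m → Euc m →L[ℝ] F} {A : Set (Euc m)}
    (hD : LocallyIntegrableOn D A volume) (v : Euc m) :
    LocallyIntegrableOn (fun x ↦ D x v) A volume := by
  intro x hx
  obtain ⟨U, hU, hi⟩ := hD x hx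
  exact ⟨U, hU, (ContinuousLinearMap.apply ℝ F v).integrable_comp hi⟩

lemma MeasureTheory.LocallyIntegrable.clm_apply {D : Euc m → Euc m →L[ℝ] F}
    (hD : LocallyIntegrable D volume) (v : Euc m) : LocallyIntegrable (fun x ↦ D x v) volume :=
  locallyIntegrableOn_univ.1 ((hD.locallyIntegrableOn univ).clm_apply v)

/-- The weak derivative only depends on classes modulo null sets. -/
lemma HasWeakDerivOn.congr_ae {f g : Euc m → F} {D D' : Euc m → Euc m →L[ℝ] F} {A : Set (Euc m)}
    (h : HasWeakDerivOn f D A) (hf : f =ᵐ[volume.restrict A] g)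
    (hD : D =ᵐ[volume.restrict A] D') : HasWeakDerivOn g D' A := by
  obtain ⟨h1, h2, h3⟩ := h
  have key : ∀ {E : Type _} [NormedAddCommGroup E] {a b : Euc m → E},
      LocallyIntegrableOn a A volume → a =ᵐ[volume.restrict A] b →
      LocallyIntegrableOn b A volume := by
    intro E _ a b ha hab x hx
    obtain ⟨U, hU, hi⟩ := ha x hx
    refine ⟨U ∩ A, inter_mem hU self_mem_nhdsWithin, ?_⟩
    exact (hi.mono_set inter_subset_left).congr_fun_ae
      (ae_restrict_of_ae_restrict_of_subset inter_subset_right hab)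
  refine ⟨key h1 hf, key h2 hD, fun φ hφ hc hs v ↦ ?_⟩
  have e1 : ∫ x in A, (fderiv ℝ φ x v) • g x = ∫ x in A, (fderiv ℝ φ x v) • f x :=
    integral_congr_ae (by filter_upwards [hf] with x hx; rw [hx])
  have e2 : ∫ x in A, φ x • D' x v = ∫ x in A, φ x • D x v :=
    integral_congr_ae (by filter_upwards [hD] with x hx; rw [hx])
  rw [e1, e2, h3 φ hφ hc hs v]

lemma HasWeakDerivOn.mono {f : Euc m → F} {D : Euc m → Euc m →L[ℝ] F} {A A' : Set (Euc m)}
    (h : HasWeakDerivOn f D A) (hA : A' ⊆ A) : HasWeakDerivOn f D A' := by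
  refine ⟨h.1.mono_set hA, h.2.1.mono_set hA, fun φ hφ hc hs v ↦ ?_⟩
  have e1 : ∀ B : Set (Euc m), tsupport φ ⊆ B →
      ∫ x in B, (fderiv ℝ φ x v) • f x = ∫ x, (fderiv ℝ φ x v) • f x := by
    intro B hB
    refine setIntegral_eq_integral_of_forall_compl_eq_zero fun x hx ↦ ?_
    have : fderiv ℝ φ x = 0 := image_eq_zero_of_notMem_tsupport
      fun h ↦ hx (hB (tsupport_fderiv_subset ℝ h))
    simp [this]
  have e2 : ∀ B : Set (Euc m), tsupport φ ⊆ B → ∫ x in B, φ x • D x v = ∫ x, φ x • D x v := by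
    intro B hB
    refine setIntegral_eq_integral_of_forall_compl_eq_zero fun x hx ↦ ?_
    rw [image_eq_zero_of_notMem_tsupport (fun h ↦ hx (hB h)), zero_smul]
  have := h.2.2 φ hφ hc (hs.trans hA) v
  rwa [e1 A (hs.trans hA), e2 A (hs.trans hA), ← e1 A' hs, ← e2 A' hs] at this

lemma HasWeakDerivOn.integral_eq {f : Euc m → F} {D : Euc m → Euc m →L[ℝ] F} {A : Set (Euc m)}
    (h : HasWeakDerivOn f D A) {φ : Euc m → ℝ} (hφ : ContDiff ℝ ∞ φ) (hc : HasCompactSupport φ)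
    (hs : tsupport φ ⊆ A) (v : Euc m) :
    ∫ x, (fderiv ℝ φ x v) • f x = - ∫ x, φ x • D x v := by
  have := (h.mono hs).2.2 φ hφ hc subset_rfl v
  rw [setIntegral_eq_integral_of_forall_compl_eq_zero fun x hx ↦ ?_,
    setIntegral_eq_integral_of_forall_compl_eq_zero fun x hx ↦ ?_] at this
  · exact this
  · rw [image_eq_zero_of_notMem_tsupport hx, zero_smul]
  · have : fderiv ℝ φ x = 0 := image_eq_zero_of_notMem_tsupport
      fun h ↦ hx (tsupport_fderiv_subset ℝ h)
    simp [this]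

lemma HasWeakDerivOn.ae_eq [CompleteSpace F] {f : Euc m → F} {D D' : Euc m → Euc m →L[ℝ] F}
    {A : Set (Euc m)} (hA : IsOpen A) (h : HasWeakDerivOn f D A) (h' : HasWeakDerivOn f D' A) :
    D =ᵐ[volume.restrict A] D' := by
  set b := EuclideanSpace.basisFun (Fin m) ℝ
  have hloc : ∀ v : Euc m, LocallyIntegrableOn (fun x ↦ (D x - D' x) v) A volume :=
    fun v ↦ (h.2.1.sub h'.2.1).clm_apply v
  have hz : ∀ v : Euc m, ∀ᵐ x, x ∈ A → (D x - D' x) v = 0 := by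
    intro v
    refine hA.ae_eq_zero_of_integral_contDiff_smul_eq_zero (hloc v) fun g hg hc hs ↦ ?_
    have hint : ∀ {D : Euc m → Euc m →L[ℝ] F}, LocallyIntegrableOn D A volume →
        Integrable fun x ↦ g x • D x v := by
      intro D hD
      have h2 := ((hD.clm_apply v).integrableOn_compact_subset hs hc)
      rw [← integrableOn_iff_integrable_of_support_subset (s := tsupport g)]
      · exact h2.continuousOn_smul hg.continuous.continuousOn hc
      · intro x hx
        by_contra hxs
        exact hx (by simp [image_eq_zero_of_notMem_tsupport hxs])
    have e1 := h.integral_eq hg hc hs v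
    have e2 := h'.integral_eq hg hc hs v
    have : ∫ x, g x • (D x - D' x) v = (∫ x, g x • D x v) - ∫ x, g x • D' x v := by
      rw [← integral_sub (hint h.2.1) (hint h'.2.1)]
      simp [smul_sub]
    rw [this, sub_eq_zero]
    exact neg_injective (e1.symm.trans e2)
  rw [EventuallyEq, ae_restrict_iff' hA.measurableSet]
  have := ae_all_iff.2 fun i ↦ hz (b i)
  filter_upwards [this] with x hx hxA
  rw [← sub_eq_zero]
  apply ContinuousLinearMap.coe_injective
  refine b.toBasis.ext fun i ↦ ?_
  simpa using! hx i hxA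

lemma dirichletEnergy_eq [CompleteSpace F] {p : ℝ} {f : Euc m → F} {D : Euc m → Euc m →L[ℝ] F}
    {A : Set (Euc m)} (hA : IsOpen A) (h : HasWeakDerivOn f D A) :
    dirichletEnergy p f A = ∫⁻ x in A, ‖D x‖ₑ ^ p := by
  refine le_antisymm (iInf₂_le D h) (le_iInf₂ fun D' h' ↦ ?_)
  refine le_of_eq (lintegral_congr_ae ?_)
  filter_upwards [h.ae_eq hA h'] with x hx
  rw [hx]

lemma exists_hasWeakDerivOn_of_dirichletEnergy_lt_top [CompleteSpace F] {p : ℝ} {f : Euc m → F}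
    {A : Set (Euc m)} (hA : IsOpen A) (h : dirichletEnergy p f A < ⊤) :
    ∃ D, HasWeakDerivOn f D A ∧ ∫⁻ x in A, ‖D x‖ₑ ^ p = dirichletEnergy p f A := by
  simp only [dirichletEnergy, iInf_lt_iff] at h
  obtain ⟨D, hD, -⟩ := h
  exact ⟨D, hD, (dirichletEnergy_eq hA hD).symm⟩

variable [FiniteDimensional ℝ F]

/-- By Rademacher's theorem, the weak derivative of a Lipschitz map is its almost everywhere
defined derivative. -/
lemma LipschitzWith.hasWeakDerivOn_fderiv {K : NNReal} {f : Euc m → F} (hf : LipschitzWith K f) :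
    HasWeakDerivOn f (fderiv ℝ f) univ := by
  have : CompleteSpace F := FiniteDimensional.complete ℝ F
  have hD : ∀ x, ‖fderiv ℝ f x‖ ≤ K := fun x ↦ norm_fderiv_le_of_lipschitz ℝ hf
  borelize (Euc m →L[ℝ] F)
  have hDm : StronglyMeasurable (fderiv ℝ f) := (measurable_fderiv ℝ f).stronglyMeasurable
  have hDl : LocallyIntegrable (fderiv ℝ f) volume :=
    (locallyIntegrable_const (K : ℝ)).mono hDm.aestronglyMeasurable
      (Eventually.of_forall fun x ↦ by simpa using hD x)
  refine ⟨hf.continuous.locallyIntegrable.locallyIntegrableOn _, hDl.locallyIntegrableOn _,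
    fun φ hφ hc _ v ↦ ?_⟩
  simp only [Measure.restrict_univ]
  have hcont : Continuous fun x ↦ fderiv ℝ φ x v :=
    (hφ.continuous_fderiv (by simp)).clm_apply continuous_const
  have hcs : HasCompactSupport fun x ↦ fderiv ℝ φ x v :=
    (hc.fderiv ℝ).comp_left (g := fun L : Euc m →L[ℝ] ℝ ↦ L v) rfl
  have i1 : Integrable fun x ↦ (fderiv ℝ φ x v) • f x :=
    (hcont.smul hf.continuous).integrable_of_hasCompactSupport hcs.smul_right
  have hDv := hDl.clm_apply v
  have i2 : Integrable fun x ↦ φ x • fderiv ℝ f x v :=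
    hDv.integrable_smul_left_of_hasCompactSupport hφ.continuous hc
  refine (SeparatingDual.eq_iff_forall_dual_eq (R := ℝ)).2 fun ℓ ↦ ?_
  rw [← ℓ.integral_comp_comm i1, map_neg, ← ℓ.integral_comp_comm i2]
  obtain ⟨L, hL⟩ := hφ.lipschitzWith_of_hasCompactSupport hc (by simp)
  have key := (ℓ.lipschitz.comp hf).integral_lineDeriv_mul_eq (μ := volume) hL hc v
  have e1 : ∀ᵐ x, lineDeriv ℝ (ℓ ∘ f) x v = ℓ (fderiv ℝ f x v) := by
    filter_upwards [hf.ae_differentiableAt (μ := volume)] with x hx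
    have h1 : DifferentiableAt ℝ (ℓ ∘ f) x := ℓ.differentiableAt.comp x hx
    rw [h1.lineDeriv_eq_fderiv, fderiv_comp x ℓ.differentiableAt hx]
    simp
  have e2 : ∀ x, lineDeriv ℝ φ x (-v) = - fderiv ℝ φ x v := fun x ↦ by
    rw [((hφ.differentiable (by simp)) x).lineDeriv_eq_fderiv, map_neg]
  have e3 : ∫ x, lineDeriv ℝ (ℓ ∘ f) x v * φ x = ∫ x, ℓ (φ x • fderiv ℝ f x v) :=
    integral_congr_ae (by filter_upwards [e1] with x hx; rw [hx]; simp [mul_comm])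
  rw [e3] at key
  rw [key]
  simp only [e2, Function.comp_apply, neg_mul, integral_neg, neg_neg, map_smul, smul_eq_mul]

lemma hasWeakDerivOn_const (c : F) : HasWeakDerivOn (fun _ : Euc m ↦ c) 0 univ := by
  have := (LipschitzWith.const (α := Euc m) c).hasWeakDerivOn_fderiv
  convert this using 1
  ext x : 1
  simp

lemma HasWeakDerivOn.ae_eq_zero_of_const {f : Euc m → F} {D : Euc m → Euc m →L[ℝ] F}
    {A : Set (Euc m)} (h : HasWeakDerivOn f D univ) (hA : IsOpen A) {c : F} (hc : ∀ x ∈ A, f x = c) :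
    ∀ᵐ x ∂volume.restrict A, D x = 0 := by
  have : CompleteSpace F := FiniteDimensional.complete ℝ F
  have h1 := (h.mono (subset_univ A)).congr_ae (g := fun _ ↦ c)
    ((ae_restrict_iff' hA.measurableSet).2 (Eventually.of_forall fun x hx ↦ hc x hx)) (ae_eq_refl D)
  exact h1.ae_eq hA ((hasWeakDerivOn_const c).mono (subset_univ A))

omit [FiniteDimensional ℝ F] in
lemma enorm_smul_sub_smul {φ : ℝ} {a b : F} : ‖φ • a - φ • b‖ₑ = ‖φ‖ₑ * ‖a - b‖ₑ := by
  rw [← smul_sub, enorm_smul]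

omit [FiniteDimensional ℝ F] in
/-- Integration against a continuous compactly supported function is continuous for the
convergence in `L^1` on bounded sets. -/
lemma tendsto_integral_smul_of_hasCompactSupport {φ : Euc m → ℝ} (hφ : Continuous φ)
    (hc : HasCompactSupport φ) {f : ℕ → Euc m → F} {g : Euc m → F}
    (hf : ∀ k, LocallyIntegrable (f k) volume) (hg : LocallyIntegrable g volume)
    (h : ∀ R : ℝ, Tendsto (fun k ↦ ∫⁻ x in oball m R, ‖f k x - g x‖ₑ) atTop (𝓝 0)) :
    Tendsto (fun k ↦ ∫ x, φ x • f k x) atTop (𝓝 (∫ x, φ x • g x)) := by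
  refine tendsto_integral_of_L1 _
    (hg.integrable_smul_left_of_hasCompactSupport hφ hc).aestronglyMeasurable
    (Eventually.of_forall fun k ↦ (hf k).integrable_smul_left_of_hasCompactSupport hφ hc) ?_
  obtain ⟨C, hC⟩ := hc.exists_bound_of_continuous hφ
  obtain ⟨R, hR⟩ := hc.isCompact.isBounded.subset_ball 0
  have h0 := ENNReal.Tendsto.const_mul (a := ENNReal.ofReal C) (h R) (Or.inr (by simp))
  rw [mul_zero] at h0
  refine tendsto_of_tendsto_of_tendsto_of_le_of_le tendsto_const_nhds h0 (fun _ ↦ zero_le) fun k ↦ ?_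
  simp only
  rw [← lintegral_const_mul' _ _ (by simp), ← lintegral_indicator measurableSet_oball]
  refine lintegral_mono fun x ↦ ?_
  rw [enorm_smul_sub_smul]
  by_cases hx : x ∈ oball m R
  · rw [indicator_of_mem hx]
    gcongr
    rw [← ofReal_norm]
    exact ENNReal.ofReal_le_ofReal (hC x)
  · have : φ x = 0 := image_eq_zero_of_notMem_tsupport fun h ↦ hx (hR h)
    simp [this]

omit [FiniteDimensional ℝ F] in
/-- Weak derivatives are closed under convergence in `L^1` on bounded sets. -/
lemma HasWeakDerivOn.of_tendsto {f : ℕ → Euc m → F} {D : ℕ → Euc m → Euc m →L[ℝ] F}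
    {g : Euc m → F} {D' : Euc m → Euc m →L[ℝ] F} (h : ∀ k, HasWeakDerivOn (f k) (D k) univ)
    (hg : LocallyIntegrable g volume) (hD' : LocallyIntegrable D' volume)
    (hf : ∀ R : ℝ, Tendsto (fun k ↦ ∫⁻ x in oball m R, ‖f k x - g x‖ₑ) atTop (𝓝 0))
    (hD : ∀ R : ℝ, Tendsto (fun k ↦ ∫⁻ x in oball m R, ‖D k x - D' x‖ₑ) atTop (𝓝 0)) :
    HasWeakDerivOn g D' univ := by
  refine ⟨hg.locallyIntegrableOn _, hD'.locallyIntegrableOn _, fun φ hφ hc hs v ↦ ?_⟩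
  simp only [Measure.restrict_univ]
  have hcont : Continuous fun x ↦ fderiv ℝ φ x v :=
    (hφ.continuous_fderiv (by simp)).clm_apply continuous_const
  have hcs : HasCompactSupport fun x ↦ fderiv ℝ φ x v :=
    (hc.fderiv ℝ).comp_left (g := fun L : Euc m →L[ℝ] ℝ ↦ L v) rfl
  have t1 := tendsto_integral_smul_of_hasCompactSupport hcont hcs
    (fun k ↦ locallyIntegrableOn_univ.1 (h k).1) hg hf
  have t2 := tendsto_integral_smul_of_hasCompactSupport hφ.continuous hc
    (f := fun k x ↦ D k x v) (g := fun x ↦ D' x v)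
    (fun k ↦ (locallyIntegrableOn_univ.1 (h k).2.1).clm_apply v) (hD'.clm_apply v) (fun R ↦ by
      have h0 := ENNReal.Tendsto.mul_const (b := ‖v‖ₑ) (hD R) (Or.inr (by simp))
      rw [zero_mul] at h0
      refine tendsto_of_tendsto_of_tendsto_of_le_of_le tendsto_const_nhds h0 (fun _ ↦ zero_le)
        fun k ↦ ?_
      simp only
      rw [← lintegral_mul_const' _ _ (by simp)]
      refine lintegral_mono fun x ↦ ?_
      rw [← sub_apply]
      exact ContinuousLinearMap.le_opENorm _ _)
  refine tendsto_nhds_unique t1 (t2.neg.congr fun k ↦ ?_)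
  rw [(h k).integral_eq hφ hc hs v]

end

/-! ### Mollification of weakly differentiable maps -/

section

variable {m : ℕ} {F : Type*} [NormedAddCommGroup F] [NormedSpace ℝ F]

/-- Composition with maps which converge to the identity is continuous in `L^1`, provided that these
maps compress volumes by a bounded factor. It suffices to check it for continuous functions with
compact support. -/
lemma tendsto_lintegral_enorm_comp_sub {β : Type*} {l : Filter β} [l.IsCountablyGenerated]
    {A : β → Euc m → Euc m} {C : ℝ≥0∞} (hC : C ≠ ⊤) (hAm : ∀ b, Measurable (A b))
    (hA : ∀ᶠ b in l, Measure.map (A b) volume ≤ C • volume)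
    (hd : ∀ᶠ b in l, ∀ x, ‖x‖ ≤ 2 * ‖A b x‖ + 1) (hlim : ∀ x, Tendsto (A · x) l (𝓝 x))
    {f : Euc m → F} (hf : Integrable f) :
    Tendsto (fun b ↦ ∫⁻ x, ‖f (A b x) - f x‖ₑ) l (𝓝 0) := by
  rw [ENNReal.tendsto_nhds_zero]
  intro ε hε
  have hC2 : C + 2 ≠ ⊤ := by finiteness
  have hC0 : C + 2 ≠ 0 := by positivity
  set δ := ε / (C + 2)
  have hδ : δ ≠ 0 := (ENNReal.div_pos hε.ne' hC2).ne'
  have hδε : (C + 2) * δ = ε := ENNReal.mul_div_cancel hC0 hC2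
  obtain ⟨g, hgc, hfg, hg, hgi⟩ := hf.exists_hasCompactSupport_lintegral_sub_le hδ
  obtain ⟨M, hM⟩ := hgc.exists_bound_of_continuous hg
  obtain ⟨R, hR⟩ := hgc.isCompact.isBounded.subset_ball 0
  have hlimg : Tendsto (fun b ↦ ∫⁻ x, ‖g (A b x) - g x‖ₑ) l (𝓝 0) := by
    have h0 : ∫⁻ x : Euc m, ‖g x - g x‖ₑ = 0 := by simp
    rw [← h0]
    refine tendsto_lintegral_filter_of_dominated_convergence
      ((oball m (2 * R + 1)).indicator fun _ ↦ ENNReal.ofReal (2 * M)) ?_ ?_ ?_ ?_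
    · exact Eventually.of_forall fun b ↦ by
        have := (hg.stronglyMeasurable.comp_measurable (hAm b)).sub hg.stronglyMeasurable
        exact this.enorm
    · filter_upwards [hd] with b hb
      refine Eventually.of_forall fun x ↦ ?_
      by_cases hx : x ∈ oball m (2 * R + 1)
      · rw [indicator_of_mem hx, ← ofReal_norm]
        refine ENNReal.ofReal_le_ofReal ((norm_sub_le _ _).trans ?_)
        linarith [hM (A b x), hM x]
      · have hx' : 2 * R + 1 ≤ ‖x‖ := by rwa [mem_oball, not_lt] at hx
        have hz : ∀ y : Euc m, R ≤ ‖y‖ → g y = 0 := fun y hy ↦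
          image_eq_zero_of_notMem_tsupport fun h ↦ by
            have := mem_ball_zero_iff.1 (hR h)
            linarith
        by_cases hgx : g x = 0
        · rw [hgx, hz (A b x) (by linarith [hb x])]; simp
        · have hR0 : ‖x‖ < R := not_le.1 fun h ↦ hgx (hz x h)
          exfalso
          linarith [norm_nonneg x]
    · rw [lintegral_indicator measurableSet_oball, setLIntegral_const]
      exact ENNReal.mul_ne_top ENNReal.ofReal_ne_top volume_oball_ne_top
    · refine Eventually.of_forall fun x ↦ ?_
      have : Continuous fun y ↦ ‖g y - g x‖ₑ := by fun_prop
      exact (this.tendsto x).comp (hlim x)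
  filter_upwards [hA, (ENNReal.tendsto_nhds_zero.1 hlimg) δ (pos_iff_ne_zero.2 hδ)] with b hAb hb
  have hac : Measure.map (A b) volume ≪ volume :=
    (Measure.absolutelyContinuous_of_le hAb).trans Measure.smul_absolutelyContinuous
  have hsub : AEMeasurable (fun x ↦ ‖f x - g x‖ₑ) volume :=
    (hf.aestronglyMeasurable.sub hg.aestronglyMeasurable).enorm
  have h1 : ∫⁻ x, ‖f (A b x) - g (A b x)‖ₑ ≤ C * δ := by
    rw [← lintegral_map' (f := fun x ↦ ‖f x - g x‖ₑ) (hsub.mono_ac hac) (hAm b).aemeasurable]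
    refine (lintegral_mono' hAb le_rfl).trans ?_
    rw [lintegral_smul_measure, smul_eq_mul]
    gcongr
  have h2 : ∫⁻ x, ‖g x - f x‖ₑ ≤ δ := by
    simpa only [← edist_eq_enorm_sub, edist_comm] using hfg
  have m1 : AEMeasurable (fun x ↦ ‖f (A b x) - g (A b x)‖ₑ) volume :=
    (hsub.mono_ac hac).comp_aemeasurable (hAm b).aemeasurable
  have m2 : Measurable (fun x ↦ ‖g (A b x) - g x‖ₑ) :=
    ((hg.stronglyMeasurable.comp_measurable (hAm b)).sub hg.stronglyMeasurable).enorm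
  calc ∫⁻ x, ‖f (A b x) - f x‖ₑ
      ≤ ∫⁻ x, (‖f (A b x) - g (A b x)‖ₑ + (‖g (A b x) - g x‖ₑ + ‖g x - f x‖ₑ)) := by
        refine lintegral_mono fun x ↦ ?_
        simp only [← edist_eq_enorm_sub]
        exact (edist_triangle _ _ _).trans (add_le_add le_rfl (edist_triangle _ _ _))
    _ = (∫⁻ x, ‖f (A b x) - g (A b x)‖ₑ) + ((∫⁻ x, ‖g (A b x) - g x‖ₑ) + ∫⁻ x, ‖g x - f x‖ₑ) := by
        rw [lintegral_add_left' m1, lintegral_add_left m2]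
    _ ≤ C * δ + (δ + δ) := by gcongr
    _ = ε := by rw [← hδε]; ring

/-- Continuity of translations in `L^1`. -/
lemma tendsto_lintegral_translate_sub {f : Euc m → F} (hf : Integrable f) :
    Tendsto (fun t : Euc m ↦ ∫⁻ x, ‖f (x - t) - f x‖ₑ) (𝓝 0) (𝓝 0) := by
  refine tendsto_lintegral_enorm_comp_sub (C := 1) (A := fun t x ↦ x - t) (by simp)
    (fun t ↦ by fun_prop) (Eventually.of_forall fun t ↦ ?_) ?_ (fun x ↦ ?_) hf
  · rw [map_sub_right_eq_self, one_smul]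
  · filter_upwards [Metric.ball_mem_nhds (0 : Euc m) one_pos] with t ht x
    have h1 := mem_ball_zero_iff.1 ht
    have h2 : ‖x‖ ≤ ‖x - t‖ + ‖t‖ := by simpa using norm_add_le (x - t) t
    linarith [norm_nonneg (x - t)]
  · have : Continuous fun t : Euc m ↦ x - t := by fun_prop
    simpa using this.tendsto 0

/-- Continuity of dilations in `L^1`. -/
lemma tendsto_lintegral_dilate_sub {f : Euc m → F} (hf : Integrable f) :
    Tendsto (fun r : ℝ ↦ ∫⁻ x, ‖f (r • x) - f x‖ₑ) (𝓝 1) (𝓝 0) := by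
  have hev : ∀ᶠ r : ℝ in 𝓝 1, 1 / 2 < r := lt_mem_nhds (by norm_num)
  refine tendsto_lintegral_enorm_comp_sub (C := ENNReal.ofReal (2 ^ m)) (A := fun r x ↦ r • x)
    (by simp) (fun t ↦ by fun_prop) ?_ ?_ (fun x ↦ ?_) hf
  · filter_upwards [hev] with r hr
    rw [Measure.map_addHaar_smul volume (by linarith)]
    simp only [finrank_euclideanSpace, Fintype.card_fin]
    refine Measure.le_iff.2 fun S _ ↦ ?_
    simp only [Measure.smul_apply, smul_eq_mul]
    gcongr
    have hr0 : 0 < r := by linarith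
    rw [abs_of_pos (by positivity), ← inv_pow]
    gcongr
    rw [inv_eq_one_div, div_le_iff₀ hr0]
    linarith
  · filter_upwards [hev] with r hr x
    rw [norm_smul, Real.norm_of_nonneg (by linarith)]
    nlinarith [norm_nonneg x]
  · have : Continuous fun r : ℝ ↦ r • x := by fun_prop
    simpa using this.tendsto 1

open ContinuousLinearMap in
/-- Mollifications converge in `L^1`. -/
lemma exists_forall_lintegral_convolution_sub_le [CompleteSpace F] {f : Euc m → F}
    (hf : Integrable f) {δ : ℝ≥0∞} (hδ : 0 < δ) : ∃ ε > 0, ∀ φ : ContDiffBump (0 : Euc m),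
      φ.rOut < ε →
      ∫⁻ x, ‖convolution (φ.normed volume) f (lsmul ℝ ℝ) volume x - f x‖ₑ ≤ δ := by
  obtain ⟨ε, hε, h⟩ := Metric.eventually_nhds_iff.1
    ((ENNReal.tendsto_nhds_zero.1 (tendsto_lintegral_translate_sub hf)) δ hδ)
  refine ⟨ε, hε, fun φ hφ ↦ ?_⟩
  set η := φ.normed (volume : Measure (Euc m))
  have hη : Continuous η := φ.continuous_normed
  have hηc : HasCompactSupport η := φ.hasCompactSupport_normed
  have hηi : Integrable η := φ.integrable_normed
  have hη0 : ∀ t, 0 ≤ η t := φ.nonneg_normed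
  have hη1 : ∫⁻ t, ‖η t‖ₑ = 1 := by
    have := ofReal_integral_eq_lintegral_ofReal hηi (Eventually.of_forall hη0)
    rw [φ.integral_normed, ENNReal.ofReal_one] at this
    rw [this]
    exact lintegral_congr fun t ↦ Real.enorm_of_nonneg (hη0 t)
  have hfm : AEStronglyMeasurable (fun q : Euc m × Euc m ↦ f (q.1 - q.2)) (volume.prod volume) :=
    hf.aestronglyMeasurable.comp_quasiMeasurePreserving
      (quasiMeasurePreserving_sub_of_right_invariant volume volume)
  have hm1 : AEMeasurable (fun q : Euc m × Euc m ↦ ‖η q.2‖ₑ * ‖f (q.1 - q.2) - f q.1‖ₑ)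
      (volume.prod volume) := by
    refine AEMeasurable.mul (by fun_prop) (hfm.sub ?_).enorm
    exact hf.aestronglyMeasurable.comp_fst
  calc ∫⁻ x, ‖convolution η f (lsmul ℝ ℝ) volume x - f x‖ₑ
      ≤ ∫⁻ x, ∫⁻ t, ‖η t‖ₑ * ‖f (x - t) - f x‖ₑ := by
        refine lintegral_mono fun x ↦ ?_
        have hi : Integrable fun t ↦ η t • f (x - t) :=
          hηc.convolutionExists_left (lsmul ℝ ℝ) hη hf.locallyIntegrable x
        have : convolution η f (lsmul ℝ ℝ) volume x - f x = ∫ t, η t • (f (x - t) - f x) := by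
          simp only [smul_sub]
          rw [integral_sub hi (hηi.smul_const _), integral_smul_const, φ.integral_normed, one_smul]
          rfl
        rw [this]
        refine (enorm_integral_le_lintegral_enorm _).trans (lintegral_mono fun t ↦ ?_)
        rw [enorm_smul]
    _ = ∫⁻ t, ∫⁻ x, ‖η t‖ₑ * ‖f (x - t) - f x‖ₑ := lintegral_lintegral_swap hm1
    _ ≤ ∫⁻ t, ‖η t‖ₑ * δ := by
        refine lintegral_mono fun t ↦ ?_
        rw [lintegral_const_mul' _ _ (by simp)]
        by_cases ht : t ∈ Metric.ball (0 : Euc m) φ.rOut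
        · gcongr
          exact h ((Metric.mem_ball.1 ht).trans hφ)
        · have : η t = 0 := by
            rw [← Function.notMem_support, φ.support_normed_eq]
            exact ht
          simp [this]
    _ = δ := by rw [lintegral_mul_const _ (by fun_prop), hη1, one_mul]

open ContinuousLinearMap in
/-- The derivative of a mollification is the mollification of the weak derivative. -/
lemma HasWeakDerivOn.hasFDerivAt_convolution [CompleteSpace F] {f f' : Euc m → F}
    {D D' : Euc m → Euc m →L[ℝ] F} {A : Set (Euc m)} (h : HasWeakDerivOn f D A)
    (hf' : LocallyIntegrable f' volume) (hD' : LocallyIntegrable D' volume)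
    (φ : ContDiffBump (0 : Euc m)) {x : Euc m} (hx : Metric.closedBall x φ.rOut ⊆ A)
    (hff' : ∀ y ∈ Metric.closedBall x φ.rOut, f' y = f y)
    (hDD' : ∀ y ∈ Metric.closedBall x φ.rOut, D' y = D y) :
    HasFDerivAt (convolution (φ.normed volume) f' (lsmul ℝ ℝ) volume)
      (convolution (φ.normed volume) D' (lsmul ℝ ℝ) volume x) x := by
  set η := φ.normed (volume : Measure (Euc m))
  have hη : Continuous η := φ.continuous_normed
  have hηs : ContDiff ℝ ∞ η := φ.contDiff_normed
  have hηc : HasCompactSupport η := φ.hasCompactSupport_normed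
  have hηd : ContDiff ℝ 1 η := φ.contDiff_normed (n := 1)
  have key := hηc.hasFDerivAt_convolution_left (lsmul ℝ ℝ) (μ := volume) hηd hf' x
  refine key.congr_fderiv (ContinuousLinearMap.ext fun v ↦ Eq.symm ?_)
  have i1 : Integrable fun t ↦ η t • D' (x - t) :=
    hηc.convolutionExists_left (lsmul ℝ ℝ) hη hD' x
  have i2 : Integrable fun t ↦ ((lsmul ℝ ℝ).precompL (Euc m) (fderiv ℝ η t)) (f' (x - t)) :=
    (hηc.fderiv ℝ).convolutionExists_left _ (hηd.continuous_fderiv (by simp)) hf' x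
  have e1 : convolution η D' (lsmul ℝ ℝ) volume x v = ∫ t, η (x - t) • D' t v := by
    rw [convolution_lsmul, ContinuousLinearMap.integral_apply i1 v,
      ← integral_sub_left_eq_self _ volume x]
    simp
  have e2 : convolution (fderiv ℝ η) f' ((lsmul ℝ ℝ).precompL (Euc m)) volume x v =
      ∫ t, (fderiv ℝ η (x - t) v) • f' t := by
    rw [convolution_def, ContinuousLinearMap.integral_apply i2 v,
      ← integral_sub_left_eq_self _ volume x]
    simp [ContinuousLinearMap.precompL_apply]
  rw [e1, e2]
  set ψ : Euc m → ℝ := fun y ↦ η (x - y)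
  have hψs : ContDiff ℝ ∞ ψ := hηs.comp (contDiff_const.sub contDiff_id)
  have hψ0 : ∀ y ∉ Metric.closedBall x φ.rOut, ψ y = 0 := by
    intro y hy
    rw [← Function.notMem_support, show ψ = fun y ↦ η (x - y) from rfl]
    intro h'
    have : x - y ∈ Metric.ball (0 : Euc m) φ.rOut := by
      rw [← φ.support_normed_eq (μ := volume)]; exact h'
    apply hy
    rw [Metric.mem_closedBall, dist_comm, dist_eq_norm]
    exact (mem_ball_zero_iff.1 this).le
  have hψt : tsupport ψ ⊆ Metric.closedBall x φ.rOut :=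
    closure_minimal (fun y hy ↦ by_contra fun h' ↦ hy (hψ0 y h')) Metric.isClosed_closedBall
  have hψc : HasCompactSupport ψ :=
    (isCompact_closedBall x φ.rOut).of_isClosed_subset (isClosed_tsupport ψ) hψt
  have hψd : ∀ y, fderiv ℝ ψ y v = - fderiv ℝ η (x - y) v := by
    intro y
    have h1 : HasFDerivAt (fun y : Euc m ↦ x - y) (-ContinuousLinearMap.id ℝ (Euc m)) y := by
      simpa using! (hasFDerivAt_id y).const_sub x
    have h2 := ((hηd.differentiable (by simp) (x - y)).hasFDerivAt.comp y h1).fderiv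
    change (fderiv ℝ (η ∘ fun y ↦ x - y) y) v = _
    rw [h2]
    simp
  have hw := h.integral_eq hψs hψc (hψt.trans hx) v
  have e3 : ∫ y, ψ y • D y v = ∫ y, η (x - y) • D' y v := by
    refine integral_congr_ae (Eventually.of_forall fun y ↦ ?_)
    by_cases hy : y ∈ Metric.closedBall x φ.rOut
    · simp only [hDD' y hy, ψ]
    · have := hψ0 y hy
      simp only [ψ] at this ⊢
      simp [this]
  have e4 : ∫ y, (fderiv ℝ ψ y v) • f y = - ∫ y, (fderiv ℝ η (x - y) v) • f' y := by
    rw [← integral_neg]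
    refine integral_congr_ae (Eventually.of_forall fun y ↦ ?_)
    by_cases hy : y ∈ Metric.closedBall x φ.rOut
    · simp only [hff' y hy, hψd, neg_smul]
    · have h0 : fderiv ℝ ψ y = 0 := image_eq_zero_of_notMem_tsupport
        fun h' ↦ hy (hψt (tsupport_fderiv_subset ℝ h'))
      have h1 : fderiv ℝ η (x - y) v = 0 := by
        rw [← neg_eq_zero, ← hψd, h0]; simp
      simp only [h0, h1]; simp
  rw [e3, e4, neg_inj] at hw
  exact hw.symm

omit [NormedSpace ℝ F] in
lemma MeasureTheory.LocallyIntegrableOn.exists_integrable_eqOn {f : Euc m → F} {A K : Set (Euc m)}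
    (h : LocallyIntegrableOn f A volume) (hK : IsCompact K) (hKA : K ⊆ A) :
    ∃ g : Euc m → F, Integrable g ∧ ∀ x ∈ K, g x = f x :=
  ⟨K.indicator f, (h.integrableOn_compact_subset hKA hK).integrable_indicator hK.measurableSet,
    fun _ hx ↦ indicator_of_mem hx _⟩

open ContinuousLinearMap in
/-- A weakly differentiable map is the limit in `W^{1,1}(K)` of maps of class `C^1`, for each
compact subset `K` of its domain. -/
lemma HasWeakDerivOn.exists_contDiff [CompleteSpace F] {f : Euc m → F}
    {D : Euc m → Euc m →L[ℝ] F} {A K : Set (Euc m)} (h : HasWeakDerivOn f D A) (hA : IsOpen A)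
    (hK : IsCompact K) (hKA : K ⊆ A) {δ : ℝ≥0∞} (hδ : 0 < δ) :
    ∃ g : Euc m → F, ContDiff ℝ 1 g ∧ ∫⁻ x in K, ‖g x - f x‖ₑ ≤ δ ∧
      ∫⁻ x in K, ‖fderiv ℝ g x - D x‖ₑ ≤ δ := by
  obtain ⟨ρ, hρ, hρA⟩ := hK.exists_cthickening_subset_open hA hKA
  set K' := Metric.cthickening ρ K
  have hK' : IsCompact K' := hK.cthickening
  have hKK' : K ⊆ K' := Metric.self_subset_cthickening K
  obtain ⟨f', hf', hff'⟩ := h.1.exists_integrable_eqOn hK' hρA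
  obtain ⟨D', hD', hDD'⟩ := h.2.1.exists_integrable_eqOn hK' hρA
  obtain ⟨ε₁, hε₁, h1⟩ := exists_forall_lintegral_convolution_sub_le hf' hδ
  obtain ⟨ε₂, hε₂, h2⟩ := exists_forall_lintegral_convolution_sub_le hD' hδ
  obtain ⟨ε, hε, hlt⟩ := exists_between (lt_min (lt_min hε₁ hε₂) hρ)
  have hεl := lt_min_iff.1 hlt
  have hεl' := lt_min_iff.1 hεl.1
  set φ : ContDiffBump (0 : Euc m) := ⟨ε / 2, ε, by positivity, by linarith⟩
  refine ⟨convolution (φ.normed volume) f' (lsmul ℝ ℝ) volume,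
    φ.hasCompactSupport_normed.contDiff_convolution_left _ (φ.contDiff_normed (n := 1))
      hf'.locallyIntegrable, ?_, ?_⟩
  · refine le_trans ?_ (h1 φ hεl'.1)
    refine (setLIntegral_mono' hK.measurableSet fun x hx ↦ ?_).trans (setLIntegral_le_lintegral K _)
    rw [hff' x (hKK' hx)]
  · refine le_trans ?_ (h2 φ hεl'.2)
    refine (setLIntegral_mono' hK.measurableSet fun x hx ↦ ?_).trans (setLIntegral_le_lintegral K _)
    have hxK : Metric.closedBall x φ.rOut ⊆ K' :=
      (Metric.closedBall_subset_closedBall hεl.2.le).trans (Metric.closedBall_subset_cthickening hx ρ)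
    rw [(h.hasFDerivAt_convolution hf'.locallyIntegrable hD'.locallyIntegrable φ (hxK.trans hρA)
      (fun y hy ↦ hff' y (hxK hy)) (fun y hy ↦ hDD' y (hxK hy))).fderiv, hDD' x (hKK' hx)]

end

/-! ### Translations and the Poincaré inequality -/

section

variable {m : ℕ} {F : Type*} [NormedAddCommGroup F] [NormedSpace ℝ F]

lemma ContDiff.lintegral_translate_sub_le [CompleteSpace F] {g : Euc m → F} (hg : ContDiff ℝ 1 g)
    {K S : Set (Euc m)} (hS : MeasurableSet S) (hK : MeasurableSet K) {v : Euc m}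
    (hSK : ∀ x ∈ S, ∀ t ∈ Icc (0 : ℝ) 1, x + t • v ∈ K) :
    ∫⁻ x in S, ‖g (x + v) - g x‖ₑ ≤ ‖v‖ₑ * ∫⁻ x in K, ‖fderiv ℝ g x‖ₑ := by
  have hdc : Continuous (fderiv ℝ g) := hg.continuous_fderiv (by simp)
  have hpt : ∀ x, ‖g (x + v) - g x‖ₑ ≤ ∫⁻ t in Icc (0 : ℝ) 1, ‖v‖ₑ * ‖fderiv ℝ g (x + t • v)‖ₑ := by
    intro x
    have hder : ∀ t : ℝ, HasDerivAt (fun t : ℝ ↦ g (x + t • v)) (fderiv ℝ g (x + t • v) v) t := by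
      intro t
      have h1 : HasDerivAt (fun t : ℝ ↦ x + t • v) v t := by
        simpa using! ((hasDerivAt_id t).smul_const v).const_add x
      exact ((hg.differentiable (by simp) (x + t • v)).hasFDerivAt.comp_hasDerivAt t h1)
    have hc : Continuous fun t : ℝ ↦ fderiv ℝ g (x + t • v) v := by fun_prop
    have := intervalIntegral.integral_eq_sub_of_hasDerivAt (a := 0) (b := 1) (fun t _ ↦ hder t)
      (hc.intervalIntegrable 0 1)
    simp only [one_smul, zero_smul, add_zero] at this
    rw [← this, intervalIntegral.integral_of_le zero_le_one]
    refine (enorm_integral_le_lintegral_enorm _).trans ?_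
    refine (lintegral_mono_set Ioc_subset_Icc_self).trans (lintegral_mono fun t ↦ ?_)
    rw [mul_comm]
    exact ContinuousLinearMap.le_opENorm _ _
  calc ∫⁻ x in S, ‖g (x + v) - g x‖ₑ
      ≤ ∫⁻ x in S, ∫⁻ t in Icc (0 : ℝ) 1, ‖v‖ₑ * ‖fderiv ℝ g (x + t • v)‖ₑ := by
        gcongr with x; exact hpt x
    _ = ∫⁻ t in Icc (0 : ℝ) 1, ∫⁻ x in S, ‖v‖ₑ * ‖fderiv ℝ g (x + t • v)‖ₑ := by
        apply lintegral_lintegral_swap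
        apply Measurable.aemeasurable
        simp only [Function.uncurry_def]
        exact (Continuous.enorm (by fun_prop)).measurable.const_mul _
    _ ≤ ∫⁻ t in Icc (0 : ℝ) 1, ‖v‖ₑ * ∫⁻ x in K, ‖fderiv ℝ g x‖ₑ := by
        refine setLIntegral_mono' measurableSet_Icc fun t ht ↦ ?_
        rw [lintegral_const_mul' _ _ (by simp)]
        refine mul_le_mul_right ?_ _
        rw [← lintegral_indicator hS, ← lintegral_indicator hK,
          ← lintegral_add_right_eq_self (fun x ↦ K.indicator _ x) (t • v)]
        refine lintegral_mono fun x ↦ ?_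
        by_cases hx : x ∈ S
        · rw [indicator_of_mem hx, indicator_of_mem (hSK x hx t ht)]
        · simp [indicator_of_notMem hx]
    _ = _ := by rw [setLIntegral_const]; simp

/-- The increments of a weakly differentiable map are controlled by its weak derivative. -/
lemma HasWeakDerivOn.lintegral_translate_sub_le [CompleteSpace F] {f : Euc m → F}
    {D : Euc m → Euc m →L[ℝ] F} {A K S : Set (Euc m)} (h : HasWeakDerivOn f D A) (hA : IsOpen A)
    (hK : IsCompact K) (hKA : K ⊆ A) (hS : MeasurableSet S) {v : Euc m}
    (hSK : ∀ x ∈ S, ∀ t ∈ Icc (0 : ℝ) 1, x + t • v ∈ K) :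
    ∫⁻ x in S, ‖f (x + v) - f x‖ₑ ≤ ‖v‖ₑ * ∫⁻ x in K, ‖D x‖ₑ := by
  have h0 : ∀ x ∈ S, x ∈ K := fun x hx ↦ by simpa using hSK x hx 0 (by simp)
  have h1 : ∀ x ∈ S, x + v ∈ K := fun x hx ↦ by simpa using hSK x hx 1 (by simp)
  obtain ⟨f', hf', hff'⟩ := h.1.exists_integrable_eqOn hK hKA
  obtain ⟨D', hD', hDD'⟩ := h.2.1.exists_integrable_eqOn hK hKA
  have step : ∀ δ : ℝ≥0∞, 0 < δ →
      ∫⁻ x in S, ‖f (x + v) - f x‖ₑ ≤ ‖v‖ₑ * (∫⁻ x in K, ‖D x‖ₑ) + (2 + ‖v‖ₑ) * δ := by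
    intro δ hδ
    obtain ⟨g, hg, hgf, hgD⟩ := h.exists_contDiff hA hK hKA hδ
    have hgc : Continuous g := hg.continuous
    have e1 : ∫⁻ x in S, ‖f' (x + v) - g (x + v)‖ₑ ≤ δ := by
      refine le_trans ?_ hgf
      rw [← lintegral_indicator hS, ← lintegral_indicator hK.measurableSet,
          ← lintegral_add_right_eq_self (fun x ↦ K.indicator _ x) v]
      refine lintegral_mono fun x ↦ ?_
      by_cases hx : x ∈ S
      · rw [indicator_of_mem hx, indicator_of_mem (h1 x hx), hff' _ (h1 x hx),
          ← edist_eq_enorm_sub, ← edist_eq_enorm_sub, edist_comm]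
      · simp [indicator_of_notMem hx]
    have e2 : ∫⁻ x in S, ‖g x - f' x‖ₑ ≤ δ := by
      refine le_trans ?_ hgf
      refine (setLIntegral_mono' hS fun x hx ↦ ?_).trans (lintegral_mono_set (fun x hx ↦ h0 x hx))
      rw [hff' x (h0 x hx)]
    have e3 : ∫⁻ x in K, ‖fderiv ℝ g x‖ₑ ≤ δ + ∫⁻ x in K, ‖D x‖ₑ := by
      have : ∫⁻ x in K, ‖D x‖ₑ = ∫⁻ x in K, ‖D' x‖ₑ :=
        setLIntegral_congr_fun hK.measurableSet fun x hx ↦ by rw [hDD' x hx]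
      rw [this]
      refine le_trans ?_ (add_le_add_left hgD _)
      rw [← lintegral_add_right' _ hD'.aestronglyMeasurable.enorm.restrict]
      refine setLIntegral_mono' hK.measurableSet fun x hx ↦ ?_
      rw [← hDD' x hx]
      calc ‖fderiv ℝ g x‖ₑ = ‖(fderiv ℝ g x - D' x) + D' x‖ₑ := by rw [sub_add_cancel]
        _ ≤ _ := enorm_add_le (fderiv ℝ g x - D' x) (D' x)
    have m1 : AEMeasurable (fun x ↦ ‖f' (x + v) - g (x + v)‖ₑ) (volume.restrict S) :=
      ((hf'.aestronglyMeasurable.comp_quasiMeasurePreserving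
        (measurePreserving_add_right volume v).quasiMeasurePreserving).sub
        (hgc.comp (continuous_add_const v)).aestronglyMeasurable).enorm.restrict
    have m2 : Measurable fun x ↦ ‖g (x + v) - g x‖ₑ := Continuous.measurable (by fun_prop)
    calc ∫⁻ x in S, ‖f (x + v) - f x‖ₑ
        ≤ ∫⁻ x in S, (‖f' (x + v) - g (x + v)‖ₑ + (‖g (x + v) - g x‖ₑ + ‖g x - f' x‖ₑ)) := by
          refine setLIntegral_mono' hS fun x hx ↦ ?_
          rw [← hff' _ (h0 x hx), ← hff' _ (h1 x hx)]
          simp only [← edist_eq_enorm_sub]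
          exact (edist_triangle _ _ _).trans (add_le_add le_rfl (edist_triangle _ _ _))
      _ = (∫⁻ x in S, ‖f' (x + v) - g (x + v)‖ₑ) + ((∫⁻ x in S, ‖g (x + v) - g x‖ₑ) +
            ∫⁻ x in S, ‖g x - f' x‖ₑ) := by
          rw [lintegral_add_left' m1, lintegral_add_left m2]
      _ ≤ δ + (‖v‖ₑ * (δ + ∫⁻ x in K, ‖D x‖ₑ) + δ) := by
          gcongr
          exact (hg.lintegral_translate_sub_le hS hK.measurableSet hSK).trans (by gcongr)
      _ = _ := by ring
  have ht : Tendsto (fun δ : ℝ≥0∞ ↦ ‖v‖ₑ * (∫⁻ x in K, ‖D x‖ₑ) + (2 + ‖v‖ₑ) * δ) (𝓝[>] 0)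
      (𝓝 (‖v‖ₑ * (∫⁻ x in K, ‖D x‖ₑ) + (2 + ‖v‖ₑ) * 0)) := by
    refine Tendsto.mono_left ?_ nhdsWithin_le_nhds
    exact (ENNReal.Tendsto.const_mul tendsto_id (Or.inr (by finiteness))).const_add _
  rw [mul_zero, add_zero] at ht
  exact ge_of_tendsto ht (eventually_nhdsWithin_of_forall fun δ hδ ↦ step δ hδ)

/-- A map on the unit ball whose weak derivative is integrable is integrable: near a boundary
point, it is compared by a translation to its values near the centre. -/
lemma HasWeakDerivOn.integrableOn_oball [CompleteSpace F] {f : Euc m → F}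
    {D : Euc m → Euc m →L[ℝ] F} (h : HasWeakDerivOn f D (oball m 1))
    (hD : ∫⁻ x in oball m 1, ‖D x‖ₑ ≠ ⊤) : IntegrableOn f (oball m 1) := by
  refine ⟨h.1.aestronglyMeasurable, ?_⟩
  have hM : ∫⁻ x in oball m (1 / 4), ‖f x‖ₑ ≠ ⊤ := by
    have := h.1.integrableOn_compact_subset (t := Metric.closedBall 0 (1 / 4))
      (Metric.closedBall_subset_ball (by norm_num)) (isCompact_closedBall _ _)
    exact ((this.mono_set Metric.ball_subset_closedBall).2).ne
  have key : ∀ e : Euc m, ‖e‖ ≤ 1 → ∫⁻ x in oball m 1 ∩ Metric.ball e (1 / 4), ‖f x‖ₑ ≤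
      (∫⁻ x in oball m (1 / 4), ‖f x‖ₑ) + ∫⁻ x in oball m 1, ‖D x‖ₑ := by
    intro e he
    set r : ℕ → ℝ := fun n ↦ 1 - 1 / ((n : ℝ) + 2)
    have hr1 : ∀ n, r n < 1 := fun n ↦ sub_lt_self _ (by positivity)
    have hr2 : ∀ n, 1 / 2 ≤ r n := fun n ↦ by
      have : 1 / ((n : ℝ) + 2) ≤ 1 / 2 := by gcongr; linarith [Nat.cast_nonneg (α := ℝ) n]
      simp only [r]; linarith
    have hrm : Monotone r := fun i j hij ↦ by simp only [r]; gcongr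
    set S : ℕ → Set (Euc m) := fun n ↦ oball m (r n) ∩ Metric.ball e (1 / 4)
    have hU : oball m 1 ∩ Metric.ball e (1 / 4) = ⋃ n, S n := by
      rw [← iUnion_inter]
      congr 1
      ext x
      simp only [mem_iUnion, mem_oball]
      refine ⟨fun hx ↦ ?_, fun ⟨n, hn⟩ ↦ hn.trans (hr1 n)⟩
      obtain ⟨n, hn⟩ := exists_nat_one_div_lt (sub_pos.2 hx)
      refine ⟨n, ?_⟩
      have : 1 / ((n : ℝ) + 2) ≤ 1 / ((n : ℝ) + 1) := by gcongr; norm_num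
      simp only [r]; linarith
    have hSm : Monotone S := fun i j hij ↦
      inter_subset_inter_left _ (Metric.ball_subset_ball (hrm hij))
    have hSmeas : ∀ n, MeasurableSet (S n) := fun n ↦ measurableSet_oball.inter measurableSet_ball
    rw [hU, setLIntegral_iUnion_of_directed _ hSm.directed_le]
    refine iSup_le fun n ↦ ?_
    have hKA : Metric.closedBall (0 : Euc m) (r n) ⊆ oball m 1 := Metric.closedBall_subset_ball (hr1 n)
    have hseg : ∀ x ∈ S n, ∀ t ∈ Icc (0 : ℝ) 1, x + t • (-e) ∈ Metric.closedBall 0 (r n) := by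
      intro x hx t ht
      have h1 : ‖x‖ < r n := mem_oball.1 hx.1
      have h2 : ‖x - e‖ < 1 / 4 := by rw [← dist_eq_norm]; exact hx.2
      rw [mem_closedBall_zero_iff, show x + t • (-e) = (1 - t) • x + t • (x - e) by module]
      refine (norm_add_le _ _).trans ?_
      rw [norm_smul, norm_smul, Real.norm_of_nonneg ht.1, Real.norm_of_nonneg (sub_nonneg.2 ht.2)]
      nlinarith [ht.1, ht.2, hr2 n]
    obtain ⟨f', hf', hff'⟩ := h.1.exists_integrable_eqOn (isCompact_closedBall 0 (r n)) hKA
    have h1 := h.lintegral_translate_sub_le isOpen_oball (isCompact_closedBall 0 (r n)) hKA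
      (hSmeas n) hseg
    have hin0 : ∀ x ∈ S n, f' x = f x := fun x hx ↦ hff' x (by simpa using hseg x hx 0 (by simp))
    have hin1 : ∀ x ∈ S n, f' (x + -e) = f (x + -e) := fun x hx ↦
      hff' _ (by simpa using hseg x hx 1 (by simp))
    have m1 : AEMeasurable (fun x ↦ ‖f' (x + -e)‖ₑ) (volume.restrict (S n)) :=
      (hf'.aestronglyMeasurable.comp_quasiMeasurePreserving
        (measurePreserving_add_right volume (-e)).quasiMeasurePreserving).enorm.restrict
    calc ∫⁻ x in S n, ‖f x‖ₑ
        ≤ ∫⁻ x in S n, (‖f' (x + -e)‖ₑ + ‖f (x + -e) - f x‖ₑ) := by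
          refine setLIntegral_mono' (hSmeas n) fun x hx ↦ ?_
          rw [hin1 x hx, ← edist_eq_enorm_sub, edist_comm, edist_eq_enorm_sub]
          calc ‖f x‖ₑ = ‖f (x + -e) + (f x - f (x + -e))‖ₑ := by congr 1; abel
            _ ≤ _ := enorm_add_le _ _
      _ = (∫⁻ x in S n, ‖f' (x + -e)‖ₑ) + ∫⁻ x in S n, ‖f (x + -e) - f x‖ₑ :=
          lintegral_add_left' m1 _
      _ ≤ (∫⁻ x in oball m (1 / 4), ‖f x‖ₑ) + ∫⁻ x in oball m 1, ‖D x‖ₑ := by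
          refine add_le_add ?_ ?_
          · rw [← lintegral_indicator (hSmeas n), ← lintegral_indicator measurableSet_oball,
              ← lintegral_add_right_eq_self (fun x ↦ (oball m (1 / 4)).indicator _ x) (-e)]
            refine lintegral_mono fun x ↦ ?_
            by_cases hx : x ∈ S n
            · have : x + -e ∈ oball m (1 / 4) := by
                have h2 : dist x e < 1 / 4 := hx.2
                rwa [mem_oball, ← sub_eq_add_neg, ← dist_eq_norm]
              rw [indicator_of_mem hx, indicator_of_mem this, hin1 x hx]
            · simp [indicator_of_notMem hx]
          · refine h1.trans ?_
            rw [← one_mul (∫⁻ x in oball m 1, ‖D x‖ₑ)]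
            refine mul_le_mul' ?_ (lintegral_mono_set hKA)
            rw [enorm_neg, ← ofReal_norm]
            exact ENNReal.ofReal_le_one.2 he
  have hcomp : ∫⁻ x in oball m 1 ∩ Metric.closedBall 0 1, ‖f x‖ₑ < ⊤ := by
    refine (isCompact_closedBall (0 : Euc m) 1).induction_on
      (p := fun s ↦ ∫⁻ x in oball m 1 ∩ s, ‖f x‖ₑ < ⊤) (by simp) ?_ ?_ ?_
    · exact fun s t hst ht ↦ (lintegral_mono_set (inter_subset_inter_right _ hst)).trans_lt ht
    · intro s t hs ht
      rw [inter_union_distrib_left]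
      exact (lintegral_union_le _ _ _).trans_lt (ENNReal.add_lt_top.2 ⟨hs, ht⟩)
    · intro e he
      refine ⟨Metric.ball e (1 / 4), mem_nhdsWithin_of_mem_nhds (Metric.ball_mem_nhds _ (by norm_num)),
        (key e (mem_closedBall_zero_iff.1 he)).trans_lt ?_⟩
      exact ENNReal.add_lt_top.2 ⟨hM.lt_top, hD.lt_top⟩
  rw [inter_eq_left.2 (show oball m 1 ⊆ _ from Metric.ball_subset_closedBall)] at hcomp
  exact hcomp

/-- A Poincaré inequality for maps which are constant off the ball of radius `1 / 2`. -/
lemma HasWeakDerivOn.lintegral_sub_const_le [CompleteSpace F] (hm : 1 ≤ m) {f : Euc m → F}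
    {D : Euc m → Euc m →L[ℝ] F} (h : HasWeakDerivOn f D univ) {c : F}
    (hc : ∀ x ∉ oball m (1 / 2), f x = c) :
    ∫⁻ x, ‖f x - c‖ₑ ≤ ∫⁻ x in Metric.closedBall 0 2, ‖D x‖ₑ := by
  have : Nonempty (Fin m) := ⟨⟨0, hm⟩⟩
  obtain ⟨v, hv⟩ := exists_norm_eq (Euc m) zero_le_one
  have h1 := h.lintegral_translate_sub_le isOpen_univ (isCompact_closedBall (0 : Euc m) 2)
    (subset_univ _) (S := oball m (1 / 2)) measurableSet_oball (v := v) (fun x hx t ht ↦ by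
      rw [mem_closedBall_zero_iff]
      refine (norm_add_le _ _).trans ?_
      rw [norm_smul, hv, Real.norm_of_nonneg ht.1]
      linarith [mem_oball.1 hx, ht.2])
  have hv' : ‖v‖ₑ = 1 := by rw [← ofReal_norm, hv, ENNReal.ofReal_one]
  rw [hv', one_mul] at h1
  refine le_trans (le_of_eq ?_) h1
  rw [← setLIntegral_eq_of_support_subset (s := oball m (1 / 2))]
  · refine setLIntegral_congr_fun measurableSet_oball fun x hx ↦ ?_
    have : x + v ∉ oball m (1 / 2) := by
      rw [mem_oball, not_lt]
      have h3 : ‖v‖ ≤ ‖x + v‖ + ‖x‖ := by simpa using norm_sub_le (x + v) x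
      linarith [mem_oball.1 hx]
    simp only [hc _ this, ← edist_eq_enorm_sub]
    rw [edist_comm]
  · intro x hx
    by_contra hxs
    exact hx (by simp [hc x hxs])

end

/-! ### Changes of variables, approximation up to the boundary and sums of disjoint pieces -/

section

variable {m : ℕ} {F : Type*} [NormedAddCommGroup F] [NormedSpace ℝ F]

/-- The affine map `x ↦ a + r x`, as a homeomorphism. -/
noncomputable def dilateHomeo (a : Euc m) {r : ℝ} (hr : 0 < r) : Euc m ≃ₜ Euc m :=
  (Homeomorph.smulOfNeZero r hr.ne').trans (Homeomorph.addLeft a)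

lemma dilateHomeo_apply (a : Euc m) {r : ℝ} (hr : 0 < r) (x : Euc m) :
    dilateHomeo a hr x = a + r • x := rfl

lemma dilateHomeo_symm_apply (a : Euc m) {r : ℝ} (hr : 0 < r) (x : Euc m) :
    (dilateHomeo a hr).symm x = r⁻¹ • (x - a) := by
  rw [Homeomorph.symm_apply_eq, dilateHomeo_apply, smul_inv_smul₀ hr.ne', add_sub_cancel]

lemma map_dilateHomeo_volume (a : Euc m) {r : ℝ} (hr : 0 < r) :
    Measure.map (dilateHomeo a hr) volume = (ENNReal.ofReal r ^ m)⁻¹ • volume := by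
  ext S hS
  rw [Measure.map_apply (dilateHomeo a hr).measurable hS, ← lintegral_indicator_one
    ((dilateHomeo a hr).measurable hS)]
  have := lintegral_comp_add_smul (S.indicator 1) a hr
  rw [lintegral_indicator_one hS] at this
  exact this

lemma quasiMeasurePreserving_dilateHomeo (a : Euc m) {r : ℝ} (hr : 0 < r) :
    Measure.QuasiMeasurePreserving (dilateHomeo a hr) :=
  ⟨(dilateHomeo a hr).measurable, by
    rw [map_dilateHomeo_volume]; exact Measure.smul_absolutelyContinuous⟩

lemma integral_comp_add_smul (f : Euc m → F) (a : Euc m) {r : ℝ} (hr : 0 < r) :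
    ∫ x, f (a + r • x) = (r ^ m)⁻¹ • ∫ x, f x := by
  have h1 := Measure.integral_comp_smul (volume : Measure (Euc m)) (fun x ↦ f (a + x)) r
  rw [h1, integral_add_left_eq_self f a]
  simp only [finrank_euclideanSpace, Fintype.card_fin]
  rw [abs_of_pos (by positivity)]

omit [NormedSpace ℝ F] in
lemma MeasureTheory.LocallyIntegrableOn.comp_dilateHomeo {f : Euc m → F} {A : Set (Euc m)}
    (h : LocallyIntegrableOn f A volume) (a : Euc m) {r : ℝ} (hr : 0 < r) :
    LocallyIntegrableOn (fun x ↦ f (a + r • x)) ((fun x ↦ a + r • x) ⁻¹' A) volume := by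
  intro x hx
  set T := dilateHomeo a hr
  obtain ⟨U, hU, hi⟩ := h (T x) hx
  refine ⟨T ⁻¹' U, ?_, ?_⟩
  · have h1 : Tendsto T (𝓝[T ⁻¹' A] x) (𝓝[A] (T x)) :=
      T.continuous.continuousWithinAt.tendsto_nhdsWithin (fun y hy ↦ hy)
    exact h1 hU
  · have h2 : IntegrableOn f U (Measure.map T volume) := by
      rw [map_dilateHomeo_volume]
      rw [IntegrableOn, Measure.restrict_smul]
      refine Integrable.smul_measure hi ?_
      have : 0 < ENNReal.ofReal r := by simpa using hr
      simp [this.ne']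
    exact (T.measurableEmbedding.integrableOn_map_iff).1 h2

/-- Weak derivatives and affine changes of variables. -/
lemma HasWeakDerivOn.comp_affine {f : Euc m → F} {D : Euc m → Euc m →L[ℝ] F} {A : Set (Euc m)}
    (h : HasWeakDerivOn f D A) (a : Euc m) {r : ℝ} (hr : 0 < r) :
    HasWeakDerivOn (fun x ↦ f (a + r • x)) (fun x ↦ r • D (a + r • x))
      ((fun x ↦ a + r • x) ⁻¹' A) := by
  set T := dilateHomeo a hr
  refine ⟨h.1.comp_dilateHomeo a hr, ?_, fun φ hφ hc hs v ↦ ?_⟩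
  · intro x hx
    obtain ⟨U, hU, hi⟩ := h.2.1.comp_dilateHomeo a hr x hx
    exact ⟨U, hU, Integrable.smul r hi⟩
  set ψ : Euc m → ℝ := fun y ↦ φ (r⁻¹ • (y - a))
  have hψT : ψ = φ ∘ T.symm := by
    ext y; simp only [ψ, Function.comp_apply, T, dilateHomeo_symm_apply]
  have hψ : ContDiff ℝ ∞ ψ := hφ.comp ((contDiff_id.sub contDiff_const).const_smul r⁻¹)
  have hψc : HasCompactSupport ψ := by rw [hψT]; exact hc.comp_homeomorph T.symm
  have hψt : tsupport ψ = T.symm ⁻¹' tsupport φ := by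
    rw [hψT]; exact tsupport_comp_eq_preimage φ T.symm
  have hψs : tsupport ψ ⊆ A := by
    rw [hψt]
    intro y hy
    have := hs hy
    simpa [T, dilateHomeo_symm_apply, smul_inv_smul₀ hr.ne'] using this
  have hinv : ∀ x : Euc m, r⁻¹ • ((a + r • x) - a) = x := fun x ↦ by
    rw [add_sub_cancel_left, inv_smul_smul₀ hr.ne']
  have hd : ∀ x : Euc m, fderiv ℝ φ x v = r * fderiv ℝ ψ (a + r • x) v := by
    intro x
    have h1 : HasFDerivAt (fun y : Euc m ↦ r⁻¹ • (y - a)) (r⁻¹ • ContinuousLinearMap.id ℝ (Euc m))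
        (a + r • x) := ((hasFDerivAt_id _).sub_const a).const_smul r⁻¹
    have h2 : HasFDerivAt ψ ((fderiv ℝ φ x).comp (r⁻¹ • ContinuousLinearMap.id ℝ (Euc m)))
        (a + r • x) := by
      refine HasFDerivAt.comp (g := φ) (a + r • x) ?_ h1
      rw [hinv]
      exact (hφ.differentiable (by simp) x).hasFDerivAt
    rw [h2.fderiv]
    simp [hr.ne']
  have e1 := integral_comp_add_smul (fun y ↦ (fderiv ℝ ψ y v) • f y) a hr
  have e2 := integral_comp_add_smul (fun y ↦ ψ y • D y v) a hr
  have key := h.integral_eq hψ hψc hψs v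
  have hr' : ∀ B : Set (Euc m), tsupport φ ⊆ B →
      ∫ x in B, (fderiv ℝ φ x v) • f (a + r • x) = ∫ x, (fderiv ℝ φ x v) • f (a + r • x) := by
    intro B hB
    refine setIntegral_eq_integral_of_forall_compl_eq_zero fun x hx ↦ ?_
    have : fderiv ℝ φ x = 0 := image_eq_zero_of_notMem_tsupport
      fun h ↦ hx (hB (tsupport_fderiv_subset ℝ h))
    simp [this]
  have hr'' : ∫ x in (fun x ↦ a + r • x) ⁻¹' A, φ x • (r • D (a + r • x)) v =
      ∫ x, φ x • (r • D (a + r • x)) v := by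
    refine setIntegral_eq_integral_of_forall_compl_eq_zero fun x hx ↦ ?_
    rw [image_eq_zero_of_notMem_tsupport (fun h ↦ hx (hs h)), zero_smul]
  rw [hr' _ hs, hr'']
  simp only [hd, mul_smul, smul_apply]
  rw [integral_smul, e1, key, smul_neg, smul_neg, ← e2, ← integral_smul]
  congr 1
  refine integral_congr_ae (Eventually.of_forall fun x ↦ ?_)
  simp only [ψ, hinv]
  rw [smul_comm]

lemma enorm_le_enorm_sub_add {E : Type*} [NormedAddCommGroup E] (a b c : E) :
    ‖a - c‖ₑ ≤ ‖a - b‖ₑ + ‖b - c‖ₑ := by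
  simp only [← edist_eq_enorm_sub]
  exact edist_triangle _ _ _

/-- A map of class `W^{1,1}` on the unit ball is the limit of maps of class `C^1` up to the
boundary, as one sees by dilating it slightly and mollifying it. -/
lemma HasWeakDerivOn.exists_contDiff_oball [CompleteSpace F] {f : Euc m → F}
    {D : Euc m → Euc m →L[ℝ] F} (h : HasWeakDerivOn f D (oball m 1))
    (hf : IntegrableOn f (oball m 1)) (hD : IntegrableOn D (oball m 1)) {δ : ℝ≥0∞} (hδ : 0 < δ) :
    ∃ g : Euc m → F, ContDiff ℝ 1 g ∧ ∫⁻ x in oball m 1, ‖g x - f x‖ₑ ≤ δ ∧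
      ∫⁻ x in oball m 1, ‖fderiv ℝ g x - D x‖ₑ ≤ δ := by
  have hext : ∀ {E : Type _} [NormedAddCommGroup E] {f : Euc m → E}, IntegrableOn f (oball m 1) →
      ∃ g : Euc m → E, Integrable g ∧ ∀ x ∈ oball m 1, g x = f x := fun {_} _ {f} hf ↦
    ⟨(oball m 1).indicator f, hf.integrable_indicator measurableSet_oball,
      fun _ hx ↦ indicator_of_mem hx _⟩
  obtain ⟨f', hf', hff'⟩ := hext hf
  obtain ⟨D', hD', hDD'⟩ := hext hD
  have hδ2 : 0 < δ / 2 := ENNReal.half_pos hδ.ne'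
  have t1 := tendsto_lintegral_dilate_sub hf'
  have t2 : Tendsto (fun r : ℝ ↦ ∫⁻ x, ‖r • D' (r • x) - D' x‖ₑ) (𝓝 1) (𝓝 0) := by
    have t3 := tendsto_lintegral_dilate_sub hD'
    have t4 : Tendsto (fun r : ℝ ↦ ‖r‖ₑ * (∫⁻ x, ‖D' (r • x) - D' x‖ₑ) +
        ‖r - 1‖ₑ * ∫⁻ x, ‖D' x‖ₑ) (𝓝 1) (𝓝 (‖(1 : ℝ)‖ₑ * 0 + ‖(1 : ℝ) - 1‖ₑ * ∫⁻ x, ‖D' x‖ₑ)) := by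
      have c1 : Continuous fun r : ℝ ↦ ‖r‖ₑ := by fun_prop
      have c2 : Continuous fun r : ℝ ↦ ‖r - 1‖ₑ := by fun_prop
      refine (ENNReal.Tendsto.mul (c1.tendsto 1) (by simp) t3 (by simp)).add ?_
      exact ENNReal.Tendsto.mul_const (c2.tendsto 1) (Or.inr hD'.2.ne)
    simp only [mul_zero, sub_self, enorm_zero, zero_mul, add_zero] at t4
    refine tendsto_of_tendsto_of_tendsto_of_le_of_le tendsto_const_nhds t4 (fun _ ↦ zero_le)
      fun r ↦ ?_
    simp only
    rw [← lintegral_const_mul' _ _ (by simp), ← lintegral_const_mul' _ _ (by simp),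
      ← lintegral_add_right' _ (by exact hD'.aestronglyMeasurable.enorm.const_mul _)]
    refine lintegral_mono fun x ↦ ?_
    rw [← enorm_smul, ← enorm_smul, sub_smul, one_smul, smul_sub]
    exact enorm_le_enorm_sub_add _ (r • D' x) _
  have e1 := (ENNReal.tendsto_nhds_zero.1 t1) _ hδ2
  have e2 := (ENNReal.tendsto_nhds_zero.1 t2) _ hδ2
  have e3 : ∀ᶠ r : ℝ in 𝓝 1, 0 < r := lt_mem_nhds one_pos
  have e4 : ∃ᶠ r : ℝ in 𝓝 1, r < 1 :=
    (frequently_lt_nhds (1 : ℝ))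
  obtain ⟨r, hr1, ⟨⟨h1, h2⟩, hr0⟩⟩ := (e4.and_eventually ((e1.and e2).and e3)).exists
  have hw := h.comp_affine 0 hr0
  simp only [zero_add] at hw
  have hA : IsOpen ((fun x : Euc m ↦ r • x) ⁻¹' oball m 1) :=
    isOpen_oball.preimage (continuous_const_smul r)
  have hsub : ∀ x : Euc m, ‖x‖ ≤ 1 → r • x ∈ oball m 1 := fun x hx ↦ by
    rw [mem_oball, norm_smul, Real.norm_of_nonneg hr0.le]
    nlinarith [norm_nonneg x]
  obtain ⟨g, hg, hgf, hgD⟩ := hw.exists_contDiff hA (isCompact_closedBall (0 : Euc m) 1)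
    (fun x hx ↦ hsub x (mem_closedBall_zero_iff.1 hx)) hδ2
  have hT : Measure.QuasiMeasurePreserving (fun x : Euc m ↦ r • x) := by
    have : (fun x : Euc m ↦ r • x) = dilateHomeo 0 hr0 := by
      funext x
      rw [dilateHomeo_apply, zero_add]
    rw [this]
    exact quasiMeasurePreserving_dilateHomeo 0 hr0
  have hBK : oball m 1 ⊆ Metric.closedBall (0 : Euc m) 1 := Metric.ball_subset_closedBall
  refine ⟨g, hg, ?_, ?_⟩
  · have m1 : AEMeasurable (fun x ↦ ‖f' (r • x) - f' x‖ₑ) (volume.restrict (oball m 1)) :=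
      ((hf'.aestronglyMeasurable.comp_quasiMeasurePreserving hT).sub
        hf'.aestronglyMeasurable).enorm.restrict
    calc ∫⁻ x in oball m 1, ‖g x - f x‖ₑ
        ≤ ∫⁻ x in oball m 1, (‖g x - f (r • x)‖ₑ + ‖f' (r • x) - f' x‖ₑ) := by
          refine setLIntegral_mono' measurableSet_oball fun x hx ↦ ?_
          rw [hff' x hx, hff' _ (hsub x (mem_oball.1 hx).le)]
          exact enorm_le_enorm_sub_add _ _ _
      _ = _ := lintegral_add_right' _ m1
      _ ≤ δ / 2 + δ / 2 := add_le_add ((lintegral_mono_set hBK).trans hgf)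
          ((setLIntegral_le_lintegral _ _).trans h1)
      _ = δ := ENNReal.add_halves δ
  · have m1 : AEMeasurable (fun x ↦ ‖r • D' (r • x) - D' x‖ₑ) (volume.restrict (oball m 1)) :=
      (((hD'.aestronglyMeasurable.comp_quasiMeasurePreserving hT).const_smul r).sub
        hD'.aestronglyMeasurable).enorm.restrict
    calc ∫⁻ x in oball m 1, ‖fderiv ℝ g x - D x‖ₑ
        ≤ ∫⁻ x in oball m 1, (‖fderiv ℝ g x - r • D (r • x)‖ₑ + ‖r • D' (r • x) - D' x‖ₑ) := by
          refine setLIntegral_mono' measurableSet_oball fun x hx ↦ ?_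
          rw [hDD' x hx, hDD' _ (hsub x (mem_oball.1 hx).le)]
          exact enorm_le_enorm_sub_add _ _ _
      _ = _ := lintegral_add_right' _ m1
      _ ≤ δ / 2 + δ / 2 := add_le_add ((lintegral_mono_set hBK).trans hgD)
          ((setLIntegral_le_lintegral _ _).trans h2)
      _ = δ := ENNReal.add_halves δ

omit [NormedSpace ℝ F] in
lemma integrable_of_iUnion {κ : Type*} [Countable κ] {S : κ → Set (Euc m)}
    (hS : ∀ i, MeasurableSet (S i)) (hd : Pairwise (Function.onFun Disjoint S)) {f : Euc m → F}
    {f' : κ → Euc m → F} (hf' : ∀ i, LocallyIntegrable (f' i) volume)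
    (hff' : ∀ i, ∀ x ∈ S i, f x = f' i x) (h0 : ∀ x ∉ ⋃ i, S i, f x = 0)
    (hsum : ∑' i, ∫⁻ x in S i, ‖f' i x‖ₑ ≠ ⊤) : Integrable f := by
  have hae : ∀ i, f' i =ᵐ[volume.restrict (S i)] f := fun i ↦
    (ae_restrict_iff' (hS i)).2 (Eventually.of_forall fun x hx ↦ (hff' i x hx).symm)
  have hsupp : Function.support f ⊆ ⋃ i, S i := fun x hx ↦ by_contra fun h ↦ hx (h0 x h)
  rw [← integrableOn_iff_integrable_of_support_subset hsupp]
  refine ⟨aestronglyMeasurable_iUnion_iff.2 fun i ↦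
    (hf' i).aestronglyMeasurable.restrict.congr (hae i), ?_⟩
  rw [HasFiniteIntegral, lintegral_iUnion hS hd]
  refine lt_of_le_of_lt (le_of_eq ?_) hsum.lt_top
  exact tsum_congr fun i ↦ setLIntegral_congr_fun (hS i) fun x hx ↦ by rw [hff' i x hx]

/-- Maps with disjoint supports may be summed, with their weak derivatives. -/
lemma HasWeakDerivOn.of_disjoint {κ : Type*} [Countable κ] {S : κ → Set (Euc m)}
    (hS : ∀ i, MeasurableSet (S i)) (hd : Pairwise (Function.onFun Disjoint S)) {f : Euc m → F}
    {D : Euc m → Euc m →L[ℝ] F} {f' : κ → Euc m → F} {D' : κ → Euc m → Euc m →L[ℝ] F}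
    (h : ∀ i, HasWeakDerivOn (f' i) (D' i) univ) (hf'0 : ∀ i, ∀ x ∉ S i, f' i x = 0)
    (hD'0 : ∀ i, ∀ᵐ x, x ∉ S i → D' i x = 0)
    (hff' : ∀ i, ∀ x ∈ S i, f x = f' i x) (hf0 : ∀ x ∉ ⋃ i, S i, f x = 0)
    (hDD' : ∀ i, ∀ x ∈ S i, D x = D' i x) (hD0 : ∀ x ∉ ⋃ i, S i, D x = 0)
    (hfs : ∑' i, ∫⁻ x in S i, ‖f' i x‖ₑ ≠ ⊤) (hDs : ∑' i, ∫⁻ x in S i, ‖D' i x‖ₑ ≠ ⊤) :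
    HasWeakDerivOn f D univ := by
  have hfi : Integrable f := integrable_of_iUnion hS hd
    (fun i ↦ locallyIntegrableOn_univ.1 (h i).1) hff' hf0 hfs
  have hDi : Integrable D := integrable_of_iUnion hS hd
    (fun i ↦ locallyIntegrableOn_univ.1 (h i).2.1) hDD' hD0 hDs
  refine ⟨hfi.locallyIntegrable.locallyIntegrableOn _, hDi.locallyIntegrable.locallyIntegrableOn _,
    fun φ hφ hc hs v ↦ ?_⟩
  simp only [Measure.restrict_univ]
  have hcont : Continuous fun x ↦ fderiv ℝ φ x v :=
    (hφ.continuous_fderiv (by simp)).clm_apply continuous_const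
  have hcs : HasCompactSupport fun x ↦ fderiv ℝ φ x v :=
    (hc.fderiv ℝ).comp_left (g := fun L : Euc m →L[ℝ] ℝ ↦ L v) rfl
  have i1 : Integrable fun x ↦ (fderiv ℝ φ x v) • f x :=
    hfi.locallyIntegrable.integrable_smul_left_of_hasCompactSupport hcont hcs
  have i2 : Integrable fun x ↦ φ x • D x v :=
    (hDi.locallyIntegrable.clm_apply v).integrable_smul_left_of_hasCompactSupport hφ.continuous hc
  have s1 : ∫ x, (fderiv ℝ φ x v) • f x = ∑' i, ∫ x, (fderiv ℝ φ x v) • f' i x := by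
    rw [← setIntegral_eq_integral_of_forall_compl_eq_zero (s := ⋃ i, S i)
      (fun x hx ↦ by rw [hf0 x hx, smul_zero]), integral_iUnion hS hd i1.integrableOn]
    refine tsum_congr fun i ↦ ?_
    have e : ∫ x in S i, (fderiv ℝ φ x v) • f' i x = ∫ x, (fderiv ℝ φ x v) • f' i x :=
      setIntegral_eq_integral_of_forall_compl_eq_zero
        (fun x hx ↦ by rw [hf'0 i x hx, smul_zero])
    rw [← e]
    exact setIntegral_congr_fun (hS i) fun x hx ↦ by simp only [hff' i x hx]
  have s2 : ∫ x, φ x • D x v = ∑' i, ∫ x, φ x • D' i x v := by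
    rw [← setIntegral_eq_integral_of_forall_compl_eq_zero (s := ⋃ i, S i)
      (fun x hx ↦ by rw [hD0 x hx]; simp), integral_iUnion hS hd i2.integrableOn]
    refine tsum_congr fun i ↦ ?_
    have e : ∫ x in S i, φ x • D' i x v = ∫ x, φ x • D' i x v :=
      setIntegral_eq_integral_of_ae_compl_eq_zero
        (by filter_upwards [hD'0 i] with x hx hxS; rw [hx hxS]; simp)
    rw [← e]
    exact setIntegral_congr_fun (hS i) fun x hx ↦ by simp only [hDD' i x hx]
  rw [s1, s2, ← tsum_neg]
  exact tsum_congr fun i ↦ (h i).integral_eq hφ hc hs v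

omit [NormedSpace ℝ F] in
lemma MeasureTheory.LocallyIntegrableOn.fun_add' {f g : Euc m → F} {A : Set (Euc m)}
    (hf : LocallyIntegrableOn f A volume) (hg : LocallyIntegrableOn g A volume) :
    LocallyIntegrableOn (fun x ↦ f x + g x) A volume :=
  hf.add hg

lemma HasWeakDerivOn.add {f g : Euc m → F} {D D' : Euc m → Euc m →L[ℝ] F}
    (hf : HasWeakDerivOn f D univ) (hg : HasWeakDerivOn g D' univ) :
    HasWeakDerivOn (fun x ↦ f x + g x) (fun x ↦ D x + D' x) univ := by
  have h1 : LocallyIntegrableOn (fun x ↦ f x + g x) univ volume := hf.1.fun_add' hg.1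
  have h2 : LocallyIntegrableOn (fun x ↦ D x + D' x) univ volume := hf.2.1.fun_add' hg.2.1
  refine ⟨h1, h2, fun φ hφ hc hs v ↦ ?_⟩
  have hcont : Continuous fun x ↦ fderiv ℝ φ x v :=
    (hφ.continuous_fderiv (by simp)).clm_apply continuous_const
  have hcs : HasCompactSupport fun x ↦ fderiv ℝ φ x v :=
    (hc.fderiv ℝ).comp_left (g := fun L : Euc m →L[ℝ] ℝ ↦ L v) rfl
  simp only [Measure.restrict_univ, smul_add, add_apply]
  rw [integral_add, integral_add, hf.integral_eq hφ hc hs v, hg.integral_eq hφ hc hs v, neg_add]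
  · exact ((locallyIntegrableOn_univ.1 hf.2.1).clm_apply
      v).integrable_smul_left_of_hasCompactSupport hφ.continuous hc
  · exact ((locallyIntegrableOn_univ.1 hg.2.1).clm_apply
      v).integrable_smul_left_of_hasCompactSupport hφ.continuous hc
  · exact (locallyIntegrableOn_univ.1 hf.1).integrable_smul_left_of_hasCompactSupport hcont hcs
  · exact (locallyIntegrableOn_univ.1 hg.1).integrable_smul_left_of_hasCompactSupport hcont hcs

end

/-! ### Opening of Sobolev maps -/

section

variable {m : ℕ}

/-- For almost every parameter the opened function is locally integrable, whatever the size of the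
ball: the averaged estimate is used on countably many balls. -/
lemma ae_lintegral_opening_lt_top (hm : 1 ≤ m) {F : Euc m → ℝ≥0∞} (hF : Measurable F)
    (hs : ∫⁻ x in oball m 1, F x ≠ ⊤) :
    ∀ᵐ h ∂volume.restrict (oball m 1), ∀ R : ℝ, ∫⁻ x in oball m R, F (opening h x) < ⊤ := by
  have hN : ∀ n : ℕ, ∀ᵐ h ∂volume.restrict (oball m 1),
      ∫⁻ x in oball m n, F (opening h x) < ⊤ := fun n ↦ by
    obtain ⟨C, hC, hle⟩ := lintegral_opening_le hm (n : ℝ)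
    refine ae_lt_top ?_ (ne_top_of_le_ne_top (ENNReal.mul_ne_top hC hs) (hle F hF))
    exact Measurable.lintegral_prod_right' (f := fun q : Euc m × Euc m ↦ F (opening q.1 q.2))
      (hF.comp continuous_opening.measurable)
  filter_upwards [ae_all_iff.2 hN] with h hh R
  obtain ⟨n, hn⟩ := exists_nat_ge R
  exact (lintegral_mono_set (Metric.ball_subset_ball hn)).trans_lt (hh n)

/-- A sequence of functions which converges fast to zero in `L^1` of the unit ball
still does so, on every ball, after composition with almost every opening map. -/
lemma ae_tendsto_lintegral_opening (hm : 1 ≤ m) {F : ℕ → Euc m → ℝ≥0∞}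
    (hF : ∀ k, Measurable (F k)) (hs : ∑' k, ∫⁻ x in oball m 1, F k x ≠ ⊤) :
    ∀ᵐ h ∂volume.restrict (oball m 1), ∀ R : ℝ,
      Tendsto (fun k ↦ ∫⁻ x in oball m R, F k (opening h x)) atTop (𝓝 0) := by
  have hF' : Measurable fun x ↦ ∑' k, F k x := Measurable.tsum hF
  have := ae_lintegral_opening_lt_top hm hF' (by
    rwa [lintegral_tsum fun k ↦ (hF k).aemeasurable])
  filter_upwards [this] with h hh R
  have h1 := (hh R).ne
  have hm' : ∀ k, Measurable fun x ↦ F k (opening h x) := fun k ↦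
    (hF k).comp (lipschitzWith_opening h).continuous.measurable
  rw [lintegral_tsum fun k ↦ (hm' k).aemeasurable] at h1
  exact ENNReal.tendsto_atTop_zero_of_tsum_ne_top h1

variable {F : Type*} [NormedAddCommGroup F] [NormedSpace ℝ F] [FiniteDimensional ℝ F]

lemma norm_fderiv_opening_le (h x : Euc m) : ‖fderiv ℝ (opening h) x‖ ≤ 3 := by
  simpa using norm_fderiv_le_of_lipschitz ℝ (lipschitzWith_opening h) (x₀ := x)

lemma enorm_fderiv_opening_le (h x : Euc m) : ‖fderiv ℝ (opening h) x‖ₑ ≤ 3 := by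
  rw [← ofReal_norm]
  refine (ENNReal.ofReal_le_ofReal (norm_fderiv_opening_le h x)).trans ?_
  simp

lemma fderiv_opening_of_lt {h x : Euc m} (hh : ‖h‖ < 1) (hx : 5 < ‖x‖) :
    fderiv ℝ (opening h) x = 0 := by
  have : opening h =ᶠ[𝓝 x] fun _ ↦ h := by
    filter_upwards [(isOpen_lt continuous_const continuous_norm).mem_nhds hx] with y hy
    exact opening_of_ge hh (le_of_lt hy)
  rw [this.fderiv_eq, fderiv_fun_const]
  rfl

omit [FiniteDimensional ℝ F] in
lemma enorm_comp_fderiv_opening_le (L : Euc m →L[ℝ] F) (h x : Euc m) :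
    ‖L.comp (fderiv ℝ (opening h) x)‖ₑ ≤ 3 * ‖L‖ₑ := by
  refine (ContinuousLinearMap.opENorm_comp_le _ _).trans ?_
  rw [mul_comm]
  exact mul_le_mul' (enorm_fderiv_opening_le h x) le_rfl

lemma hasWeakDerivOn_comp_opening {g : Euc m → F} (hg : ContDiff ℝ 1 g) (h : Euc m) :
    HasWeakDerivOn (g ∘ opening h)
      (fun x ↦ (fderiv ℝ g (opening h x)).comp (fderiv ℝ (opening h) x)) univ := by
  obtain ⟨K, hK⟩ := hg.contDiffOn.exists_lipschitzOnWith (s := Metric.closedBall (0 : Euc m) 1)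
    (by simp) (convex_closedBall _ _) (isCompact_closedBall _ _)
  have hmaps : MapsTo (opening h) univ (Metric.closedBall (0 : Euc m) 1) := fun x _ ↦
    mem_closedBall_zero_iff.2 (norm_opening_le h x)
  have hL := lipschitzOnWith_univ.1
    (hK.comp (lipschitzOnWith_univ.2 (lipschitzWith_opening h)) hmaps)
  refine hL.hasWeakDerivOn_fderiv.congr_ae (ae_eq_refl _) ?_
  rw [Measure.restrict_univ]
  filter_upwards [(lipschitzWith_opening h).ae_differentiableAt (μ := volume)] with x hx
  exact fderiv_comp x (hg.differentiable (by simp) _) hx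

omit [FiniteDimensional ℝ F] in
lemma stronglyMeasurable_comp_fderiv_opening {D : Euc m → Euc m →L[ℝ] F}
    (hD : StronglyMeasurable D) (h : Euc m) :
    StronglyMeasurable fun x ↦ (D (opening h x)).comp (fderiv ℝ (opening h) x) := by
  borelize (Euc m →L[ℝ] Euc m)
  have h1 : StronglyMeasurable fun x ↦ fderiv ℝ (opening h) x :=
    (measurable_fderiv ℝ _).stronglyMeasurable
  have h2 : StronglyMeasurable fun x ↦ D (opening h x) :=
    hD.comp_measurable (lipschitzWith_opening h).continuous.measurable
  exact isBoundedBilinearMap_comp.continuous.comp_stronglyMeasurable (h2.prodMk h1)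

/-- If `f` is weakly differentiable on the unit ball with integrable weak derivative then so is
its composition with almost every opening map. -/
lemma ae_hasWeakDerivOn_opening (hm : 1 ≤ m) {f : Euc m → F} {D : Euc m → Euc m →L[ℝ] F}
    (hf : StronglyMeasurable f) (hD : StronglyMeasurable D) (h : HasWeakDerivOn f D (oball m 1))
    (hDi : ∫⁻ x in oball m 1, ‖D x‖ₑ ≠ ⊤) :
    ∀ᵐ h ∂volume.restrict (oball m 1), HasWeakDerivOn (f ∘ opening h)
      (fun x ↦ (D (opening h x)).comp (fderiv ℝ (opening h) x)) univ := by
  have : CompleteSpace F := FiniteDimensional.complete ℝ F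
  have hfi : IntegrableOn f (oball m 1) := h.integrableOn_oball hDi
  have hDi' : IntegrableOn D (oball m 1) := ⟨hD.aestronglyMeasurable, hDi.lt_top⟩
  choose g hg hgf hgD using fun k : ℕ ↦ h.exists_contDiff_oball hfi hDi'
    (δ := 2⁻¹ ^ k) (by simp [pos_iff_ne_zero])
  have hsum : ∑' k : ℕ, (2⁻¹ : ℝ≥0∞) ^ k ≠ ⊤ := by
    rw [ENNReal.tsum_geometric, ENNReal.one_sub_inv_two, inv_inv]
    exact ENNReal.ofNat_ne_top
  borelize (Euc m →L[ℝ] F)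
  have m1 : ∀ k, Measurable fun x ↦ ‖g k x - f x‖ₑ := fun k ↦
    ((hg k).continuous.stronglyMeasurable.sub hf).enorm
  have m2 : ∀ k, Measurable fun x ↦ ‖fderiv ℝ (g k) x - D x‖ₑ := fun k ↦
    (((hg k).continuous_fderiv (by simp)).stronglyMeasurable.sub hD).enorm
  filter_upwards [ae_tendsto_lintegral_opening hm m1
      (ne_top_of_le_ne_top hsum (ENNReal.tsum_le_tsum hgf)),
    ae_tendsto_lintegral_opening hm m2 (ne_top_of_le_ne_top hsum (ENNReal.tsum_le_tsum hgD)),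
    ae_lintegral_opening_lt_top hm hf.enorm hfi.2.ne,
    ae_lintegral_opening_lt_top hm hD.enorm hDi] with h t1 t2 f1 f2
  have hloc : ∀ {E : Type _} [NormedAddCommGroup E] {u : Euc m → E}, StronglyMeasurable u →
      (∀ R : ℝ, ∫⁻ x in oball m R, ‖u x‖ₑ < ⊤) → LocallyIntegrable u volume := by
    intro E _ u hu hfin x
    exact ⟨oball m (‖x‖ + 1), isOpen_oball.mem_nhds (mem_oball.2 (lt_add_one _)),
      hu.aestronglyMeasurable, hfin _⟩
  refine HasWeakDerivOn.of_tendsto (fun k ↦ hasWeakDerivOn_comp_opening (hg k) h)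
    (hloc (hf.comp_measurable (lipschitzWith_opening h).continuous.measurable) f1)
    (hloc (stronglyMeasurable_comp_fderiv_opening hD h) fun R ↦ ?_) t1 fun R ↦ ?_
  · refine (lintegral_mono fun x ↦ enorm_comp_fderiv_opening_le _ h x).trans_lt ?_
    rw [lintegral_const_mul' _ _ (by simp)]
    exact ENNReal.mul_lt_top (by simp) (f2 R)
  · have t3 := ENNReal.Tendsto.const_mul (a := 3) (t2 R) (Or.inr (by simp))
    rw [mul_zero] at t3
    refine tendsto_of_tendsto_of_tendsto_of_le_of_le tendsto_const_nhds t3 (fun _ ↦ zero_le)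
      fun k ↦ ?_
    simp only
    rw [← lintegral_const_mul' _ _ (by simp)]
    refine lintegral_mono fun x ↦ ?_
    rw [← ContinuousLinearMap.sub_comp]
    exact enorm_comp_fderiv_opening_le _ h x

lemma setLIntegral_enorm_le_add_rpow {E : Type*} [NormedAddCommGroup E] {p : ℝ} (hp : 1 ≤ p)
    (D : Euc m → E) (A : Set (Euc m)) :
    ∫⁻ x in A, ‖D x‖ₑ ≤ volume A + ∫⁻ x in A, ‖D x‖ₑ ^ p := by
  have h1 : ∫⁻ x in A, ‖D x‖ₑ ≤ ∫⁻ x in A, (1 + ‖D x‖ₑ ^ p) := by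
    refine lintegral_mono fun x ↦ ?_
    rcases le_total (‖D x‖ₑ) 1 with h | h
    · exact h.trans le_self_add
    · refine le_trans ?_ le_add_self
      simpa using ENNReal.rpow_le_rpow_of_exponent_le h hp
  rw [lintegral_add_left measurable_const] at h1
  simpa using h1

/-- Averaged over the parameter, the Dirichlet energy of the composition with an opening map is
controlled by the Dirichlet energy on the unit ball. -/
lemma lintegral_dirichletEnergy_opening_le (hm : 1 ≤ m) {p : ℝ} (hp : 1 ≤ p) :
    ∃ C : ℝ≥0∞, C ≠ ⊤ ∧ ∀ f : Euc m → F, StronglyMeasurable f →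
      ∫⁻ h in oball m 1, dirichletEnergy p (f ∘ opening h) univ ≤
        C * dirichletEnergy p f (oball m 1) := by
  have : CompleteSpace F := FiniteDimensional.complete ℝ F
  obtain ⟨C, hC, hle⟩ := lintegral_opening_le hm (m := m) 6
  refine ⟨3 ^ p * C + 1, by simp [hC, ENNReal.mul_eq_top], fun f hf ↦ ?_⟩
  rcases eq_or_ne (dirichletEnergy p f (oball m 1)) ⊤ with htop | htop
  · rw [htop, ENNReal.mul_top (by simp)]
    exact le_top
  obtain ⟨D₀, hD₀, hE⟩ := exists_hasWeakDerivOn_of_dirichletEnergy_lt_top isOpen_oball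
    (lt_top_iff_ne_top.2 htop)
  have hmeas : AEStronglyMeasurable D₀ (volume.restrict (oball m 1)) :=
    hD₀.2.1.aestronglyMeasurable
  set D := hmeas.mk D₀
  have hDm : StronglyMeasurable D := hmeas.stronglyMeasurable_mk
  have hD : HasWeakDerivOn f D (oball m 1) := hD₀.congr_ae (ae_eq_refl _) hmeas.ae_eq_mk
  have hE' : dirichletEnergy p f (oball m 1) = ∫⁻ x in oball m 1, ‖D x‖ₑ ^ p :=
    dirichletEnergy_eq isOpen_oball hD
  have hw := ae_hasWeakDerivOn_opening hm hf hDm hD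
    (ne_top_of_le_ne_top (ENNReal.add_ne_top.2 ⟨volume_oball_ne_top, hE' ▸ htop⟩)
      (setLIntegral_enorm_le_add_rpow hp D _))
  have hp0 : 0 ≤ p := by linarith
  have h3 : (3 : ℝ≥0∞) ^ p ≠ ⊤ := ENNReal.rpow_ne_top_of_nonneg hp0 (by simp)
  calc ∫⁻ h in oball m 1, dirichletEnergy p (f ∘ opening h) univ
      ≤ ∫⁻ h in oball m 1, 3 ^ p * ∫⁻ x in oball m 6, ‖D (opening h x)‖ₑ ^ p := by
        refine lintegral_mono_ae ?_
        filter_upwards [hw, ae_restrict_mem measurableSet_oball] with h hh hhB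
        rw [dirichletEnergy_eq isOpen_univ hh, Measure.restrict_univ,
          ← lintegral_const_mul' _ _ h3, ← lintegral_indicator measurableSet_oball]
        refine lintegral_mono fun x ↦ ?_
        by_cases hx : x ∈ oball m 6
        · rw [indicator_of_mem hx, ← ENNReal.mul_rpow_of_nonneg _ _ hp0]
          exact ENNReal.rpow_le_rpow (enorm_comp_fderiv_opening_le _ h x) hp0
        · rw [indicator_of_notMem hx, fderiv_opening_of_lt (mem_oball.1 hhB)]
          · have : 0 < p := by linarith
            simp only [ContinuousLinearMap.comp_zero, nonpos_iff_eq_zero,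
              ENNReal.rpow_eq_zero_iff_of_pos this]
            exact enorm_zero (E := Euc m →L[ℝ] F)
          · rw [mem_oball, not_lt] at hx
            linarith
    _ = 3 ^ p * ∫⁻ h in oball m 1, ∫⁻ x in oball m 6, ‖D (opening h x)‖ₑ ^ p :=
        lintegral_const_mul' _ _ h3
    _ ≤ 3 ^ p * (C * ∫⁻ x in oball m 1, ‖D x‖ₑ ^ p) :=
        mul_le_mul' le_rfl (hle _ (hDm.enorm.pow_const p))
    _ ≤ (3 ^ p * C + 1) * dirichletEnergy p f (oball m 1) := by
        rw [hE', ← mul_assoc]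
        exact mul_le_mul' le_self_add le_rfl

variable {N : Type*} [MetricSpace N] [SecondCountableTopology N] [MeasurableSpace N] [BorelSpace N]
  {ν : ℕ} {ι : N → Euc ν} {s p : ℝ}

omit [FiniteDimensional ℝ F] in
lemma dirichletEnergy_congr_ae {f g : Euc m → F} {A : Set (Euc m)}
    (h : f =ᵐ[volume.restrict A] g) : dirichletEnergy p f A = dirichletEnergy p g A :=
  le_antisymm
    (le_iInf₂ fun D hD ↦ iInf₂_le D (hD.congr_ae h.symm (ae_eq_refl _)))
    (le_iInf₂ fun D hD ↦ iInf₂_le D (hD.congr_ae h (ae_eq_refl _)))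

omit [SecondCountableTopology N] [MeasurableSpace N] [BorelSpace N] in
lemma sobolevEnergy_congr_ae {u w : Euc m → N} {A : Set (Euc m)}
    (h : u =ᵐ[volume.restrict A] w) : sobolevEnergy ι s p u A = sobolevEnergy ι s p w A := by
  unfold sobolevEnergy
  split_ifs
  · refine dirichletEnergy_congr_ae ?_
    filter_upwards [h] with x hx
    simp only [Function.comp_apply, hx]
  · refine lintegral_congr_ae ?_
    filter_upwards [h] with x hx
    refine lintegral_congr_ae ?_
    filter_upwards [h] with y hy
    rw [hx, hy]

lemma lintegral_sobolevEnergy_opening_le (hm : 1 ≤ m) (hs : 0 < s) (hp : 1 ≤ p)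
    (hι : s = 1 → Continuous ι) :
    ∃ C : ℝ≥0∞, C ≠ ⊤ ∧ ∀ u : Euc m → N, Measurable u →
      ∫⁻ h in oball m 1, sobolevEnergy ι s p (u ∘ opening h) univ ≤
        C * sobolevEnergy ι s p u (oball m 1) := by
  by_cases h1 : s = 1
  · obtain ⟨C, hC, hle⟩ := lintegral_dirichletEnergy_opening_le (F := Euc ν) hm hp
    refine ⟨C, hC, fun u hu ↦ ?_⟩
    simp only [sobolevEnergy, if_pos h1]
    exact hle (ι ∘ u) ((hι h1).measurable.comp hu).stronglyMeasurable
  · simpa only [sobolevEnergy, if_neg h1] using lintegral_gagliardoEnergy_opening_le hm hs hp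

/-- The opening construction: a map on the unit ball agrees there with a map on the whole
space which is constant near infinity and whose energy is of the same order. -/
lemma exists_eqOn_oball_sobolevEnergy_le (hm : 1 ≤ m) (hs : 0 < s) (hp : 1 ≤ p)
    (hι : s = 1 → Continuous ι) :
    ∃ C : ℝ≥0∞, C ≠ ⊤ ∧ ∀ u : Euc m → N, MeasOn u (oball m 1) →
      sobolevEnergy ι s p u (oball m 1) ≠ 0 → sobolevEnergy ι s p u (oball m 1) ≠ ⊤ →
      ∃ (w : Euc m → N) (b : N), MeasOn w univ ∧ EqOn w u (oball m 1) ∧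
        (∀ x, 5 ≤ ‖x‖ → w x = b) ∧
        sobolevEnergy ι s p w univ ≤ C * sobolevEnergy ι s p u (oball m 1) := by
  obtain ⟨C, hC, hle⟩ := lintegral_sobolevEnergy_opening_le hm hs hp hι
  set V := volume (oball m 1)
  have hV0 : V ≠ 0 := (Metric.measure_ball_pos _ _ one_pos).ne'
  have hVt : V ≠ ⊤ := volume_oball_ne_top
  refine ⟨(C + 1) / V, ENNReal.div_ne_top (by simp [hC]) hV0, fun u hu h0 ht ↦ ?_⟩
  set E := sobolevEnergy ι s p u (oball m 1)
  set u' := hu.mk u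
  have hu' : Measurable u' := hu.measurable_mk
  have hE' : sobolevEnergy ι s p u' (oball m 1) = E :=
    (sobolevEnergy_congr_ae hu.ae_eq_mk).symm
  obtain ⟨h, hh, hhE⟩ : ∃ h ∈ oball m 1,
      sobolevEnergy ι s p (u' ∘ opening h) univ ≤ (C + 1) / V * E := by
    by_contra! hcon
    have h1 : (C + 1) * E ≤ C * E := calc
      (C + 1) * E = ∫⁻ _h in oball m 1, (C + 1) / V * E := by
        rw [lintegral_const, Measure.restrict_apply_univ, mul_right_comm,
          ENNReal.div_mul_cancel hV0 hVt]
      _ ≤ ∫⁻ h in oball m 1, sobolevEnergy ι s p (u' ∘ opening h) univ :=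
        setLIntegral_mono' measurableSet_oball fun h hh ↦ (hcon h hh).le
      _ ≤ C * E := by rw [← hE']; exact hle u' hu'
    refine absurd h1 (not_le.2 ?_)
    exact ENNReal.mul_lt_mul_left h0 ht (ENNReal.lt_add_right hC one_ne_zero)
  classical
  set w := (oball m 1).piecewise u (u' ∘ opening h)
  have hwu : w =ᵐ[volume] u' ∘ opening h := by
    have := (ae_restrict_iff' (measurableSet_oball (m := m) (r := 1))).1 hu.ae_eq_mk
    filter_upwards [this] with x hx
    by_cases hxB : x ∈ oball m 1
    · simp only [w, piecewise_eq_of_mem _ _ _ hxB, Function.comp_apply,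
        opening_of_lt (mem_oball.1 hh) (mem_oball.1 hxB).le]
      exact hx hxB
    · simp only [w, piecewise_eq_of_notMem _ _ _ hxB]
  have hwm : MeasOn w univ := by
    rw [MeasOn, Measure.restrict_univ]
    exact ⟨_, hu'.comp (lipschitzWith_opening h).continuous.measurable, hwu⟩
  refine ⟨w, u' h, hwm, fun x hx ↦ piecewise_eq_of_mem _ _ _ hx, fun x hx ↦ ?_, ?_⟩
  · have hxB : x ∉ oball m 1 := by rw [mem_oball]; linarith
    simp only [w, piecewise_eq_of_notMem _ _ _ hxB, Function.comp_apply,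
      opening_of_ge (mem_oball.1 hh) hx]
  · rw [sobolevEnergy_congr_ae (w := u' ∘ opening h) (by rwa [Measure.restrict_univ])]
    exact hhE

end

/-! ### Gluing and rescaling -/

section

variable {m : ℕ}

/-- The gluing of maps `V i` on disjoint sets `S i` with a map `T` on the complement. -/
lemma exists_glue {N κ : Type*} {S : κ → Set (Euc m)}
    (hd : Pairwise (Function.onFun Disjoint S)) (V : κ → Euc m → N) (T : Euc m → N) :
    ∃ w : Euc m → N, (∀ i, ∀ x ∈ S i, w x = V i x) ∧ ∀ x ∉ ⋃ i, S i, w x = T x := by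
  classical
  refine ⟨fun x ↦ if h : ∃ i, x ∈ S i then V h.choose x else T x, fun i x hx ↦ ?_, fun x hx ↦ ?_⟩
  · have h : ∃ i, x ∈ S i := ⟨i, hx⟩
    have : h.choose = i := by
      by_contra hne
      exact (hd hne).le_bot ⟨h.choose_spec, hx⟩
    simp only [dif_pos h, this]
  · exact dif_neg (by simpa using hx)

section Measurability

variable {N : Type*} [MetricSpace N] [MeasurableSpace N] {κ : Type*} [Countable κ]
  {S : κ → Set (Euc m)} {V : κ → Euc m → N} {T w : Euc m → N}

omit [MetricSpace N] in
lemma measOn_univ {u : Euc m → N} : MeasOn u univ ↔ AEMeasurable u volume := by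
  rw [MeasOn, Measure.restrict_univ]

omit [MetricSpace N] in
lemma measOn_of_glue (hS : ∀ i, MeasurableSet (S i)) (hV : ∀ i, MeasOn (V i) univ)
    (hT : MeasOn T univ) (hwV : ∀ i, ∀ x ∈ S i, w x = V i x) (hwT : ∀ x ∉ ⋃ i, S i, w x = T x) :
    MeasOn w univ := by
  have hSu : MeasurableSet (⋃ i, S i) := MeasurableSet.iUnion hS
  rw [MeasOn, ← union_compl_self (⋃ i, S i), aemeasurable_union_iff, aemeasurable_iUnion_iff]
  refine ⟨fun i ↦ ?_, ?_⟩
  · refine (measOn_univ.1 (hV i)).restrict.congr ?_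
    exact (ae_restrict_iff' (hS i)).2 (Eventually.of_forall fun x hx ↦ (hwV i x hx).symm)
  · refine (measOn_univ.1 hT).restrict.congr ?_
    exact (ae_restrict_iff' hSu.compl).2 (Eventually.of_forall fun x hx ↦ (hwT x hx).symm)

variable [SecondCountableTopology N] [BorelSpace N]

lemma aemeasurable_gagliardo {u : Euc m → N} (hu : AEMeasurable u volume) (p q : ℝ) (x : Euc m) :
    AEMeasurable (fun y ↦ edist (u x) (u y) ^ p / edist x y ^ q) volume :=
  ((aemeasurable_const.edist hu).pow_const p).div
    ((measurable_const.edist measurable_id).pow_const q).aemeasurable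

lemma aemeasurable_lintegral_gagliardo {u : Euc m → N} (hu : AEMeasurable u volume) (p q : ℝ) :
    AEMeasurable (fun x ↦ ∫⁻ y, edist (u x) (u y) ^ p / edist x y ^ q) volume := by
  refine AEMeasurable.lintegral_prod_right'
    (f := fun z : Euc m × Euc m ↦ edist (u z.1) (u z.2) ^ p / edist z.1 z.2 ^ q) ?_
  have h1 : AEMeasurable (fun z : Euc m × Euc m ↦ u z.1) (volume.prod volume) :=
    hu.comp_quasiMeasurePreserving Measure.quasiMeasurePreserving_fst
  have h2 : AEMeasurable (fun z : Euc m × Euc m ↦ u z.2) (volume.prod volume) :=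
    hu.comp_quasiMeasurePreserving Measure.quasiMeasurePreserving_snd
  exact ((h1.edist h2).pow_const p).div
    ((measurable_fst.edist measurable_snd).pow_const q).aemeasurable

omit [Countable κ] [SecondCountableTopology N] [BorelSpace N] [MeasurableSpace N] in
/-- Two points see at most two of the glued pieces. -/
lemma edist_rpow_glue_le {p : ℝ} (hp : 1 ≤ p) {b : N}
    (hd : Pairwise (Function.onFun Disjoint S)) (hVb : ∀ i, ∀ x ∉ S i, V i x = b)
    (hTb : ∀ i, ∀ x ∈ S i, T x = b) (hwV : ∀ i, ∀ x ∈ S i, w x = V i x)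
    (hwT : ∀ x ∉ ⋃ i, S i, w x = T x) (x y : Euc m) :
    edist (w x) (w y) ^ p ≤
      2 ^ p * (edist (T x) (T y) ^ p + ∑' i, edist (V i x) (V i y) ^ p) := by
  have hp0 : 0 < p := by linarith
  have h2 : ∀ a c : N, edist a c ^ p ≤ 2 ^ p * (edist a b ^ p + edist b c ^ p) := fun a c ↦
    (edist_rpow_le hp a b c).trans
      (mul_le_mul' (ENNReal.rpow_le_rpow_of_exponent_le (by norm_num) (by linarith)) le_rfl)
  have h1 : ∀ X : ℝ≥0∞, X ≤ 2 ^ p * X := fun X ↦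
    le_mul_of_one_le_left' (ENNReal.one_le_rpow (by norm_num) hp0)
  have hle : ∀ i, edist (V i x) (V i y) ^ p ≤ ∑' i, edist (V i x) (V i y) ^ p := fun i ↦
    ENNReal.le_tsum i
  by_cases hx : x ∈ ⋃ i, S i <;> by_cases hy : y ∈ ⋃ i, S i
  · obtain ⟨i, hi⟩ := mem_iUnion.1 hx
    obtain ⟨j, hj⟩ := mem_iUnion.1 hy
    rw [hwV i x hi, hwV j y hj]
    rcases eq_or_ne i j with rfl | hij
    · exact ((hle i).trans le_add_self).trans (h1 _)
    · have hyi : y ∉ S i := fun h ↦ (hd hij).le_bot ⟨h, hj⟩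
      have hxj : x ∉ S j := fun h ↦ (hd hij).le_bot ⟨hi, h⟩
      refine (h2 _ _).trans (mul_le_mul' le_rfl (le_trans ?_ le_add_self))
      classical
      have h3 : ∑ k ∈ {i, j}, edist (V k x) (V k y) ^ p ≤ ∑' i, edist (V i x) (V i y) ^ p :=
        ENNReal.sum_le_tsum _
      rwa [Finset.sum_pair hij, hVb i y hyi, hVb j x hxj] at h3
  · obtain ⟨i, hi⟩ := mem_iUnion.1 hx
    have hyi : y ∉ S i := fun h ↦ hy (mem_iUnion.2 ⟨i, h⟩)
    rw [hwV i x hi, hwT y hy]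
    refine (h2 _ _).trans (mul_le_mul' le_rfl ?_)
    rw [add_comm, hTb i x hi]
    refine add_le_add le_rfl ?_
    have := hle i
    rwa [hVb i y hyi] at this
  · obtain ⟨j, hj⟩ := mem_iUnion.1 hy
    have hxj : x ∉ S j := fun h ↦ hx (mem_iUnion.2 ⟨j, h⟩)
    rw [hwV j y hj, hwT x hx]
    refine (h2 _ _).trans (mul_le_mul' le_rfl ?_)
    rw [hTb j y hj]
    refine add_le_add le_rfl ?_
    have := hle j
    rwa [hVb j x hxj] at this
  · rw [hwT x hx, hwT y hy]
    exact le_self_add.trans (h1 _)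

/-- The energy density of the glued map `w` is controlled by the triangle inequality
`edist (w x) (w y) ≤ edist (T x) (T y) + ∑' i, edist (V i x) (V i y)`, in which at most two terms of the
sum do not vanish, since `V i` is constant off `S i`. -/
lemma gagliardoEnergy_glue_le {s p : ℝ} (hp : 1 ≤ p) {b : N}
    (hd : Pairwise (Function.onFun Disjoint S)) (hV : ∀ i, MeasOn (V i) univ)
    (hT : MeasOn T univ) (hVb : ∀ i, ∀ x ∉ S i, V i x = b)
    (hTb : ∀ i, ∀ x ∈ S i, T x = b) (hwV : ∀ i, ∀ x ∈ S i, w x = V i x)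
    (hwT : ∀ x ∉ ⋃ i, S i, w x = T x) :
    gagliardoEnergy s p w univ ≤
      2 ^ p * (gagliardoEnergy s p T univ + ∑' i, gagliardoEnergy s p (V i) univ) := by
  have h2 : (2 : ℝ≥0∞) ^ p ≠ ⊤ := ENNReal.rpow_ne_top_of_nonneg (by linarith) (by simp)
  have hV' := fun i ↦ measOn_univ.1 (hV i)
  have hT' := measOn_univ.1 hT
  simp only [gagliardoEnergy, Measure.restrict_univ]
  set q := (m : ℝ) + s * p
  rw [← lintegral_tsum fun i ↦ aemeasurable_lintegral_gagliardo (hV' i) p q,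
    ← lintegral_add_left' (aemeasurable_lintegral_gagliardo hT' p q),
    ← lintegral_const_mul' _ _ h2]
  refine lintegral_mono fun x ↦ ?_
  rw [← lintegral_tsum fun i ↦ aemeasurable_gagliardo (hV' i) p q x,
    ← lintegral_add_left' (aemeasurable_gagliardo hT' p q x), ← lintegral_const_mul' _ _ h2]
  refine lintegral_mono fun y ↦ ?_
  refine (ENNReal.div_le_div_right
    (edist_rpow_glue_le hp hd hVb hTb hwV hwT x y) _).trans (le_of_eq ?_)
  simp only [div_eq_mul_inv]
  rw [mul_assoc, add_mul, ENNReal.tsum_mul_right]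

end Measurability

variable {F : Type*} [NormedAddCommGroup F] [NormedSpace ℝ F] [FiniteDimensional ℝ F]

lemma HasWeakDerivOn.sub_const {f : Euc m → F} {D : Euc m → Euc m →L[ℝ] F}
    (h : HasWeakDerivOn f D univ) (c : F) : HasWeakDerivOn (fun x ↦ f x - c) D univ := by
  have := h.add (hasWeakDerivOn_const (-c))
  simpa only [← sub_eq_add_neg, Pi.zero_apply, add_zero] using this

omit [NormedSpace ℝ F] [FiniteDimensional ℝ F] in
lemma lintegral_enorm_eq_of_ae {D : Euc m → F} {A : Set (Euc m)} (hA : MeasurableSet A)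
    (h : ∀ᵐ x, x ∉ A → D x = 0) : ∫⁻ x, ‖D x‖ₑ = ∫⁻ x in A, ‖D x‖ₑ := by
  rw [← lintegral_indicator hA]
  refine lintegral_congr_ae ?_
  filter_upwards [h] with x hx
  by_cases hxA : x ∈ A
  · rw [indicator_of_mem hxA]
  · rw [indicator_of_notMem hxA, hx hxA, enorm_zero]

omit [NormedSpace ℝ F] [FiniteDimensional ℝ F] in
lemma lintegral_rpow_add_le {κ : Type*} [Countable κ] {S : κ → Set (Euc m)} {p : ℝ}
    (hS : ∀ i, MeasurableSet (S i)) (hd : Pairwise (Function.onFun Disjoint S))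
    {D₀ D : Euc m → F} {D' : κ → Euc m → F}
    (h0 : ∀ i, ∀ᵐ x ∂volume.restrict (S i), D₀ x = 0) (hD : ∀ i, ∀ x ∈ S i, D x = D' i x)
    (hD0 : ∀ x ∉ ⋃ i, S i, D x = 0) :
    ∫⁻ x, ‖D₀ x + D x‖ₑ ^ p ≤ (∫⁻ x, ‖D₀ x‖ₑ ^ p) + ∑' i, ∫⁻ x, ‖D' i x‖ₑ ^ p := by
  have hSu : MeasurableSet (⋃ i, S i) := MeasurableSet.iUnion hS
  rw [← lintegral_add_compl _ hSu, add_comm, lintegral_iUnion hS hd]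
  refine add_le_add ?_ (ENNReal.tsum_le_tsum fun i ↦ ?_)
  · refine le_trans (le_of_eq ?_) (setLIntegral_le_lintegral (⋃ i, S i)ᶜ _)
    exact setLIntegral_congr_fun hSu.compl fun x hx ↦ by simp only [hD0 x hx, add_zero]
  · refine le_trans (le_of_eq ?_) (setLIntegral_le_lintegral (S i) _)
    refine lintegral_congr_ae ?_
    filter_upwards [h0 i, ae_restrict_mem (hS i)] with x hx hxS
    rw [hx, zero_add, hD i x hxS]

/-- Gluing for the Dirichlet energy. The inequality of Poincaré makes the sum of the glued pieces
integrable. -/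
lemma dirichletEnergy_glue_le (hm : 1 ≤ m) {p : ℝ} (hp : 1 ≤ p) {κ : Type*} [Countable κ]
    {S K : κ → Set (Euc m)} (hS : ∀ i, IsOpen (S i)) (hd : Pairwise (Function.onFun Disjoint S))
    (hS2 : ∀ i, S i ⊆ oball m (1 / 2)) (hK : ∀ i, IsClosed (K i)) (hKS : ∀ i, K i ⊆ S i)
    {V : κ → Euc m → F} {T w : Euc m → F} {b : F} (hVb : ∀ i, ∀ x ∉ K i, V i x = b)
    (hTb : ∀ i, ∀ x ∈ S i, T x = b) (hwV : ∀ i, ∀ x ∈ S i, w x = V i x)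
    (hwT : ∀ x ∉ ⋃ i, S i, w x = T x) :
    dirichletEnergy p w univ ≤ dirichletEnergy p T univ + ∑' i, dirichletEnergy p (V i) univ := by
  have : CompleteSpace F := FiniteDimensional.complete ℝ F
  rcases eq_or_ne (dirichletEnergy p T univ + ∑' i, dirichletEnergy p (V i) univ) ⊤ with htop | htop
  · rw [htop]; exact le_top
  obtain ⟨hTt, hVt⟩ := ENNReal.add_ne_top.1 htop
  have hSm := fun i ↦ (hS i).measurableSet
  obtain ⟨D₀, hD₀, hE₀⟩ := exists_hasWeakDerivOn_of_dirichletEnergy_lt_top isOpen_univ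
    (lt_top_iff_ne_top.2 hTt)
  choose D' hD' hE' using fun i ↦ exists_hasWeakDerivOn_of_dirichletEnergy_lt_top (f := V i)
    isOpen_univ (lt_top_iff_ne_top.2 (ENNReal.ne_top_of_tsum_ne_top hVt i))
  simp only [Measure.restrict_univ] at hE₀ hE'
  obtain ⟨D, hDD', hD0⟩ := exists_glue hd D' 0
  have hz : ∀ i, ∀ᵐ x, x ∉ S i → D' i x = 0 := fun i ↦ by
    have := (hD' i).ae_eq_zero_of_const (hK i).isOpen_compl (hVb i)
    filter_upwards [(ae_restrict_iff' (hK i).isOpen_compl.measurableSet).1 this] with x hx hxS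
    exact hx fun h ↦ hxS (hKS i h)
  have hvol : ∑' i, volume (S i) ≠ ⊤ := by
    rw [← measure_iUnion hd hSm]
    exact ne_top_of_le_ne_top volume_oball_ne_top (measure_mono (iUnion_subset hS2))
  have hbound : ∀ i, ∫⁻ x in S i, ‖D' i x‖ₑ ≤ volume (S i) + dirichletEnergy p (V i) univ := by
    intro i
    refine (setLIntegral_enorm_le_add_rpow hp (D' i) (S i)).trans (add_le_add le_rfl ?_)
    rw [← hE' i]
    exact setLIntegral_le_lintegral _ _
  have hDs : ∑' i, ∫⁻ x in S i, ‖D' i x‖ₑ ≠ ⊤ := by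
    refine ne_top_of_le_ne_top ?_ (ENNReal.tsum_le_tsum hbound)
    rw [ENNReal.tsum_add]
    exact ENNReal.add_ne_top.2 ⟨hvol, hVt⟩
  have hfs : ∑' i, ∫⁻ x in S i, ‖V i x - b‖ₑ ≠ ⊤ := by
    refine ne_top_of_le_ne_top hDs (ENNReal.tsum_le_tsum fun i ↦ ?_)
    rw [← lintegral_enorm_eq_of_ae (hSm i) (hz i)]
    refine (setLIntegral_le_lintegral _ _).trans (((hD' i).lintegral_sub_const_le hm
      fun x hx ↦ hVb i x fun h ↦ hx (hS2 i (hKS i h))).trans (setLIntegral_le_lintegral _ _))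
  have hsum : HasWeakDerivOn (fun x ↦ w x - T x) D univ := by
    refine HasWeakDerivOn.of_disjoint hSm hd (fun i ↦ (hD' i).sub_const b)
      (fun i x hx ↦ by rw [hVb i x fun h ↦ hx (hKS i h), sub_self]) hz
      (fun i x hx ↦ by rw [hwV i x hx, hTb i x hx]) (fun x hx ↦ by rw [hwT x hx, sub_self]) hDD'
      (fun x hx ↦ hD0 x hx) hfs hDs
  have hw : HasWeakDerivOn w (fun x ↦ D₀ x + D x) univ := by
    have := hD₀.add hsum
    simpa only [add_sub_cancel] using this
  rw [dirichletEnergy_eq isOpen_univ hw, Measure.restrict_univ, ← hE₀]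
  simp only [← hE']
  exact lintegral_rpow_add_le hSm hd
    (fun i ↦ hD₀.ae_eq_zero_of_const (hS i) (hTb i)) hDD' hD0

section Dilation

variable {N : Type*} [MetricSpace N] {ν : ℕ} {ι : N → Euc ν} {s p : ℝ}

/-- The rescaled map `x ↦ u ((x - a) / r)`. -/
noncomputable def rescale {N : Type*} (u : Euc m → N) (a : Euc m) (r : ℝ) (x : Euc m) : N :=
  u (r⁻¹ • (x - a))

lemma rescale_add_smul {N : Type*} (u : Euc m → N) (a : Euc m) {r : ℝ} (hr : 0 < r) (x : Euc m) :
    rescale u a r (a + r • x) = u x := by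
  rw [rescale, add_sub_cancel_left, inv_smul_smul₀ hr.ne']

lemma rescale_eq {N : Type*} (u : Euc m → N) (a : Euc m) (r : ℝ) :
    rescale u a r = fun x ↦ u (-(r⁻¹ • a) + r⁻¹ • x) := by
  funext x
  rw [rescale, smul_sub, sub_eq_neg_add]

lemma measOn_rescale {N : Type*} [MeasurableSpace N] {u : Euc m → N} (hu : MeasOn u univ)
    (a : Euc m) {r : ℝ} (hr : 0 < r) : MeasOn (rescale u a r) univ := by
  rw [measOn_univ] at hu ⊢
  rw [rescale_eq]
  exact hu.comp_quasiMeasurePreserving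
    (quasiMeasurePreserving_dilateHomeo (-(r⁻¹ • a)) (inv_pos.2 hr))

lemma lintegral_eq_comp_add_smul (f : Euc m → ℝ≥0∞) (a : Euc m) {r : ℝ} (hr : 0 < r) :
    ∫⁻ x, f x = ENNReal.ofReal r ^ m * ∫⁻ x, f (a + r • x) := by
  have h0 : ENNReal.ofReal r ^ m ≠ 0 := pow_ne_zero _ (by simpa using hr)
  rw [lintegral_comp_add_smul f a hr, ← mul_assoc, ENNReal.mul_inv_cancel h0 (by simp), one_mul]

lemma edist_add_smul (a x y : Euc m) {r : ℝ} (hr : 0 < r) :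
    edist (a + r • x) (a + r • y) = ENNReal.ofReal r * edist x y := by
  rw [edist_add_left, edist_smul₀, ENNReal.smul_def, smul_eq_mul, ← enorm_eq_nnnorm,
    Real.enorm_of_nonneg hr.le]

lemma lintegral_lintegral_add_smul (Φ : Euc m → Euc m → ℝ≥0∞) (a : Euc m) {r q : ℝ} (hr : 0 < r)
    (hq : 0 ≤ q) : ∫⁻ x, ∫⁻ y, Φ x y / edist x y ^ q =
      ENNReal.ofReal r ^ (m + m - q) *
        ∫⁻ x, ∫⁻ y, Φ (a + r • x) (a + r • y) / edist x y ^ q := by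
  have hR0 : ENNReal.ofReal r ≠ 0 := by simpa using hr
  rw [lintegral_eq_comp_add_smul _ a hr]
  simp_rw [lintegral_eq_comp_add_smul (fun y ↦ Φ _ y / edist _ y ^ q) a hr,
    edist_add_smul a _ _ hr]
  have h1 : ∀ x y : Euc m, Φ (a + r • x) (a + r • y) / (ENNReal.ofReal r * edist x y) ^ q =
      (ENNReal.ofReal r ^ q)⁻¹ * (Φ (a + r • x) (a + r • y) / edist x y ^ q) := by
    intro x y
    rw [ENNReal.mul_rpow_of_nonneg _ _ hq, div_eq_mul_inv, div_eq_mul_inv,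
      ENNReal.mul_inv (Or.inl ?_) (Or.inl ?_)]
    · ring
    · simp [ENNReal.rpow_eq_zero_iff, hR0]
    · exact ENNReal.rpow_ne_top_of_nonneg hq (by simp)
  have hfin : (ENNReal.ofReal r ^ q)⁻¹ ≠ ⊤ := by
    simp [ENNReal.rpow_eq_zero_iff, hR0]
  simp_rw [h1, lintegral_const_mul' _ _ hfin]
  rw [lintegral_const_mul' _ _ (by simp), lintegral_const_mul' _ _ hfin, ← mul_assoc, ← mul_assoc]
  congr 1
  rw [← ENNReal.rpow_natCast, ← ENNReal.rpow_neg,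
    ← ENNReal.rpow_add _ _ hR0 (by simp), ← ENNReal.rpow_add _ _ hR0 (by simp)]
  congr 1

lemma gagliardoEnergy_rescale (u : Euc m → N) (a : Euc m) {r : ℝ} (hr : 0 < r)
    (hq : 0 ≤ (m : ℝ) + s * p) :
    gagliardoEnergy s p (rescale u a r) univ =
      ENNReal.ofReal (r ^ ((m : ℝ) - s * p)) * gagliardoEnergy s p u univ := by
  simp only [gagliardoEnergy, Measure.restrict_univ]
  rw [lintegral_lintegral_add_smul _ a hr hq, ← ENNReal.ofReal_rpow_of_pos hr]
  simp only [rescale_add_smul u a hr]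
  congr 2
  ring

omit [FiniteDimensional ℝ F] in
lemma dirichletEnergy_rescale_le (hp : 0 ≤ p) (f : Euc m → F) (a : Euc m) {r : ℝ} (hr : 0 < r) :
    dirichletEnergy p (rescale f a r) univ ≤
      ENNReal.ofReal (r ^ ((m : ℝ) - p)) * dirichletEnergy p f univ := by
  have hR0 : ENNReal.ofReal r ≠ 0 := by simpa using hr
  have hc0 : ENNReal.ofReal (r ^ ((m : ℝ) - p)) ≠ 0 := by
    simpa using Real.rpow_pos_of_pos hr _
  rw [dirichletEnergy, dirichletEnergy, ENNReal.mul_iInf_of_ne hc0 (by simp)]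
  refine le_iInf fun D ↦ ?_
  rw [ENNReal.mul_iInf_of_ne hc0 (by simp)]
  refine le_iInf fun hD ↦ ?_
  have hw := hD.comp_affine (-(r⁻¹ • a)) (inv_pos.2 hr)
  rw [preimage_univ, ← rescale_eq] at hw
  have h2 : dirichletEnergy p (rescale f a r) univ ≤
      ∫⁻ x in univ, ‖r⁻¹ • D (-(r⁻¹ • a) + r⁻¹ • x)‖ₑ ^ p :=
    iInf₂_le (fun x ↦ r⁻¹ • D (-(r⁻¹ • a) + r⁻¹ • x)) hw
  refine h2.trans (le_of_eq ?_)
  simp only [Measure.restrict_univ, enorm_smul]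
  have h1 : ∀ x : Euc m, (‖r⁻¹‖ₑ * ‖D x‖ₑ) ^ p = ENNReal.ofReal r ^ (-p) * ‖D x‖ₑ ^ p := by
    intro x
    rw [ENNReal.mul_rpow_of_nonneg _ _ hp, Real.enorm_of_nonneg (inv_pos.2 hr).le,
      ENNReal.ofReal_inv_of_pos hr, ENNReal.inv_rpow, ENNReal.rpow_neg]
  simp only [h1]
  rw [lintegral_const_mul' _ _ (by rw [ENNReal.rpow_neg]; simp [ENNReal.rpow_eq_zero_iff, hR0]),
    lintegral_eq_comp_add_smul _ a hr]
  simp only [smul_add, inv_smul_smul₀ hr.ne', neg_add_cancel_left]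
  rw [← mul_assoc]
  congr 1
  rw [← ENNReal.ofReal_rpow_of_pos hr, ← ENNReal.rpow_natCast,
    ← ENNReal.rpow_add _ _ hR0 (by simp)]
  congr 1
  ring

lemma sobolevEnergy_rescale_le (hs : 0 < s) (hp : 1 ≤ p) (u : Euc m → N) (a : Euc m) {r : ℝ}
    (hr : 0 < r) : sobolevEnergy ι s p (rescale u a r) univ ≤
      ENNReal.ofReal (r ^ ((m : ℝ) - s * p)) * sobolevEnergy ι s p u univ := by
  unfold sobolevEnergy
  split_ifs with h1
  · rw [h1, one_mul]
    exact dirichletEnergy_rescale_le (by linarith) (ι ∘ u) a hr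
  · exact (gagliardoEnergy_rescale u a hr (by positivity)).le

end Dilation

/-- Maps `V i` which are constant outside disjoint sets, glued into a map `T` which takes the same
value on these sets: up to a constant the energy of the result is at most the
sum of the energies. -/
lemma sobolevEnergy_glue_le {N : Type*} [MetricSpace N] [MeasurableSpace N]
    [SecondCountableTopology N] [BorelSpace N] {ν : ℕ} {ι : N → Euc ν} {s p : ℝ}
    (hm : 1 ≤ m) (hp : 1 ≤ p) {κ : Type*} [Countable κ] {S K : κ → Set (Euc m)}
    (hS : ∀ i, IsOpen (S i)) (hd : Pairwise (Function.onFun Disjoint S))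
    (hS2 : ∀ i, S i ⊆ oball m (1 / 2)) (hK : ∀ i, IsClosed (K i)) (hKS : ∀ i, K i ⊆ S i)
    {V : κ → Euc m → N} {T w : Euc m → N} {b : N} (hV : ∀ i, MeasOn (V i) univ)
    (hT : MeasOn T univ) (hVb : ∀ i, ∀ x ∉ K i, V i x = b) (hTb : ∀ i, ∀ x ∈ S i, T x = b)
    (hwV : ∀ i, ∀ x ∈ S i, w x = V i x) (hwT : ∀ x ∉ ⋃ i, S i, w x = T x) :
    sobolevEnergy ι s p w univ ≤
      2 ^ p * (sobolevEnergy ι s p T univ + ∑' i, sobolevEnergy ι s p (V i) univ) := by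
  unfold sobolevEnergy
  split_ifs with h1
  · refine (dirichletEnergy_glue_le hm hp hS hd hS2 hK hKS (V := fun i ↦ ι ∘ V i) (T := ι ∘ T)
      (b := ι b) (fun i x hx ↦ by simp [hVb i x hx]) (fun i x hx ↦ by simp [hTb i x hx])
      (fun i x hx ↦ by simp [hwV i x hx]) (fun x hx ↦ by simp only [Function.comp_apply, hwT x hx])).trans ?_
    exact le_mul_of_one_le_left' (ENNReal.one_le_rpow (by norm_num) (by linarith))
  · exact gagliardoEnergy_glue_le hp hd hV hT (fun i x hx ↦ hVb i x fun h ↦ hx (hKS i h)) hTb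
      hwV hwT

end

/-! ### Lipschitz paths in Riemannian manifolds -/

section
variable {m d ν : ℕ} {N : Type*} [MetricSpace N]
    [ChartedSpace (Euc d) N]
    [RiemannianBundle (fun x : N ↦ TangentSpace (𝓡 d) x)]
    [IsRiemannianManifold (𝓡 d) N]  {ι : N → Euc ν}

/-- The image by `ι` of a path of the manifold has the same length, so that `ι` does not increase
distances. The converse comparison fails in general. -/
lemma IsIsometricEmbedding.lipschitzWith (hι : IsIsometricEmbedding (d := d) ι) :
    LipschitzWith 1 ι := by
  intro x y
  rw [ENNReal.coe_one, one_mul]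
  refine le_of_forall_gt fun r hr ↦ ?_
  rw [IsRiemannianManifold.out (I := 𝓡 d) x y] at hr
  obtain ⟨γ, h0, h1, hγ, hL⟩ := exists_lt_of_riemannianEDist_lt hr
  have hs : ContMDiff (𝓡 d) 𝓘(ℝ, Euc ν) 1 ι := hι.contMDiff.of_le (by simp)
  rw [IsRiemannianManifold.out (I := 𝓘(ℝ, Euc ν)) (ι x) (ι y)]
  refine (riemannianEDist_le_pathELength (γ := ι ∘ γ) (a := 0) (b := 1)
    (hs.comp_contMDiffOn hγ) (by simp [h0]) (by simp [h1]) zero_le_one).trans_lt ?_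
  refine lt_of_le_of_lt (le_of_eq ?_) hL
  simp only [pathELength_eq_lintegral_mfderivWithin_Icc]
  refine setLIntegral_congr_fun measurableSet_Icc fun t ht ↦ ?_
  have e1 := mfderivWithin_comp (I := 𝓘(ℝ, ℝ)) (I' := 𝓡 d) (I'' := 𝓘(ℝ, Euc ν)) (s := Icc 0 1)
    (u := univ) t (hs.mdifferentiable one_ne_zero (γ t)).mdifferentiableWithinAt
    ((hγ t ht).mdifferentiableWithinAt one_ne_zero) (fun _ _ ↦ mem_univ _)
    ((uniqueDiffOn_Icc zero_lt_one t ht).uniqueMDiffWithinAt)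
  rw [mfderivWithin_univ] at e1
  simp only [e1]
  have := hι.norm_mfderiv (γ t) (mfderivWithin 𝓘(ℝ, ℝ) (𝓡 d) γ (Icc 0 1) t 1)
  rw [← ofReal_norm, ← ofReal_norm]
  congr 1

/-- Points at distance less than `δ` are joined by a `δ`-Lipschitz path, which is obtained
from a short path of class `C^1` by a reparametrization essentially by arc length. -/
lemma exists_lipschitzOnWith_path (d : ℕ) {N : Type*} [MetricSpace N] [ChartedSpace (Euc d) N]
    [RiemannianBundle (fun x : N ↦ TangentSpace (𝓡 d) x)] [IsRiemannianManifold (𝓡 d) N]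
    {x y : N} {δ : NNReal} (hδ : edist x y < δ) :
    ∃ γ : ℝ → N, γ 0 = x ∧ γ 1 = y ∧ LipschitzOnWith δ γ (Icc 0 1) := by
  rw [IsRiemannianManifold.out (I := 𝓡 d) x y] at hδ
  obtain ⟨γ, h0, h1, hγ, hL⟩ := exists_lt_of_riemannianEDist_lt hδ
  set P : ℝ → ℝ → ℝ≥0∞ := pathELength (𝓡 d) γ
  have hPtop : ∀ {a b : ℝ}, 0 ≤ a → b ≤ 1 → P a b ≠ ⊤ := fun ha hb ↦
    ne_top_of_le_ne_top (hL.trans ENNReal.coe_lt_top).ne (pathELength_mono ha hb)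
  have hadd : ∀ {a b : ℝ}, 0 ≤ a → a ≤ b → b ≤ 1 →
      (P 0 b).toReal = (P 0 a).toReal + (P a b).toReal := fun ha hab hb ↦ by
    rw [← ENNReal.toReal_add (hPtop le_rfl (hab.trans hb)) (hPtop ha hb),
      show P 0 _ + P _ _ = P 0 _ from pathELength_add ha hab]
  set η : ℝ := δ - (P 0 1).toReal
  have hη : 0 < η := by
    have : (P 0 1).toReal < (δ : ℝ≥0∞).toReal :=
      (ENNReal.toReal_lt_toReal (hPtop le_rfl le_rfl) ENNReal.coe_ne_top).2 hL
    simpa [η] using this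
  set l : ℝ → ℝ := fun t ↦ (P 0 t).toReal + η * t
  have hl0 : l 0 = 0 := by simp [l, P]
  have hl1 : l 1 = δ := by simp [l, η]
  have hlmono : ∀ {a b : ℝ}, 0 ≤ a → a < b → b ≤ 1 → l a < l b := fun {a b} ha hab hb ↦ by
    have h2 := hadd ha hab.le hb
    have h3 : 0 ≤ (P a b).toReal := ENNReal.toReal_nonneg
    simp only [l]
    nlinarith
  have hPcont : ContinuousOn (fun t ↦ (P 0 t).toReal) (Icc 0 1) := by
    have hfin : ∫⁻ t in Icc (0 : ℝ) 1, ‖mfderiv 𝓘(ℝ, ℝ) (𝓡 d) γ t 1‖ₑ ≠ ⊤ := by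
      have := hPtop le_rfl (le_refl 1)
      rwa [show P 0 1 = _ from pathELength_eq_lintegral_mfderiv_Icc] at this
    have key : ∀ ε : ℝ, 0 < ε → ∃ r > 0, ∀ a b, 0 ≤ a → a ≤ b → b ≤ 1 → b - a < r →
        (P a b).toReal < ε := by
      intro ε hε
      obtain ⟨r, hr, hrε⟩ := exists_pos_setLIntegral_lt_of_measure_lt hfin
        (ENNReal.ofReal_pos.2 hε).ne'
      obtain ⟨r', hr', hrr'⟩ := ENNReal.lt_iff_exists_nnreal_btwn.1 hr
      refine ⟨r', by exact_mod_cast hr', fun a b ha hab hb hd ↦ ?_⟩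
      have h2 := hrε (Icc a b) (by
        refine (Measure.restrict_apply_le _ _).trans_lt (lt_of_le_of_lt ?_ hrr')
        rw [Real.volume_Icc, ← ENNReal.ofReal_coe_nnreal]
        exact ENNReal.ofReal_le_ofReal hd.le)
      rw [Measure.restrict_restrict measurableSet_Icc,
        inter_eq_left.2 (Icc_subset_Icc ha hb)] at h2
      rw [show P a b = _ from pathELength_eq_lintegral_mfderiv_Icc]
      exact (ENNReal.lt_ofReal_iff_toReal_lt h2.ne_top).1 h2
    refine Metric.continuousOn_iff.2 fun a ha ε hε ↦ ?_
    obtain ⟨r, hr, hrε⟩ := key ε hε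
    refine ⟨r, hr, fun b hb hab ↦ ?_⟩
    rw [Real.dist_eq] at hab ⊢
    rcases le_total a b with h | h
    · rw [abs_of_nonneg (by linarith)] at hab
      rw [hadd ha.1 h hb.2, add_sub_cancel_left, abs_of_nonneg ENNReal.toReal_nonneg]
      exact hrε _ _ ha.1 h hb.2 hab
    · rw [abs_sub_comm, abs_of_nonneg (by linarith)] at hab
      rw [abs_sub_comm, hadd hb.1 h ha.2, add_sub_cancel_left,
        abs_of_nonneg ENNReal.toReal_nonneg]
      exact hrε _ _ hb.1 h ha.2 hab
  have hlcont : ContinuousOn l (Icc 0 1) := hPcont.add (by fun_prop)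
  have hsurj : ∀ u : ℝ, ∃ t, u ∈ Icc (0 : ℝ) 1 → t ∈ Icc (0 : ℝ) 1 ∧ l t = u * δ := by
    intro u
    by_cases hu : u ∈ Icc (0 : ℝ) 1
    · obtain ⟨t, ht, hlt⟩ := intermediate_value_Icc zero_le_one hlcont
        (show u * δ ∈ Icc (l 0) (l 1) by
          rw [hl0, hl1]
          exact ⟨mul_nonneg hu.1 δ.2, mul_le_of_le_one_left δ.2 hu.2⟩)
      exact ⟨t, fun _ ↦ ⟨ht, hlt⟩⟩
    · exact ⟨0, fun h ↦ absurd h hu⟩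
  choose τ hτ using hsurj
  have h0m : (0 : ℝ) ∈ Icc (0 : ℝ) 1 := ⟨le_rfl, zero_le_one⟩
  have h1m : (1 : ℝ) ∈ Icc (0 : ℝ) 1 := ⟨zero_le_one, le_rfl⟩
  have hτ0 : τ 0 = 0 := by
    obtain ⟨ht, hlt⟩ := hτ 0 h0m
    by_contra hne
    have := hlmono le_rfl (lt_of_le_of_ne ht.1 (Ne.symm hne)) ht.2
    rw [hlt, hl0, zero_mul] at this
    exact lt_irrefl _ this
  have hτ1 : τ 1 = 1 := by
    obtain ⟨ht, hlt⟩ := hτ 1 h1m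
    by_contra hne
    have := hlmono ht.1 (lt_of_le_of_ne ht.2 hne) le_rfl
    rw [hlt, hl1, one_mul] at this
    exact lt_irrefl _ this
  have hLip : ∀ u ∈ Icc (0 : ℝ) 1, ∀ v ∈ Icc (0 : ℝ) 1, u ≤ v →
      edist (γ (τ u)) (γ (τ v)) ≤ δ * edist u v := by
    intro u hu v hv huv
    obtain ⟨hut, hul⟩ := hτ u hu
    obtain ⟨hvt, hvl⟩ := hτ v hv
    have hle : τ u ≤ τ v := by
      by_contra! hlt
      have h2 := hlmono hvt.1 hlt hut.2
      rw [hul, hvl] at h2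
      exact absurd h2 (not_lt.2 (mul_le_mul_of_nonneg_right huv δ.2))
    rw [IsRiemannianManifold.out (I := 𝓡 d)]
    refine (riemannianEDist_le_pathELength (hγ.mono (Icc_subset_Icc hut.1 hvt.2)) rfl rfl
      hle).trans ?_
    have h2 := hadd hut.1 hle hvt.2
    have h3 : (P (τ u) (τ v)).toReal ≤ δ * (v - u) := by
      simp only [l] at hul hvl
      nlinarith
    rw [edist_comm, edist_dist, Real.dist_eq, abs_of_nonneg (by linarith),
      ← ENNReal.ofReal_coe_nnreal, ← ENNReal.ofReal_mul δ.coe_nonneg]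
    exact (ENNReal.le_ofReal_iff_toReal_le (hPtop hut.1 hvt.2)
      (mul_nonneg δ.2 (by linarith))).2 h3
  refine ⟨γ ∘ τ, by simp [hτ0, h0], by simp [hτ1, h1], fun u hu v hv ↦ ?_⟩
  rcases le_total u v with h | h
  · exact hLip u hu v hv h
  · rw [edist_comm, edist_comm u v]
    exact hLip v hv u hu h

end

section

variable {m : ℕ} {F : Type*} [NormedAddCommGroup F] [NormedSpace ℝ F]

/-- The energy `ℰ_{s,p}` of a real valued function on the whole space. -/
noncomputable def scalarEnergy (s p : ℝ) (θ : Euc m → ℝ) : ℝ≥0∞ :=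
  open Classical in if s = 1 then dirichletEnergy p θ univ else gagliardoEnergy s p θ univ

lemma norm_fderiv_le_of_norm_sub_le {f : Euc m → F} {θ : Euc m → ℝ} {L : NNReal} {x : Euc m}
    (h : ∀ y, ‖f y - f x‖ ≤ L * ‖θ y - θ x‖) (hf : DifferentiableAt ℝ f x)
    (hθ : DifferentiableAt ℝ θ x) : ‖fderiv ℝ f x‖ ≤ L * ‖fderiv ℝ θ x‖ := by
  refine ContinuousLinearMap.opNorm_le_bound _ (by positivity) fun v ↦ ?_
  have t1 := hf.hasFDerivAt.lim_real v
  have t2 := hθ.hasFDerivAt.lim_real v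
  have h1 : ‖fderiv ℝ f x v‖ ≤ L * ‖fderiv ℝ θ x v‖ := by
    refine le_of_tendsto_of_tendsto' t1.norm (t2.norm.const_mul (L : ℝ)) fun c ↦ ?_
    rw [norm_smul, norm_smul, mul_left_comm]
    exact mul_le_mul_of_nonneg_left (h _) (norm_nonneg _)
  refine h1.trans ?_
  rw [mul_assoc]
  exact mul_le_mul_of_nonneg_left ((fderiv ℝ θ x).le_opNorm v) L.2

variable {N : Type*} [MetricSpace N] {ν : ℕ} {ι : N → Euc ν} {s p : ℝ}

lemma sobolevEnergy_comp_le (hp : 0 ≤ p) (hι : s = 1 → LipschitzWith 1 ι) {γ : ℝ → N}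
    {L K : NNReal} (hγ : LipschitzOnWith L γ (Icc 0 1)) {θ : Euc m → ℝ} (hθ : LipschitzWith K θ)
    (hθ1 : ∀ x, θ x ∈ Icc (0 : ℝ) 1) :
    sobolevEnergy ι s p (γ ∘ θ) univ ≤ (L : ℝ≥0∞) ^ p * scalarEnergy s p θ := by
  have hLp : (L : ℝ≥0∞) ^ p ≠ ⊤ := ENNReal.rpow_ne_top_of_nonneg hp (by simp)
  unfold sobolevEnergy scalarEnergy
  split_ifs with h1
  · have hιγ : LipschitzOnWith L (ι ∘ γ) (Icc 0 1) := by
      simpa using (lipschitzOnWith_univ.2 (hι h1)).comp hγ (mapsTo_univ _ _)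
    have hf : LipschitzWith (L * K) (ι ∘ γ ∘ θ) := lipschitzOnWith_univ.1
      (hιγ.comp (lipschitzOnWith_univ.2 hθ) fun x _ ↦ hθ1 x)
    rw [dirichletEnergy_eq isOpen_univ hf.hasWeakDerivOn_fderiv,
      dirichletEnergy_eq isOpen_univ hθ.hasWeakDerivOn_fderiv, Measure.restrict_univ,
      ← lintegral_const_mul' _ _ hLp]
    refine lintegral_mono_ae ?_
    filter_upwards [hf.ae_differentiableAt (μ := volume), hθ.ae_differentiableAt (μ := volume)]
      with x hfx hθx
    rw [← ENNReal.mul_rpow_of_nonneg _ _ hp]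
    refine ENNReal.rpow_le_rpow ?_ hp
    have h2 : ‖fderiv ℝ (ι ∘ γ ∘ θ) x‖ ≤ L * ‖fderiv ℝ θ x‖ := by
      refine norm_fderiv_le_of_norm_sub_le (fun y ↦ ?_) hfx hθx
      rw [← dist_eq_norm, ← dist_eq_norm]
      exact hιγ.dist_le_mul _ (hθ1 y) _ (hθ1 x)
    rw [← ofReal_norm, ← ofReal_norm, ← ENNReal.ofReal_coe_nnreal, ← ENNReal.ofReal_mul L.coe_nonneg]
    exact ENNReal.ofReal_le_ofReal h2
  · simp only [gagliardoEnergy, Measure.restrict_univ]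
    rw [← lintegral_const_mul' _ _ hLp]
    refine lintegral_mono fun x ↦ ?_
    rw [← lintegral_const_mul' _ _ hLp]
    refine lintegral_mono fun y ↦ ?_
    rw [← mul_div_assoc, ← ENNReal.mul_rpow_of_nonneg _ _ hp]
    exact ENNReal.div_le_div_right (ENNReal.rpow_le_rpow (hγ (hθ1 x) (hθ1 y)) hp) _

end

/-! ### Cutoff functions -/

section

variable {m : ℕ} {s p : ℝ}

/-- A Lipschitz function with values in `[0, 1]`, equal to `1` on the ball of radius `ρ` and
to `0` outside the ball of radius `1 / 2`. -/
structure IsCutoff (K : NNReal) (ρ : ℝ) (θ : Euc m → ℝ) : Prop where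
  lipschitz : LipschitzWith K θ
  mem_Icc : ∀ x, θ x ∈ Icc (0 : ℝ) 1
  eq_one : ∀ x, ‖x‖ ≤ ρ → θ x = 1
  eq_zero : ∀ x, 1 / 2 ≤ ‖x‖ → θ x = 0

/-- The piecewise affine radial cutoff function. -/
noncomputable def bump (x : Euc m) : ℝ := max 0 (min 1 (2 - 4 * ‖x‖))

lemma isCutoff_bump : IsCutoff 4 (1 / 4) (bump : Euc m → ℝ) where
  lipschitz := by
    have h1 : LipschitzWith 4 fun x : Euc m ↦ 2 - 4 * ‖x‖ :=
      LipschitzWith.of_dist_le_mul fun x y ↦ by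
        have h := abs_norm_sub_norm_le y x
        rw [Real.dist_eq, dist_comm, dist_eq_norm, show 2 - 4 * ‖x‖ - (2 - 4 * ‖y‖) =
          4 * (‖y‖ - ‖x‖) by ring, abs_mul, abs_of_pos (by norm_num : (0 : ℝ) < 4)]
        exact mul_le_mul_of_nonneg_left h (by norm_num)
    exact (h1.const_min 1).const_max 0
  mem_Icc x := ⟨le_max_left _ _, max_le zero_le_one (min_le_left _ _)⟩
  eq_one x hx := by
    rw [bump, min_eq_left (by linarith), max_eq_right zero_le_one]
  eq_zero x hx := by
    rw [bump, max_eq_left]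
    exact (min_le_right _ _).trans (by linarith)

lemma IsCutoff.edist_le_one {K : NNReal} {ρ : ℝ} {θ : Euc m → ℝ} (h : IsCutoff K ρ θ) (x y : Euc m) :
    edist (θ x) (θ y) ≤ 1 := by
  obtain ⟨hx0, hx1⟩ := h.mem_Icc x
  obtain ⟨hy0, hy1⟩ := h.mem_Icc y
  rw [edist_dist, Real.dist_eq]
  refine ENNReal.ofReal_le_one.2 (abs_le.2 ⟨by linarith, by linarith⟩)

lemma IsCutoff.fderiv_eq_zero {K : NNReal} {ρ : ℝ} {θ : Euc m → ℝ} (h : IsCutoff K ρ θ) {x : Euc m}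
    (hx : ‖x‖ < ρ ∨ 1 / 2 < ‖x‖) : fderiv ℝ θ x = 0 := by
  have : ∃ c : ℝ, θ =ᶠ[𝓝 x] fun _ ↦ c := by
    rcases hx with hx | hx
    · refine ⟨1, ?_⟩
      filter_upwards [(isOpen_lt continuous_norm continuous_const).mem_nhds hx] with y hy
      exact h.eq_one y (le_of_lt hy)
    · refine ⟨0, ?_⟩
      filter_upwards [(isOpen_lt continuous_const continuous_norm).mem_nhds hx] with y hy
      exact h.eq_zero y (le_of_lt hy)
  obtain ⟨c, hc⟩ := this
  rw [hc.fderiv_eq, fderiv_fun_const]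
  rfl

lemma measurable_edist_div {Φ : Euc m → Euc m → ℝ≥0∞} (hΦ : Measurable (Function.uncurry Φ))
    (q : ℝ) : Measurable (Function.uncurry fun x y ↦ Φ x y / edist x y ^ q) :=
  hΦ.div ((measurable_fst.edist measurable_snd).pow_const q)

lemma IsCutoff.measurable_edist {K : NNReal} {ρ : ℝ} {θ : Euc m → ℝ} (h : IsCutoff K ρ θ) (p : ℝ) :
    Measurable (Function.uncurry fun x y ↦ edist (θ x) (θ y) ^ p) :=
  ((h.lipschitz.continuous.measurable.comp measurable_fst).edist
    (h.lipschitz.continuous.measurable.comp measurable_snd)).pow_const p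

lemma lintegral_tail_sub_le {q : ℝ} (hq : (m : ℝ) < q) : ∃ T : ℝ≥0∞, T ≠ ⊤ ∧
    ∀ ρ : ℝ, 0 < ρ → ∀ x : Euc m, ∀ g : Euc m → ℝ≥0∞, (∀ y, g y ≤ 1) →
      (∀ y, ‖y - x‖ ≤ ρ → g y = 0) →
      ∫⁻ y, g y / edist x y ^ q ≤ T * (ENNReal.ofReal ρ ^ (q - m))⁻¹ := by
  obtain ⟨T, hT, hle⟩ := lintegral_tail_le hq
  refine ⟨T, hT, fun ρ hρ x g hg hg0 ↦ le_trans ?_ (hle ρ hρ)⟩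
  have hmeas : MeasurableSet {w : Euc m | ρ < ‖w‖} := measurableSet_lt measurable_const measurable_norm
  rw [← lintegral_indicator hmeas, ← lintegral_sub_right_eq_self
    ({w : Euc m | ρ < ‖w‖}.indicator fun w ↦ (‖w‖ₑ ^ q)⁻¹) x]
  refine lintegral_mono fun y ↦ ?_
  by_cases hy : ρ < ‖y - x‖
  · rw [indicator_of_mem (show y - x ∈ {w : Euc m | ρ < ‖w‖} from hy), edist_comm,
      edist_eq_enorm_sub, div_eq_mul_inv]
    exact mul_le_of_le_one_left' (hg y)
  · rw [hg0 y (not_lt.1 hy), ENNReal.zero_div]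
    exact zero_le

/-- The energy of a cutoff function is finite. -/
lemma IsCutoff.scalarEnergy_ne_top (hm : 1 ≤ m) (hs : 0 < s) (hs1 : s ≤ 1) (hp : 1 ≤ p)
    {K : NNReal} {ρ : ℝ} {θ : Euc m → ℝ} (h : IsCutoff K ρ θ) : scalarEnergy s p θ ≠ ⊤ := by
  have hp0 : 0 < p := by linarith
  unfold scalarEnergy
  split_ifs with h1
  · rw [dirichletEnergy_eq isOpen_univ h.lipschitz.hasWeakDerivOn_fderiv, Measure.restrict_univ]
    refine ne_top_of_le_ne_top (b := ∫⁻ _x in oball m 1, (K : ℝ≥0∞) ^ p) ?_ ?_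
    · rw [lintegral_const, Measure.restrict_apply_univ]
      exact ENNReal.mul_ne_top (ENNReal.rpow_ne_top_of_nonneg hp0.le (by simp)) volume_oball_ne_top
    · rw [← lintegral_indicator measurableSet_oball]
      refine lintegral_mono fun x ↦ ?_
      by_cases hx : x ∈ oball m 1
      · rw [indicator_of_mem hx]
        refine ENNReal.rpow_le_rpow ?_ hp0.le
        rw [← ofReal_norm, ← ENNReal.ofReal_coe_nnreal]
        exact ENNReal.ofReal_le_ofReal (norm_fderiv_le_of_lipschitz ℝ h.lipschitz)
      · rw [indicator_of_notMem hx, h.fderiv_eq_zero (Or.inr ?_)]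
        · rw [nonpos_iff_eq_zero, ENNReal.rpow_eq_zero_iff_of_pos hp0]
          exact enorm_zero (E := Euc m →L[ℝ] ℝ)
        · rw [mem_oball, not_lt] at hx
          linarith
  · have hs1' : s < 1 := lt_of_le_of_ne hs1 h1
    simp only [gagliardoEnergy, Measure.restrict_univ]
    set q := (m : ℝ) + s * p
    have hsp : 0 < s * p := by positivity
    have hqm : (m : ℝ) < q := by simp only [q]; linarith
    obtain ⟨T, hT, hTail⟩ := lintegral_tail_sub_le hqm
    have h2 := lintegral_lintegral_le_two_mul (μ := (volume : Measure (Euc m)))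
      (measurable_edist_div (h.measurable_edist p) q)
      (fun x y ↦ by rw [edist_comm (θ x), edist_comm x]) (S := oball m 1) measurableSet_oball
      (fun x hx y hy ↦ by
        rw [mem_oball, not_lt] at hx hy
        rw [h.eq_zero x (by linarith), h.eq_zero y (by linarith), edist_self,
          ENNReal.zero_rpow_of_pos hp0, ENNReal.zero_div])
    refine ne_top_of_le_ne_top ?_ h2
    set α : ℝ := q - p
    have hα : α < Module.finrank ℝ (Euc m) := by
      simp only [α, q, finrank_euclideanSpace, Fintype.card_fin]
      nlinarith
    have hsing : ∫⁻ z in oball m 2, ‖‖z‖ ^ (-α)‖ₑ < ⊤ :=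
      (integrableOn_ball_of_norm_le_rpow (f := fun z : Euc m ↦ ‖z‖ ^ (-α)) (C := 1) (r := 2)
        (by simpa using hm) hα (Eventually.of_forall fun z ↦ by
          rw [one_mul, Real.norm_of_nonneg (by positivity)])
        (by fun_prop : Measurable fun z : Euc m ↦ ‖z‖ ^ (-α)).aestronglyMeasurable).2
    set I := ∫⁻ z in oball m 2, ‖‖z‖ ^ (-α)‖ₑ
    have hKp : (K : ℝ≥0∞) ^ p ≠ ⊤ := ENNReal.rpow_ne_top_of_nonneg hp0.le (by simp)
    have hbound : ∀ x : Euc m, ∫⁻ y, edist (θ x) (θ y) ^ p / edist x y ^ q ≤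
        K ^ p * I + T * (ENNReal.ofReal 1 ^ (q - m))⁻¹ := by
      intro x
      set g : Euc m → ℝ≥0∞ := fun y ↦ ({y : Euc m | 1 < ‖y - x‖}.indicator 1 y)
      have hgm : Measurable g := measurable_one.indicator
        (measurableSet_lt measurable_const (measurable_id.sub_const x).norm)
      have e2 := hTail 1 one_pos x g (fun y ↦ indicator_le_self' (fun _ _ ↦ zero_le) y)
        (fun y hy ↦ indicator_of_notMem (s := {y : Euc m | 1 < ‖y - x‖}) (not_lt.2 hy) _)
      refine le_trans ?_ (add_le_add le_rfl e2)
      have e1 : (K : ℝ≥0∞) ^ p * I = ∫⁻ y, K ^ p * (oball m 2).indicator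
          (fun z ↦ ‖‖z‖ ^ (-α)‖ₑ) (y - x) := by
        rw [lintegral_sub_right_eq_self (fun y ↦ (K : ℝ≥0∞) ^ p * (oball m 2).indicator
          (fun z ↦ ‖‖z‖ ^ (-α)‖ₑ) y) x, lintegral_const_mul' _ _ hKp,
          lintegral_indicator measurableSet_oball]
      have hgm' : Measurable fun y ↦ g y / edist x y ^ q :=
        hgm.div ((measurable_const.edist measurable_id).pow_const q)
      rw [e1, ← lintegral_add_right _ hgm']
      refine lintegral_mono fun y ↦ ?_
      by_cases hy : 1 < ‖y - x‖
      · refine le_trans ?_ le_add_self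
        rw [show g y = 1 from indicator_of_mem (s := {y : Euc m | 1 < ‖y - x‖}) hy _]
        refine ENNReal.div_le_div_right ?_ _
        exact ENNReal.rpow_le_one (h.edist_le_one x y) hp0.le
      · refine le_trans ?_ le_self_add
        have hy2 : y - x ∈ oball m 2 := by rw [mem_oball]; linarith
        rw [indicator_of_mem hy2]
        rcases eq_or_ne x y with rfl | hxy
        · rw [edist_self, ENNReal.zero_rpow_of_pos hp0, ENNReal.zero_div]
          exact zero_le
        have hpos : 0 < ‖y - x‖ := norm_pos_iff.2 (sub_ne_zero.2 hxy.symm)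
        have hne : edist x y ≠ 0 := by simpa using hxy
        calc edist (θ x) (θ y) ^ p / edist x y ^ q ≤ (K * edist x y) ^ p / edist x y ^ q :=
              ENNReal.div_le_div_right (ENNReal.rpow_le_rpow (h.lipschitz x y) hp0.le) _
          _ = K ^ p * edist x y ^ (-α) := by
              rw [ENNReal.mul_rpow_of_nonneg _ _ hp0.le, mul_div_assoc,
                ← ENNReal.rpow_sub _ _ hne (edist_ne_top _ _)]
              simp only [α, neg_sub]
          _ = K ^ p * ‖‖y - x‖ ^ (-α)‖ₑ := by
              rw [Real.enorm_of_nonneg (by positivity), ← ENNReal.ofReal_rpow_of_pos hpos,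
                ofReal_norm, edist_comm, edist_eq_enorm_sub]
    refine ENNReal.mul_ne_top (by simp) (ne_top_of_le_ne_top ?_
      (lintegral_mono fun x ↦ hbound x))
    rw [lintegral_const, Measure.restrict_apply_univ]
    refine ENNReal.mul_ne_top (ENNReal.add_ne_top.2 ⟨ENNReal.mul_ne_top hKp hsing.ne,
      ENNReal.mul_ne_top hT ?_⟩) volume_oball_ne_top
    simp

/-- The energy between points of which one is far away is small. -/
lemma IsCutoff.exists_lintegral_far_le (hs : 0 < s) (hp : 1 ≤ p) {K : NNReal} {ρ : ℝ}
    {θ : Euc m → ℝ} (h : IsCutoff K ρ θ) {ε : ℝ≥0∞} (hε : 0 < ε) : ∃ R : ℝ, 1 ≤ R ∧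
      ∫⁻ x, ∫⁻ y, (if R < max ‖x‖ ‖y‖ then edist (θ x) (θ y) ^ p else 0) /
        edist x y ^ ((m : ℝ) + s * p) ≤ ε := by
  have hp0 : 0 < p := by linarith
  have hsp : 0 < s * p := by positivity
  set q := (m : ℝ) + s * p
  have hqm : (m : ℝ) < q := by simp only [q]; linarith
  obtain ⟨T, hT, hTail⟩ := lintegral_tail_sub_le hqm
  set V := volume (oball m 1)
  have hV : V ≠ ⊤ := volume_oball_ne_top
  have ht : Tendsto (fun R : ℝ ↦ 2 * (T * (ENNReal.ofReal (R - 1) ^ (q - m))⁻¹ * V)) atTop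
      (𝓝 (2 * (T * (⊤)⁻¹ * V))) := by
    have t1 : Tendsto (fun R : ℝ ↦ ENNReal.ofReal (R - 1)) atTop (𝓝 ⊤) :=
      ENNReal.tendsto_ofReal_atTop.comp (tendsto_atTop_add_const_right _ (-1) tendsto_id)
    have t2 := (ENNReal.continuous_rpow_const (y := q - m)).tendsto ⊤
    rw [ENNReal.top_rpow_of_pos (by linarith)] at t2
    have t3 := (tendsto_inv_iff.2 (t2.comp t1))
    refine ENNReal.Tendsto.const_mul (ENNReal.Tendsto.mul_const
      (ENNReal.Tendsto.const_mul t3 (Or.inr hT)) (Or.inr hV)) (Or.inr (by simp))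
  simp only [ENNReal.inv_top, mul_zero, zero_mul] at ht
  obtain ⟨R, hR2, hRε⟩ := ((eventually_ge_atTop 2).and
    ((ENNReal.tendsto_nhds_zero.1 ht) ε hε)).exists
  refine ⟨R, by linarith, le_trans ?_ hRε⟩
  have hmeas : Measurable (Function.uncurry fun x y : Euc m ↦
      if R < max ‖x‖ ‖y‖ then edist (θ x) (θ y) ^ p else 0) :=
    Measurable.ite (measurableSet_lt measurable_const
      (measurable_fst.norm.max measurable_snd.norm)) (h.measurable_edist p) measurable_const
  refine (lintegral_lintegral_le_two_mul (μ := (volume : Measure (Euc m)))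
      (measurable_edist_div hmeas q)
      (fun x y ↦ by rw [edist_comm (θ x), edist_comm x, max_comm]) (S := oball m 1)
      measurableSet_oball (fun x hx y hy ↦ by
        rw [mem_oball, not_lt] at hx hy
        rw [h.eq_zero x (by linarith), h.eq_zero y (by linarith), edist_self,
          ENNReal.zero_rpow_of_pos hp0, ite_self, ENNReal.zero_div])).trans ?_
  refine mul_le_mul' le_rfl ?_
  rw [show V = volume.restrict (oball m 1) univ from (Measure.restrict_apply_univ _).symm,
    ← lintegral_const]
  refine setLIntegral_mono' measurableSet_oball fun x hx ↦ ?_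
  have hx1 := mem_oball.1 hx
  refine hTail (R - 1) (by linarith) x _ (fun y ↦ ?_) fun y hy ↦ if_neg ?_
  · split_ifs
    · exact ENNReal.rpow_le_one (h.edist_le_one x y) hp0.le
    · exact zero_le
  · rw [not_lt]
    refine max_le (by linarith) ?_
    have := norm_add_le (y - x) x
    rw [sub_add_cancel] at this
    linarith

end

/-! ### Vanishing capacity of points in the critical case -/

section

variable {m : ℕ} {s p : ℝ}

/-- If at most one of the terms satisfying `P` is nonzero, there is no loss due to the number of these
terms in comparing the power of the sum with the sum of the powers. -/
lemma rpow_sum_le_of_unique {κ : Type*} (t : Finset κ) (a : κ → ℝ≥0∞) (P : κ → Prop)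
    [DecidablePred P] (hp : 1 ≤ p)
    (h : ∀ i ∈ t, ∀ j ∈ t, P i → P j → a i ≠ 0 → a j ≠ 0 → i = j) :
    (∑ i ∈ t, a i) ^ p ≤
      2 ^ p * (∑ i ∈ t, a i ^ p + (t.card : ℝ≥0∞) ^ p * ∑ i ∈ t, if P i then 0 else a i ^ p) := by
  have hp0 : 0 < p := by linarith
  rw [← Finset.sum_filter_add_sum_filter_not t P a]
  refine (ENNReal.rpow_add_le_mul_rpow_add_rpow _ _ hp).trans (mul_le_mul'
    (ENNReal.rpow_le_rpow_of_exponent_le (by norm_num) (by linarith)) (add_le_add ?_ ?_))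
  · by_cases h0 : ∀ i ∈ t.filter P, a i = 0
    · rw [Finset.sum_eq_zero h0, ENNReal.zero_rpow_of_pos hp0]
      exact zero_le
    · push Not at h0
      obtain ⟨i, hi, hai⟩ := h0
      obtain ⟨hit, hiP⟩ := Finset.mem_filter.1 hi
      rw [Finset.sum_eq_single_of_mem i hi fun j hj hji ↦ by
        by_contra haj
        obtain ⟨hjt, hjP⟩ := Finset.mem_filter.1 hj
        exact hji (h j hjt i hit hjP hiP haj hai)]
      exact Finset.single_le_sum (f := fun i ↦ a i ^ p) (fun _ _ ↦ zero_le) hit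
  · rcases Finset.eq_empty_or_nonempty (t.filter fun i ↦ ¬ P i) with hc | hc
    · rw [hc, Finset.sum_empty, ENNReal.zero_rpow_of_pos hp0]
      exact zero_le
    refine (ENNReal.rpow_sum_le_const_mul_sum_rpow _ _ hp).trans (mul_le_mul' ?_ ?_)
    · refine (ENNReal.rpow_le_rpow_of_exponent_le (by exact_mod_cast hc.card_pos)
        (by linarith : p - 1 ≤ p)).trans (ENNReal.rpow_le_rpow ?_ hp0.le)
      exact_mod_cast Finset.card_filter_le _ _
    · rw [Finset.sum_filter]
      exact Finset.sum_le_sum fun i _ ↦ by by_cases hP : P i <;> simp [hP]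

lemma enorm_inv_smul_sum_le {E : Type*} [NormedAddCommGroup E] [NormedSpace ℝ E] {k : ℕ}
    (hk : 1 ≤ k) (v : ℕ → E) : ‖(k : ℝ)⁻¹ • ∑ i ∈ Finset.range k, v i‖ₑ ≤
      (k : ℝ≥0∞)⁻¹ * ∑ i ∈ Finset.range k, ‖v i‖ₑ := by
  rw [enorm_smul, Real.enorm_of_nonneg (by positivity),
    ENNReal.ofReal_inv_of_pos (by exact_mod_cast hk), ENNReal.ofReal_natCast]
  exact mul_le_mul' le_rfl (enorm_sum_le _ _)

/-- The average of `k` dilations of a function, by powers of `l`. -/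
noncomputable def averageDilation (θ : Euc m → ℝ) (l : ℝ) (k : ℕ) (x : Euc m) : ℝ :=
  (k : ℝ)⁻¹ * ∑ i ∈ Finset.range k, θ (l ^ i • x)

lemma IsCutoff.dilation {K : NNReal} {ρ : ℝ} {θ : Euc m → ℝ} (h : IsCutoff K ρ θ) {r : ℝ}
    (hr : 1 ≤ r) : IsCutoff (K * r.toNNReal) (ρ / r) fun x ↦ θ (r • x) where
  lipschitz := by
    refine h.lipschitz.comp ?_
    have := lipschitzWith_smul (β := Euc m) r
    rwa [show ‖r‖₊ = r.toNNReal by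
      ext; rw [coe_nnnorm, Real.norm_of_nonneg (by linarith), Real.coe_toNNReal _ (by linarith)]]
      at this
  mem_Icc x := h.mem_Icc _
  eq_one x hx := h.eq_one _ (by
    rw [norm_smul, Real.norm_of_nonneg (by linarith)]
    rwa [le_div_iff₀' (by linarith)] at hx)
  eq_zero x hx := h.eq_zero _ (by
    rw [norm_smul, Real.norm_of_nonneg (by linarith)]
    nlinarith)

lemma exists_isCutoff_averageDilation {K : NNReal} {ρ : ℝ} (hρ : 0 < ρ) {θ : Euc m → ℝ}
    (h : IsCutoff K ρ θ) {l : ℝ} (hl : 1 ≤ l) {k : ℕ} (hk : 1 ≤ k) :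
    ∃ K' ρ', 0 < ρ' ∧ IsCutoff K' ρ' (averageDilation θ l k) := by
  have hk0 : (0 : ℝ) < k := by exact_mod_cast hk
  have hd : ∀ i, IsCutoff _ _ fun x ↦ θ (l ^ i • x) := fun i ↦ h.dilation (one_le_pow₀ hl)
  have hL : ∀ n : ℕ, ∃ K', LipschitzWith K' fun x ↦ ∑ i ∈ Finset.range n, θ (l ^ i • x) := by
    intro n
    induction n with
    | zero => exact ⟨0, by simp⟩
    | succ n ih =>
      obtain ⟨K', hK'⟩ := ih
      simp only [Finset.sum_range_succ]
      exact ⟨_, hK'.add (hd n).lipschitz⟩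
  obtain ⟨K', hK'⟩ := hL k
  refine ⟨_, ρ / l ^ k, by positivity, ⟨(lipschitzWith_smul ((k : ℝ)⁻¹)).comp hK', fun x ↦ ⟨?_, ?_⟩,
    fun x hx ↦ ?_, fun x hx ↦ ?_⟩⟩
  · exact mul_nonneg (by positivity) (Finset.sum_nonneg fun i _ ↦ (h.mem_Icc _).1)
  · rw [averageDilation, inv_mul_le_iff₀ hk0, mul_one]
    calc ∑ i ∈ Finset.range k, θ (l ^ i • x) ≤ ∑ _i ∈ Finset.range k, (1 : ℝ) :=
          Finset.sum_le_sum fun i _ ↦ (h.mem_Icc _).2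
      _ = k := by simp
  · rw [averageDilation, Finset.sum_congr rfl fun i hi ↦ (hd i).eq_one x (hx.trans ?_)]
    · simp [hk0.ne']
    · exact div_le_div_of_nonneg_left hρ.le (by positivity)
        (pow_le_pow_right₀ hl (Finset.mem_range.1 hi).le)
  · rw [averageDilation, Finset.sum_congr rfl fun i _ ↦ (hd i).eq_zero x hx]
    simp

/-- If the increments of a function at sparse scales are integrated, then essentially
only one scale is seen at a time. -/
lemma gagliardoEnergy_averageDilation_le (hm : 1 ≤ m) (hs : 0 < s) (hp : 1 ≤ p) (hsp : s * p = m)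
    {K : NNReal} {ρ : ℝ} (hρ : 0 < ρ) {θ : Euc m → ℝ} (h : IsCutoff K ρ θ) {k : ℕ} (hk : 1 ≤ k)
    {ε : ℝ≥0∞} (hε : 0 < ε) : ∃ l : ℝ, 1 ≤ l ∧
      gagliardoEnergy s p (averageDilation θ l k) univ ≤
        ((k : ℝ≥0∞) ^ p)⁻¹ * (2 ^ p * (k * gagliardoEnergy s p θ univ + k ^ p * (k * ε))) := by
  have hp0 : 0 < p := by linarith
  obtain ⟨R, hR1, hR⟩ := h.exists_lintegral_far_le hs hp hε
  have hk0 : (k : ℝ≥0∞) ≠ 0 := by exact_mod_cast (by omega : k ≠ 0)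
  refine ⟨R / ρ + 1, by linarith [show 0 ≤ R / ρ by positivity], ?_⟩
  set l : ℝ := R / ρ + 1
  have hl1 : 1 ≤ l := by linarith [show 0 ≤ R / ρ by positivity]
  have hlR : R < l * ρ := by
    simp only [l, add_mul, div_mul_cancel₀ _ hρ.ne']
    linarith
  set q := (m : ℝ) + s * p
  have hq : 0 ≤ q := by positivity
  have hqm : (m : ℝ) + m - q = 0 := by simp only [q, hsp]; ring
  set a : ℕ → Euc m → Euc m → ℝ≥0∞ := fun i x y ↦ edist (θ (l ^ i • x)) (θ (l ^ i • y))
  set far : ℕ → Euc m → Euc m → Prop := fun i x y ↦ R < max ‖l ^ i • x‖ ‖l ^ i • y‖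
  have hcont := h.lipschitz.continuous
  have hpt : ∀ x y, edist (averageDilation θ l k x) (averageDilation θ l k y) ^ p ≤
      ((k : ℝ≥0∞) ^ p)⁻¹ * (2 ^ p * (∑ i ∈ Finset.range k, a i x y ^ p +
        k ^ p * ∑ i ∈ Finset.range k, if far i x y then a i x y ^ p else 0)) := by
    intro x y
    have e1 : edist (averageDilation θ l k x) (averageDilation θ l k y) ≤
        (k : ℝ≥0∞)⁻¹ * ∑ i ∈ Finset.range k, a i x y := by
      rw [averageDilation, averageDilation, edist_eq_enorm_sub, ← mul_sub,
        ← Finset.sum_sub_distrib]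
      simp only [a, edist_eq_enorm_sub]
      exact enorm_inv_smul_sum_le hk _
    refine (ENNReal.rpow_le_rpow e1 hp0.le).trans ?_
    rw [ENNReal.mul_rpow_of_nonneg _ _ hp0.le, ENNReal.inv_rpow]
    refine mul_le_mul' le_rfl ?_
    classical
    have := rpow_sum_le_of_unique (Finset.range k) (fun i ↦ a i x y) (fun i ↦ ¬ far i x y) hp ?_
    · rw [Finset.card_range] at this
      simpa only [ite_not] using this
    -- a scale which sees the two points satisfies `ρ < l ^ i * max ‖x‖ ‖y‖ ≤ R < l * ρ`
    have hwin : ∀ i, ¬ far i x y → a i x y ≠ 0 →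
        ρ < l ^ i * max ‖x‖ ‖y‖ ∧ l ^ i * max ‖x‖ ‖y‖ < l * ρ := by
      intro i hi hai
      have hli : 0 ≤ l ^ i := by positivity
      have hmax : max ‖l ^ i • x‖ ‖l ^ i • y‖ = l ^ i * max ‖x‖ ‖y‖ := by
        rw [norm_smul, norm_smul, Real.norm_of_nonneg hli, mul_max_of_nonneg _ _ hli]
      refine ⟨?_, ?_⟩
      · by_contra! hle
        rw [← hmax] at hle
        refine hai ?_
        simp only [a]
        rw [h.eq_one _ ((le_max_left _ _).trans hle), h.eq_one _ ((le_max_right _ _).trans hle),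
          edist_self]
      · rw [← hmax]
        exact (not_lt.1 hi).trans_lt hlR
    have hlt : ∀ i j, i < j → ¬ far i x y → ¬ far j x y → a i x y ≠ 0 → a j x y ≠ 0 → False := by
      intro i j hij hi hj hai haj
      have h1 := (hwin i hi hai).1
      have h2 := (hwin j hj haj).2
      have h3 : l ^ (i + 1) ≤ l ^ j := pow_le_pow_right₀ hl1 hij
      have h4 : 0 ≤ max ‖x‖ ‖y‖ := le_max_of_le_left (norm_nonneg x)
      have h5 : l ^ (i + 1) * max ‖x‖ ‖y‖ ≤ l ^ j * max ‖x‖ ‖y‖ :=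
        mul_le_mul_of_nonneg_right h3 h4
      rw [pow_succ] at h5
      nlinarith
    intro i _ j _ hi hj hai haj
    rcases lt_trichotomy i j with hij | hij | hij
    · exact (hlt i j hij hi hj hai haj).elim
    · exact hij
    · exact (hlt j i hij hj hi haj hai).elim
  have hkp : ((k : ℝ≥0∞) ^ p)⁻¹ ≠ ⊤ := by
    simp [ENNReal.rpow_eq_zero_iff, hk0]
  have h2p : (2 : ℝ≥0∞) ^ p ≠ ⊤ := ENNReal.rpow_ne_top_of_nonneg hp0.le (by simp)
  have hkp' : (k : ℝ≥0∞) ^ p ≠ ⊤ := ENNReal.rpow_ne_top_of_nonneg hp0.le (by simp)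
  have hJ : ∀ Φ : Euc m → Euc m → ℝ≥0∞, ∀ i : ℕ,
      ∫⁻ x, ∫⁻ y, Φ (l ^ i • x) (l ^ i • y) / edist x y ^ q =
        ∫⁻ x, ∫⁻ y, Φ x y / edist x y ^ q := by
    intro Φ i
    have := lintegral_lintegral_add_smul Φ 0 (r := l ^ i) (by positivity) hq
    rw [hqm, ENNReal.rpow_zero, one_mul] at this
    simpa only [zero_add] using this.symm
  have hma : ∀ i, Measurable (Function.uncurry fun x y ↦ a i x y ^ p) := fun i ↦
    (Measurable.edist (by fun_prop) (by fun_prop)).pow_const p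
  have hmb : ∀ i, Measurable (Function.uncurry fun x y ↦ by
      classical exact if far i x y then a i x y ^ p else 0) := fun i ↦
    Measurable.ite (measurableSet_lt measurable_const (by fun_prop)) (hma i) measurable_const
  classical
  simp only [gagliardoEnergy, Measure.restrict_univ]
  set A : ℕ → Euc m → Euc m → ℝ≥0∞ := fun i x y ↦ a i x y ^ p / edist x y ^ q
  set B : ℕ → Euc m → Euc m → ℝ≥0∞ :=
    fun i x y ↦ (if far i x y then a i x y ^ p else 0) / edist x y ^ q
  have hmA : ∀ i, Measurable (Function.uncurry (A i)) := fun i ↦ measurable_edist_div (hma i) q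
  have hmB : ∀ i, Measurable (Function.uncurry (B i)) := fun i ↦ measurable_edist_div (hmb i) q
  have eA : ∀ i, ∫⁻ x, ∫⁻ y, A i x y = ∫⁻ x, ∫⁻ y, edist (θ x) (θ y) ^ p / edist x y ^ q :=
    fun i ↦ hJ (fun x y ↦ edist (θ x) (θ y) ^ p) i
  have eB : ∀ i, ∫⁻ x, ∫⁻ y, B i x y ≤ ε := fun i ↦
    (hJ (fun x y ↦ if R < max ‖x‖ ‖y‖ then edist (θ x) (θ y) ^ p else 0) i).trans_le hR
  calc ∫⁻ x, ∫⁻ y, edist (averageDilation θ l k x) (averageDilation θ l k y) ^ p / edist x y ^ q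
      ≤ ∫⁻ x, ∫⁻ y, ((k : ℝ≥0∞) ^ p)⁻¹ * (2 ^ p * (∑ i ∈ Finset.range k, A i x y +
        k ^ p * ∑ i ∈ Finset.range k, B i x y)) := by
        refine lintegral_mono fun x ↦ lintegral_mono fun y ↦ ?_
        refine (ENNReal.div_le_div_right (hpt x y) _).trans (le_of_eq ?_)
        simp only [A, B, div_eq_mul_inv, ← Finset.sum_mul]
        ring
    _ = ((k : ℝ≥0∞) ^ p)⁻¹ * (2 ^ p * (∑ i ∈ Finset.range k, (∫⁻ x, ∫⁻ y, A i x y) +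
        k ^ p * ∑ i ∈ Finset.range k, ∫⁻ x, ∫⁻ y, B i x y)) := by
        have i1 : ∀ x, ∫⁻ y, ((k : ℝ≥0∞) ^ p)⁻¹ * (2 ^ p * (∑ i ∈ Finset.range k, A i x y +
            k ^ p * ∑ i ∈ Finset.range k, B i x y)) =
            ((k : ℝ≥0∞) ^ p)⁻¹ * (2 ^ p * (∑ i ∈ Finset.range k, (∫⁻ y, A i x y) +
            k ^ p * ∑ i ∈ Finset.range k, ∫⁻ y, B i x y)) := by
          intro x
          have m1 : ∀ i, Measurable (A i x) := fun i ↦ (hmA i).of_uncurry_left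
          have m2 : ∀ i, Measurable (B i x) := fun i ↦ (hmB i).of_uncurry_left
          rw [lintegral_const_mul' _ _ hkp, lintegral_const_mul' _ _ h2p,
            lintegral_add_left (Finset.measurable_sum _ fun i _ ↦ m1 i),
            lintegral_const_mul' _ _ hkp', lintegral_finsetSum _ fun i _ ↦ m1 i,
            lintegral_finsetSum _ fun i _ ↦ m2 i]
        have m1 : ∀ i, Measurable fun x ↦ ∫⁻ y, A i x y := fun i ↦ (hmA i).lintegral_prod_right
        have m2 : ∀ i, Measurable fun x ↦ ∫⁻ y, B i x y := fun i ↦ (hmB i).lintegral_prod_right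
        simp only [i1]
        rw [lintegral_const_mul' _ _ hkp, lintegral_const_mul' _ _ h2p,
          lintegral_add_left (Finset.measurable_sum _ fun i _ ↦ m1 i),
          lintegral_const_mul' _ _ hkp', lintegral_finsetSum _ fun i _ ↦ m1 i,
          lintegral_finsetSum _ fun i _ ↦ m2 i]
    _ ≤ _ := by
        refine mul_le_mul' le_rfl (mul_le_mul' le_rfl (add_le_add ?_ (mul_le_mul' le_rfl ?_)))
        · rw [Finset.sum_congr rfl fun i _ ↦ eA i, Finset.sum_const, Finset.card_range, nsmul_eq_mul]
        · refine (Finset.sum_le_sum fun i _ ↦ eB i).trans ?_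
          simp

/-- For a dilation factor `l` large enough, the dilations have derivatives with disjoint supports,
and in the critical case they all have the same energy. -/
lemma dirichletEnergy_averageDilation_le (hp : 1 ≤ p) (hpm : p = m)
    {K : NNReal} {ρ : ℝ} (hρ : 0 < ρ) {θ : Euc m → ℝ} (h : IsCutoff K ρ θ) {k : ℕ} (hk : 1 ≤ k) :
    ∃ l : ℝ, 1 ≤ l ∧ dirichletEnergy p (averageDilation θ l k) univ ≤
        ((k : ℝ≥0∞) ^ p)⁻¹ * (2 ^ p * (k * dirichletEnergy p θ univ)) := by
  have hp0 : 0 < p := by linarith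
  have hk0 : (k : ℝ≥0∞) ≠ 0 := by exact_mod_cast (by omega : k ≠ 0)
  have hl0 : 0 ≤ 1 / ρ := by positivity
  refine ⟨1 / ρ + 1, by linarith, ?_⟩
  set l : ℝ := 1 / ρ + 1
  have hl1 : 1 ≤ l := by linarith
  have hlR : 1 / 2 < l * ρ := by
    simp only [l, add_mul, div_mul_cancel₀ _ hρ.ne']
    linarith
  have hd : ∀ i, IsCutoff _ _ fun x ↦ θ (l ^ i • x) := fun i ↦ h.dilation (one_le_pow₀ hl1)
  obtain ⟨K', ρ', -, h'⟩ := exists_isCutoff_averageDilation hρ h hl1 hk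
  have hkp : ((k : ℝ≥0∞) ^ p)⁻¹ ≠ ⊤ := by
    simp [ENNReal.rpow_eq_zero_iff, hk0]
  have h2p : (2 : ℝ≥0∞) ^ p ≠ ⊤ := ENNReal.rpow_ne_top_of_nonneg hp0.le (by simp)
  set D : ℕ → Euc m → ℝ≥0∞ := fun i x ↦ ‖fderiv ℝ (fun x ↦ θ (l ^ i • x)) x‖ₑ
  have hDm : ∀ i, Measurable fun x ↦ D i x ^ p := fun i ↦ by
    borelize (Euc m →L[ℝ] ℝ)
    exact ((measurable_fderiv ℝ _).stronglyMeasurable.enorm).pow_const p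
  have hDe : ∀ i, ∫⁻ x, D i x ^ p ≤ dirichletEnergy p θ univ := by
    intro i
    have h1 := dirichletEnergy_rescale_le hp0.le θ 0 (r := (l ^ i)⁻¹) (by positivity)
    have e : rescale θ 0 (l ^ i)⁻¹ = fun x ↦ θ (l ^ i • x) := by
      funext x
      rw [rescale, inv_inv, sub_zero]
    rw [e, dirichletEnergy_eq isOpen_univ (hd i).lipschitz.hasWeakDerivOn_fderiv,
      Measure.restrict_univ, hpm, sub_self, Real.rpow_zero, ENNReal.ofReal_one, one_mul] at h1
    rwa [hpm]
  rw [dirichletEnergy_eq isOpen_univ h'.lipschitz.hasWeakDerivOn_fderiv, Measure.restrict_univ]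
  calc ∫⁻ x, ‖fderiv ℝ (averageDilation θ l k) x‖ₑ ^ p
      ≤ ∫⁻ x, ((k : ℝ≥0∞) ^ p)⁻¹ * (2 ^ p * ∑ i ∈ Finset.range k, D i x ^ p) := by
        refine lintegral_mono_ae ?_
        filter_upwards [ae_all_iff.2 fun i ↦ (hd i).lipschitz.ae_differentiableAt (μ := volume)]
          with x hx
        have e1 : ‖fderiv ℝ (averageDilation θ l k) x‖ₑ ≤
            (k : ℝ≥0∞)⁻¹ * ∑ i ∈ Finset.range k, D i x := by
          have e2 : fderiv ℝ (averageDilation θ l k) x =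
              (k : ℝ)⁻¹ • ∑ i ∈ Finset.range k, fderiv ℝ (fun x ↦ θ (l ^ i • x)) x := by
            exact ((HasFDerivAt.fun_sum fun i _ ↦ (hx i).hasFDerivAt).const_mul _).fderiv
          rw [e2]
          exact enorm_inv_smul_sum_le hk _
        refine (ENNReal.rpow_le_rpow e1 hp0.le).trans ?_
        rw [ENNReal.mul_rpow_of_nonneg _ _ hp0.le, ENNReal.inv_rpow]
        refine mul_le_mul' le_rfl ?_
        have := rpow_sum_le_of_unique (Finset.range k) (fun i ↦ D i x) (fun _ ↦ True) hp ?_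
        · simpa using this
        -- a dilation which varies near `x` satisfies `ρ ≤ l ^ i * ‖x‖ ≤ 1 / 2 < l * ρ`
        have hwin : ∀ i, D i x ≠ 0 → ρ ≤ l ^ i * ‖x‖ ∧ l ^ i * ‖x‖ < l * ρ := by
          intro i hi
          have hn : ‖l ^ i • x‖ = l ^ i * ‖x‖ := by
            rw [norm_smul, Real.norm_of_nonneg (by positivity)]
          by_contra hcon
          refine hi ?_
          have hz : fderiv ℝ θ (l ^ i • x) = 0 := h.fderiv_eq_zero (by
            rw [hn]
            by_contra! hc
            exact hcon ⟨hc.1, hc.2.trans_lt hlR⟩)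
          simp only [D]
          rw [fderiv_comp_smul, hz, smul_zero]
          exact enorm_zero (E := Euc m →L[ℝ] ℝ)
        have hlt : ∀ i j, i < j → D i x ≠ 0 → D j x ≠ 0 → False := by
          intro i j hij hai haj
          have h1 := (hwin i hai).1
          have h2 := (hwin j haj).2
          have h3 : l ^ (i + 1) ≤ l ^ j := pow_le_pow_right₀ hl1 hij
          have h5 : l ^ (i + 1) * ‖x‖ ≤ l ^ j * ‖x‖ :=
            mul_le_mul_of_nonneg_right h3 (norm_nonneg x)
          rw [pow_succ] at h5
          nlinarith
        intro i _ j _ _ _ hai haj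
        rcases lt_trichotomy i j with hij | hij | hij
        · exact (hlt i j hij hai haj).elim
        · exact hij
        · exact (hlt j i hij haj hai).elim
    _ = ((k : ℝ≥0∞) ^ p)⁻¹ * (2 ^ p * ∑ i ∈ Finset.range k, ∫⁻ x, D i x ^ p) := by
        rw [lintegral_const_mul' _ _ hkp, lintegral_const_mul' _ _ h2p,
          lintegral_finsetSum _ fun i _ ↦ hDm i]
    _ ≤ _ := by
        refine mul_le_mul' le_rfl (mul_le_mul' le_rfl ?_)
        refine (Finset.sum_le_sum fun i _ ↦ hDe i).trans ?_
        simp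

/-- In the critical case the capacity of a point vanishes: there are cutoff functions of
arbitrarily small energy. -/
lemma exists_isCutoff_scalarEnergy_le (hm : 1 ≤ m) (hs : 0 < s) (hs1 : s ≤ 1) (hp : 1 ≤ p)
    (hsp : s * p = m) (hsm : s < m) {ε : ℝ≥0∞} (hε : 0 < ε) :
    ∃ (K : NNReal) (ρ : ℝ) (θ : Euc m → ℝ), 0 < ρ ∧ IsCutoff K ρ θ ∧ scalarEnergy s p θ ≤ ε := by
  have hp0 : 0 < p := by linarith
  have hp1 : 1 < p := by
    by_contra! hle
    have : s * p ≤ s * 1 := mul_le_mul_of_nonneg_left hle hs.le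
    linarith
  have hb := isCutoff_bump (m := m)
  set c := scalarEnergy s p (bump : Euc m → ℝ)
  have hc : c ≠ ⊤ := hb.scalarEnergy_ne_top hm hs hs1 hp
  have h2p : (2 : ℝ≥0∞) ^ p ≠ ⊤ := ENNReal.rpow_ne_top_of_nonneg hp0.le (by simp)
  have h2p0 : (2 : ℝ≥0∞) ^ p ≠ 0 := by simp [ENNReal.rpow_eq_zero_iff]
  have hε2 : 0 < ε / 2 := ENNReal.half_pos hε.ne'
  have ht : Tendsto (fun k : ℕ ↦ 2 ^ p * (((k : ℝ≥0∞) ^ (p - 1))⁻¹ * c)) atTop (𝓝 0) := by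
    have t2 := (ENNReal.continuous_rpow_const (y := p - 1)).tendsto ⊤
    rw [ENNReal.top_rpow_of_pos (by linarith)] at t2
    have t3 := tendsto_inv_iff.2 (t2.comp ENNReal.tendsto_nat_nhds_top)
    have t4 := ENNReal.Tendsto.const_mul (ENNReal.Tendsto.mul_const t3 (Or.inr hc)) (Or.inr h2p)
    simpa using t4
  obtain ⟨k, hk1, hk⟩ := ((eventually_ge_atTop 1).and
    ((ENNReal.tendsto_nhds_zero.1 ht) _ hε2)).exists
  have hk0 : (k : ℝ≥0∞) ≠ 0 := by exact_mod_cast (by omega : k ≠ 0)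
  have hkt : (k : ℝ≥0∞) ≠ ⊤ := by simp
  have hkp0 : (k : ℝ≥0∞) ^ p ≠ 0 := by simp [ENNReal.rpow_eq_zero_iff, hk0]
  have hkpt : (k : ℝ≥0∞) ^ p ≠ ⊤ := ENNReal.rpow_ne_top_of_nonneg hp0.le hkt
  set δ : ℝ≥0∞ := ε / 2 / (2 ^ p * k)
  have hδ : 0 < δ := ENNReal.div_pos hε2.ne' (ENNReal.mul_ne_top h2p hkt)
  have key : ∃ l : ℝ, 1 ≤ l ∧ scalarEnergy s p (averageDilation (bump : Euc m → ℝ) l k) ≤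
      ((k : ℝ≥0∞) ^ p)⁻¹ * (2 ^ p * (k * c + k ^ p * (k * δ))) := by
    simp only [c, scalarEnergy]
    split_ifs with h1
    · rw [h1, one_mul] at hsp
      obtain ⟨l, hl, hle⟩ := dirichletEnergy_averageDilation_le hp hsp (by norm_num) hb hk1
      exact ⟨l, hl, hle.trans (mul_le_mul' le_rfl (mul_le_mul' le_rfl le_self_add))⟩
    · exact gagliardoEnergy_averageDilation_le hm hs hp hsp (by norm_num) hb hk1 hδ
  obtain ⟨l, hl, hle⟩ := key
  obtain ⟨K, ρ, hρ, hcut⟩ := exists_isCutoff_averageDilation (by norm_num) hb hl hk1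
  refine ⟨K, ρ, _, hρ, hcut, hle.trans ?_⟩
  have e1 : ((k : ℝ≥0∞) ^ p)⁻¹ * (2 ^ p * (k * c + k ^ p * (k * δ))) =
      2 ^ p * ((((k : ℝ≥0∞) ^ p)⁻¹ * k) * c) +
        (((k : ℝ≥0∞) ^ p)⁻¹ * k ^ p) * (2 ^ p * k * δ) := by ring
  have e2 : ((k : ℝ≥0∞) ^ p)⁻¹ * k = ((k : ℝ≥0∞) ^ (p - 1))⁻¹ := by
    rw [← ENNReal.rpow_neg, ← ENNReal.rpow_neg]
    nth_rewrite 2 [← ENNReal.rpow_one (k : ℝ≥0∞)]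
    rw [← ENNReal.rpow_add _ _ hk0 hkt]
    congr 1
    ring
  rw [e1, e2, ENNReal.inv_mul_cancel hkp0 hkpt, one_mul,
    ENNReal.mul_div_cancel (mul_ne_zero h2p0 hk0) (ENNReal.mul_ne_top h2p hkt)]
  exact (add_le_add hk le_rfl).trans (ENNReal.add_halves ε).le

end

/-! ### Assembling copies of maps -/

section

variable {m ν : ℕ} {N : Type*} [MetricSpace N] [MeasurableSpace N] {ι : N → Euc ν} {s p : ℝ}
  {G : MapEnergy m N}

omit [MetricSpace N] in
lemma MapEnergy.on_congr (G : MapEnergy m N) {u w : Euc m → N} {A : Set (Euc m)} (h : EqOn u w A) :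
    G.on u A = G.on w A := by
  unfold MapEnergy.on
  congr 1
  funext x
  exact h x.2

omit [MetricSpace N] in
lemma MapEnergy.on_mono (G : MapEnergy m N) {u : Euc m → N} (hu : MeasOn u univ)
    {A B : Set (Euc m)} (hAB : A ⊆ B) (hA : IsOpen A) (hB : IsOpen B) : G.on u A ≤ G.on u B := by
  refine G.mono A B hAB hA hB (fun x : B ↦ u x) ?_
  have h1 : AEMeasurable u (Measure.map (Subtype.val : B → Euc m) (volume.comap Subtype.val)) := by
    rw [map_comap_subtype_coe hB.measurableSet]
    exact (measOn_univ.1 hu).restrict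
  exact h1.comp_measurable measurable_subtype_coe

omit [MetricSpace N] in
lemma MapEnergy.Superadditive.sum_le (hG : G.Superadditive) {u : Euc m → N} (hu : MeasOn u univ)
    {κ : Type*} {S : κ → Set (Euc m)} (hS : ∀ i, IsOpen (S i))
    (hd : Pairwise (Function.onFun Disjoint fun i ↦ closure (S i))) (t : Finset κ) :
    ∑ i ∈ t, G.on u (S i) ≤ G.on u (⋃ i ∈ t, S i) := by
  classical
  induction t using Finset.induction_on with
  | empty => simp
  | insert i t hi ih =>
    rw [Finset.sum_insert hi, Finset.set_biUnion_insert]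
    refine (add_le_add le_rfl ih).trans (hG u hu _ _ (hS i) (isOpen_biUnion fun j _ ↦ hS j) ?_)
    rw [t.closure_biUnion]
    refine disjoint_iUnion₂_right.2 fun j hj ↦ hd ?_
    rintro rfl
    exact hi hj

omit [MetricSpace N] in
lemma MapEnergy.Superadditive.tsum_le (hG : G.Superadditive) {u : Euc m → N} (hu : MeasOn u univ)
    {κ : Type*} {S : κ → Set (Euc m)} {B : Set (Euc m)} (hB : IsOpen B) (hS : ∀ i, IsOpen (S i))
    (hd : Pairwise (Function.onFun Disjoint fun i ↦ closure (S i))) (hSB : ∀ i, S i ⊆ B) :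
    ∑' i, G.on u (S i) ≤ G.on u B := by
  rw [ENNReal.tsum_eq_iSup_sum]
  exact iSup_le fun t ↦ (hG.sum_le hu hS hd t).trans
    (G.on_mono hu (iUnion₂_subset fun i _ ↦ hSB i) (isOpen_biUnion fun i _ ↦ hS i) hB)

omit [MetricSpace N] in
lemma MapEnergy.Scaling.on_rescale (hG : G.Scaling s p) {v : Euc m → N} (hv : MeasOn v univ)
    (a : Euc m) {r : ℝ} (hr : 0 < r) :
    G.on (rescale v a r) (Metric.ball a r) =
      ENNReal.ofReal (r ^ ((m : ℝ) - s * p)) * G.on v (oball m 1) := by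
  have himg : (fun x ↦ a + r • x) '' oball m 1 = Metric.ball a r := by
    ext y
    constructor
    · rintro ⟨x, hx, rfl⟩
      rw [mem_oball] at hx
      rw [Metric.mem_ball, dist_eq_norm, add_sub_cancel_left, norm_smul,
        Real.norm_of_nonneg hr.le]
      nlinarith
    · intro hy
      rw [Metric.mem_ball, dist_eq_norm] at hy
      refine ⟨r⁻¹ • (y - a), ?_, by
        simp only [smul_inv_smul₀ hr.ne', add_sub_cancel]⟩
      rw [mem_oball, norm_smul, Real.norm_of_nonneg (inv_pos.2 hr).le, inv_mul_lt_iff₀ hr, mul_one]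
      exact hy
  have := hG (rescale v a r) (measOn_rescale hv a hr) r hr a (oball m 1) isOpen_oball
  rw [himg] at this
  simpa only [rescale_add_smul v a hr] using this

omit [MeasurableSpace N] in
lemma gagliardoEnergy_const (hp : 0 < p) (b : N) :
    gagliardoEnergy s p (fun _ : Euc m ↦ b) univ = 0 := by
  simp [gagliardoEnergy, ENNReal.zero_rpow_of_pos hp]

lemma dirichletEnergy_const (hp : 0 < p) (b : Euc ν) :
    dirichletEnergy p (fun _ : Euc m ↦ b) univ = 0 := by
  have h0 : ∀ x : Euc m, ‖(0 : Euc m → Euc m →L[ℝ] Euc ν) x‖ₑ ^ p = 0 := fun x ↦ by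
    rw [ENNReal.rpow_eq_zero_iff_of_pos hp]
    exact enorm_zero (E := Euc m →L[ℝ] Euc ν)
  rw [dirichletEnergy_eq isOpen_univ (hasWeakDerivOn_const b)]
  simp only [h0, lintegral_zero]

omit [MeasurableSpace N] in
lemma sobolevEnergy_const (hp : 0 < p) (b : N) :
    sobolevEnergy ι s p (fun _ : Euc m ↦ b) univ = 0 := by
  unfold sobolevEnergy
  split_ifs
  · exact dirichletEnergy_const hp (ι b)
  · exact gagliardoEnergy_const hp b

/-- Some map which equals `b` outside the ball of radius `1 / 2` has Sobolev energy at most `e`,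
and energy `G` at least `g` on the unit ball. -/
def Attains (ι : N → Euc ν) (s p : ℝ) (G : MapEnergy m N) (b : N) (e g : ℝ≥0∞) : Prop :=
  ∃ v : Euc m → N, MeasOn v univ ∧ (∀ x ∉ oball m (1 / 2), v x = b) ∧
    sobolevEnergy ι s p v univ ≤ e ∧ g ≤ G.on v (oball m 1)

lemma Attains.mono {G : MapEnergy m N} {b : N} {e e' g g' : ℝ≥0∞}
    (h : Attains ι s p G b e g) (he : e ≤ e') (hg : g' ≤ g) : Attains ι s p G b e' g' := by
  obtain ⟨v, hv, hvb, hve, hvg⟩ := h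
  exact ⟨v, hv, hvb, hve.trans he, hg.trans hvg⟩

variable [SecondCountableTopology N] [BorelSpace N]

/-- Rescaled copies of maps, inserted in disjoint balls on which a given map is constant. -/
lemma exists_glue_balls (hm : 1 ≤ m) (hs : 0 < s) (hp : 1 ≤ p) (hG : G.Superadditive)
    (hG' : G.Scaling s p) {κ : Type*} [Countable κ] {a : κ → Euc m} {r : κ → ℝ}
    (hr : ∀ i, 0 < r i) (hsub : ∀ i, Metric.ball (a i) (r i) ⊆ oball m (1 / 2))
    (hd : Pairwise (Function.onFun Disjoint fun i ↦ Metric.closedBall (a i) (r i)))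
    {T : Euc m → N} {b b₀ : N} (hT : MeasOn T univ) (hTb : ∀ i, ∀ x ∈ Metric.ball (a i) (r i), T x = b)
    (hTb₀ : ∀ x ∉ oball m (1 / 2), T x = b₀) {e g : κ → ℝ≥0∞}
    (hv : ∀ i, Attains ι s p G b (e i) (g i)) :
    Attains ι s p G b₀
      (2 ^ p * (sobolevEnergy ι s p T univ +
        ∑' i, ENNReal.ofReal (r i ^ ((m : ℝ) - s * p)) * e i))
      (∑' i, ENNReal.ofReal (r i ^ ((m : ℝ) - s * p)) * g i) := by
  choose v hvm hvb hve hvg using hv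
  set S : κ → Set (Euc m) := fun i ↦ Metric.ball (a i) (r i)
  set V : κ → Euc m → N := fun i ↦ rescale (v i) (a i) (r i)
  have hdS : Pairwise (Function.onFun Disjoint S) := fun i j hij ↦
    (hd hij).mono Metric.ball_subset_closedBall Metric.ball_subset_closedBall
  have hdc : Pairwise (Function.onFun Disjoint fun i ↦ closure (S i)) := fun i j hij ↦
    (hd hij).mono Metric.closure_ball_subset_closedBall Metric.closure_ball_subset_closedBall
  have hVm : ∀ i, MeasOn (V i) univ := fun i ↦ measOn_rescale (hvm i) _ (hr i)
  have hVb : ∀ i, ∀ x ∉ Metric.closedBall (a i) (r i / 2), V i x = b := by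
    intro i x hx
    refine hvb i _ fun hx' ↦ hx ?_
    have hri := hr i
    rw [mem_oball, norm_smul, Real.norm_of_nonneg (inv_pos.2 hri).le, inv_mul_lt_iff₀ hri] at hx'
    rw [Metric.mem_closedBall, dist_eq_norm]
    linarith
  obtain ⟨w, hwV, hwT⟩ := exists_glue hdS V T
  have hwm : MeasOn w univ := measOn_of_glue (fun i ↦ Metric.isOpen_ball.measurableSet) hVm hT
    hwV hwT
  refine ⟨w, hwm, fun x hx ↦ ?_, ?_, ?_⟩
  · rw [hwT x fun h ↦ hx ?_, hTb₀ x hx]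
    obtain ⟨i, hi⟩ := mem_iUnion.1 h
    exact hsub i hi
  · refine (sobolevEnergy_glue_le hm hp (fun i ↦ Metric.isOpen_ball) hdS hsub
      (fun i ↦ Metric.isClosed_closedBall) (fun i ↦ Metric.closedBall_subset_ball
        (by linarith [hr i])) hVm hT hVb hTb hwV hwT).trans ?_
    refine mul_le_mul' le_rfl (add_le_add le_rfl (ENNReal.tsum_le_tsum fun i ↦ ?_))
    exact (sobolevEnergy_rescale_le hs hp _ _ (hr i)).trans (mul_le_mul' le_rfl (hve i))
  · refine le_trans (ENNReal.tsum_le_tsum fun i ↦ ?_) (hG.tsum_le hwm isOpen_oball (S := S)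
      (fun i ↦ Metric.isOpen_ball) hdc
      fun i ↦ (hsub i).trans (Metric.ball_subset_ball (by norm_num)))
    rw [G.on_congr (hwV i), hG'.on_rescale (hvm i) _ (hr i)]
    exact mul_le_mul' le_rfl (hvg i)

/-- A rescaled map is inserted in the ball of radius `r`, in which `T` is constant. -/
lemma Attains.shrink (hm : 1 ≤ m) (hs : 0 < s) (hp : 1 ≤ p) (hG : G.Superadditive)
    (hG' : G.Scaling s p) {T : Euc m → N} {b b₀ : N} {r : ℝ} (hr : 0 < r) (hr2 : r ≤ 1 / 2)
    (hT : MeasOn T univ) (hTb : ∀ x, ‖x‖ ≤ r → T x = b)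
    (hTb₀ : ∀ x ∉ oball m (1 / 2), T x = b₀) {e g : ℝ≥0∞} (hv : Attains ι s p G b e g) :
    Attains ι s p G b₀
      (2 ^ p * (sobolevEnergy ι s p T univ + ENNReal.ofReal (r ^ ((m : ℝ) - s * p)) * e))
      (ENNReal.ofReal (r ^ ((m : ℝ) - s * p)) * g) := by
  have := exists_glue_balls hm hs hp hG hG' (κ := Unit) (a := fun _ ↦ 0) (r := fun _ ↦ r)
    (fun _ ↦ hr) (fun _ ↦ Metric.ball_subset_ball hr2)
    (fun i j hij ↦ (hij (Subsingleton.elim i j)).elim) hT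
    (fun _ x hx ↦ hTb x (mem_ball_zero_iff.1 hx).le) hTb₀ (fun _ ↦ hv)
  simpa using this

lemma Attains.shrink_const (hm : 1 ≤ m) (hs : 0 < s) (hp : 1 ≤ p) (hG : G.Superadditive)
    (hG' : G.Scaling s p) {b : N} {r : ℝ} (hr : 0 < r) (hr2 : r ≤ 1 / 2)
    {e g : ℝ≥0∞} (hv : Attains ι s p G b e g) :
    Attains ι s p G b (2 ^ p * (ENNReal.ofReal (r ^ ((m : ℝ) - s * p)) * e))
      (ENNReal.ofReal (r ^ ((m : ℝ) - s * p)) * g) := by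
  have := hv.shrink hm hs hp hG hG' hr hr2 (T := fun _ ↦ b) (measOn_univ.2 aemeasurable_const)
    (fun _ _ ↦ rfl) (b₀ := b) (fun _ _ ↦ rfl)
  rwa [sobolevEnergy_const (by linarith), zero_add] at this

/-- Transitions between two values along Lipschitz paths. -/
lemma Attains.transition (hm : 1 ≤ m) (hs : 0 < s) (hp : 1 ≤ p) (hG : G.Superadditive)
    (hG' : G.Scaling s p) (hι : s = 1 → LipschitzWith 1 ι) {b b₀ : N} {δ K : NNReal} {ρ : ℝ}
    {γ : ℝ → N} (hγ0 : γ 0 = b₀) (hγ1 : γ 1 = b) (hγ : LipschitzOnWith δ γ (Icc 0 1))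
    {θ : Euc m → ℝ} (hθ : IsCutoff K ρ θ) (hρ : 0 < ρ) (hρ2 : ρ ≤ 1 / 2)
    {e g : ℝ≥0∞} (hv : Attains ι s p G b e g) :
    Attains ι s p G b₀
      (2 ^ p * ((δ : ℝ≥0∞) ^ p * scalarEnergy s p θ +
        ENNReal.ofReal (ρ ^ ((m : ℝ) - s * p)) * e))
      (ENNReal.ofReal (ρ ^ ((m : ℝ) - s * p)) * g) := by
  have hT : Continuous (γ ∘ θ) :=
    hγ.continuousOn.comp_continuous hθ.lipschitz.continuous hθ.mem_Icc
  refine (hv.shrink hm hs hp hG hG' hρ hρ2 (T := γ ∘ θ)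
    (measOn_univ.2 hT.measurable.aemeasurable) (fun x hx ↦ ?_) (b₀ := b₀) fun x hx ↦ ?_).mono
    (mul_le_mul' le_rfl (add_le_add (sobolevEnergy_comp_le (by linarith) hι hγ hθ.lipschitz
      hθ.mem_Icc) le_rfl)) le_rfl
  · simp [hθ.eq_one x hx, hγ1]
  · rw [mem_oball, not_lt] at hx
    simp [hθ.eq_zero x hx, hγ0]

/-- A map on the unit ball is opened, and rescaled so that it is constant off the ball of radius
`1 / 2`; the original map is still seen, at a smaller scale, in the unit ball. -/
lemma exists_attains (hm : 1 ≤ m) (hs : 0 < s) (hp : 1 ≤ p) (hι : s = 1 → Continuous ι)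
    (hG' : G.Scaling s p) : ∃ A B : ℝ≥0∞, A ≠ 0 ∧ A ≠ ⊤ ∧ B ≠ 0 ∧ B ≠ ⊤ ∧
      ∀ u : Euc m → N, MeasOn u (oball m 1) → sobolevEnergy ι s p u (oball m 1) ≠ 0 →
        sobolevEnergy ι s p u (oball m 1) ≠ ⊤ →
        ∃ b, Attains ι s p G b (A * sobolevEnergy ι s p u (oball m 1)) (B * G.on u (oball m 1)) := by
  obtain ⟨C, hC, hle⟩ := exists_eqOn_oball_sobolevEnergy_le (N := N) hm hs hp hι
  set c := ENNReal.ofReal ((1 / 10 : ℝ) ^ ((m : ℝ) - s * p))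
  have hc : c ≠ 0 := ENNReal.ofReal_ne_zero_iff.2 (by positivity)
  have hct : c ≠ ⊤ := ENNReal.ofReal_ne_top
  refine ⟨c * (C + 1), c, by simp [hc], ENNReal.mul_ne_top hct (by simp [hC]), hc, hct,
    fun u hu h0 ht ↦ ?_⟩
  obtain ⟨w, b, hw, hwu, hwb, hwE⟩ := hle u hu h0 ht
  refine ⟨b, rescale w 0 (1 / 10), measOn_rescale hw _ (by norm_num), fun x hx ↦ ?_, ?_, ?_⟩
  · rw [mem_oball, not_lt] at hx
    refine hwb _ ?_
    rw [norm_smul, sub_zero, Real.norm_of_nonneg (by norm_num)]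
    linarith
  · refine (sobolevEnergy_rescale_le hs hp w 0 (by norm_num)).trans ?_
    rw [mul_assoc]
    exact mul_le_mul' le_rfl (hwE.trans (mul_le_mul' le_self_add le_rfl))
  · rw [← G.on_congr hwu, ← hG'.on_rescale hw 0 (by norm_num)]
    exact G.on_mono (measOn_rescale hw _ (by norm_num)) (Metric.ball_subset_ball (by norm_num))
      Metric.isOpen_ball isOpen_oball

/-- Many copies of a map in the cells of a grid multiply both energies by the same factor. -/
lemma exists_attains_grid (hm : 1 ≤ m) (hs : 0 < s) (hp : 1 ≤ p) (hG : G.Superadditive)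
    (hG' : G.Scaling s p) : ∃ A B : ℝ≥0∞, A ≠ 0 ∧ A ≠ ⊤ ∧ B ≠ 0 ∧ B ≠ ⊤ ∧
      ∀ (b : N) (e g : ℝ≥0∞) (j : ℕ), 1 ≤ j → Attains ι s p G b e g →
        Attains ι s p G b (A * (j : ℝ≥0∞) ^ (s * p) * e) (B * (j : ℝ≥0∞) ^ (s * p) * g) := by
  have hp0 : 0 < p := by linarith
  have hm0 : (1 : ℝ) ≤ m := by exact_mod_cast hm
  -- the copies have scale `1 / (6 * m * j)`, a third of the mesh of the grid
  set B := ENNReal.ofReal ((1 / (6 * m) : ℝ) ^ ((m : ℝ) - s * p))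
  have hB : B ≠ 0 := ENNReal.ofReal_ne_zero_iff.2 (by positivity)
  have hBt : B ≠ ⊤ := ENNReal.ofReal_ne_top
  have h2p : (2 : ℝ≥0∞) ^ p ≠ ⊤ := ENNReal.rpow_ne_top_of_nonneg hp0.le (by simp)
  have h2p0 : (2 : ℝ≥0∞) ^ p ≠ 0 := by simp [ENNReal.rpow_eq_zero_iff]
  refine ⟨2 ^ p * B, B, mul_ne_zero h2p0 hB, ENNReal.mul_ne_top h2p hBt, hB, hBt,
    fun b e g j hj hv ↦ ?_⟩
  have hj0 : (1 : ℝ) ≤ j := by exact_mod_cast hj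
  -- `h` is the mesh of the grid
  set h : ℝ := 1 / (2 * m * j)
  have hh : 0 < h := by positivity
  have hhj : m * h * j = 1 / 2 := by simp only [h]; field_simp
  set a : (Fin m → Fin j) → Euc m := fun α ↦ WithLp.toLp 2 fun i ↦ h * (α i : ℝ)
  have ha : ∀ α, ‖a α‖ ≤ m * (h * (j - 1)) := by
    intro α
    have h1 : ‖a α‖ ≤ ∑ i, ‖a α i‖ := by
      rw [EuclideanSpace.norm_eq]
      refine (Real.sqrt_le_sqrt (Finset.sum_sq_le_sq_sum_of_nonneg fun i _ ↦ norm_nonneg _)).trans ?_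
      rw [Real.sqrt_sq (Finset.sum_nonneg fun i _ ↦ norm_nonneg _)]
    refine h1.trans ?_
    calc ∑ i, ‖a α i‖ ≤ ∑ _i : Fin m, h * ((j : ℝ) - 1) := by
          refine Finset.sum_le_sum fun i _ ↦ ?_
          have h2 : ((α i : ℕ) : ℝ) + 1 ≤ j := by exact_mod_cast (α i).2
          rw [show a α i = h * (α i : ℝ) from rfl, Real.norm_of_nonneg (by positivity)]
          exact mul_le_mul_of_nonneg_left (by linarith) hh.le
      _ = m * (h * (j - 1)) := by simp
  have hdist : ∀ α β, α ≠ β → h ≤ ‖a α - a β‖ := by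
    intro α β hαβ
    obtain ⟨i, hi⟩ := Function.ne_iff.1 hαβ
    refine le_trans ?_ (PiLp.norm_apply_le (a α - a β) i)
    have e1 : (a α - a β) i = h * ((α i : ℝ) - (β i : ℝ)) := by
      rw [PiLp.sub_apply]
      simp only [a]
      ring
    rw [e1, norm_mul, Real.norm_of_nonneg hh.le]
    refine le_mul_of_one_le_right hh.le ?_
    have h3 : ((α i : ℕ) : ℤ) - ((β i : ℕ) : ℤ) ≠ 0 := by
      have : (α i : ℕ) ≠ (β i : ℕ) := fun h ↦ hi (Fin.ext h)
      omega
    have h4 := Int.one_le_abs h3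
    rw [Real.norm_eq_abs]
    exact_mod_cast h4
  have key := exists_glue_balls hm hs hp hG hG' (κ := Fin m → Fin j) (a := a) (r := fun _ ↦ h / 3)
    (T := fun _ ↦ b) (b := b) (b₀ := b) (fun _ ↦ by positivity) (fun α x hx ↦ ?_)
    (fun α β hαβ ↦ ?_)
    (measOn_univ.2 aemeasurable_const) (fun _ _ _ ↦ rfl) (fun _ _ ↦ rfl) (fun _ ↦ hv)
  · rw [sobolevEnergy_const hp0, zero_add] at key
    simp only [tsum_fintype, Finset.sum_const, Finset.card_univ, Fintype.card_fun,
      Fintype.card_fin, nsmul_eq_mul] at key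
    have hscale : ((j ^ m : ℕ) : ℝ≥0∞) * ENNReal.ofReal ((h / 3) ^ ((m : ℝ) - s * p)) =
        B * (j : ℝ≥0∞) ^ (s * p) := by
      have e1 : h / 3 = 1 / (6 * m) * (j : ℝ)⁻¹ := by simp only [h]; field_simp; norm_num
      have e2 : ((j ^ m : ℕ) : ℝ≥0∞) = ENNReal.ofReal ((j : ℝ) ^ (m : ℝ)) := by
        rw [Real.rpow_natCast, ← Nat.cast_pow, ENNReal.ofReal_natCast]
      rw [e1, Real.mul_rpow (by positivity) (by positivity), ENNReal.ofReal_mul (by positivity),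
        mul_left_comm, e2, ← ENNReal.ofReal_mul (by positivity), Real.inv_rpow (by positivity),
        ← Real.rpow_neg (by positivity), ← Real.rpow_add (by positivity),
        ← ENNReal.ofReal_natCast, ENNReal.ofReal_rpow_of_pos (by positivity)]
      congr 3
      ring
    have hk : ∀ z, ((j ^ m : ℕ) : ℝ≥0∞) * (ENNReal.ofReal ((h / 3) ^ ((m : ℝ) - s * p)) * z) =
        B * (j : ℝ≥0∞) ^ (s * p) * z := fun z ↦ by rw [← mul_assoc, hscale]
    rw [hk, hk, ← mul_assoc, ← mul_assoc] at key
    exact key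
  · rw [Metric.mem_ball, dist_eq_norm] at hx
    rw [mem_oball]
    have h1 := ha α
    have h2 := norm_add_le (x - a α) (a α)
    rw [sub_add_cancel] at h2
    have h3 : h ≤ m * h := le_mul_of_one_le_left hh.le hm0
    nlinarith
  · refine Metric.closedBall_disjoint_closedBall ?_
    rw [dist_eq_norm]
    linarith [hdist α β hαβ]

/-- Maps of arbitrarily small Sobolev energy and arbitrarily large energy `G` are combined into a
map of infinite energy `G`, by inserting them in a sequence of balls. -/
lemma exists_on_eq_top (hm : 1 ≤ m) (hs : 0 < s) (hp : 1 ≤ p) (hG : G.Superadditive)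
    (hG' : G.Scaling s p) {b : N}
    (h : ∀ e : ℝ≥0∞, 0 < e → ∀ g : ℝ≥0∞, g ≠ ⊤ → Attains ι s p G b e g) {ε : ℝ} (hε : 0 < ε) :
    ∃ w : Euc m → N, MeasOn w univ ∧ sobolevEnergy ι s p w univ ≤ ENNReal.ofReal ε ∧
      (∀ x, x ∉ oball m (1 / 2) → w x = b) ∧ G.on w (oball m 1) = ⊤ := by
  have hp0 : 0 < p := by linarith
  have : Nonempty (Fin m) := ⟨⟨0, hm⟩⟩
  obtain ⟨v, hv⟩ := exists_norm_eq (Euc m) zero_le_one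
  have h2p : (2 : ℝ≥0∞) ^ p ≠ ⊤ := ENNReal.rpow_ne_top_of_nonneg hp0.le (by simp)
  have h2p0 : (2 : ℝ≥0∞) ^ p ≠ 0 := by simp [ENNReal.rpow_eq_zero_iff]
  -- disjoint balls which accumulate at the origin along the direction `v`
  set a : ℕ → Euc m := fun n ↦ ((4 : ℝ)⁻¹ ^ n / 4) • v
  set r : ℕ → ℝ := fun n ↦ (4 : ℝ)⁻¹ ^ n / 16
  have hr : ∀ n, 0 < r n := fun n ↦ by positivity
  have hq1 : ∀ n, (4 : ℝ)⁻¹ ^ n ≤ 1 := fun n ↦ pow_le_one₀ (by norm_num) (by norm_num)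
  set c : ℕ → ℝ≥0∞ := fun n ↦ ENNReal.ofReal (r n ^ ((m : ℝ) - s * p))
  have hc : ∀ n, c n ≠ 0 := fun n ↦ ENNReal.ofReal_ne_zero_iff.2 (Real.rpow_pos_of_pos (hr n) _)
  have hct : ∀ n, c n ≠ ⊤ := fun n ↦ ENNReal.ofReal_ne_top
  obtain ⟨ε', hε', hsum⟩ := ENNReal.exists_pos_sum_of_countable'
    (ENNReal.div_pos (ENNReal.ofReal_pos.2 hε).ne' h2p).ne' ℕ
  have hdlt : ∀ i j, i < j → Disjoint (Metric.closedBall (a i) (r i))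
      (Metric.closedBall (a j) (r j)) := by
    intro i j hij
    refine Metric.closedBall_disjoint_closedBall ?_
    have h1 : (4 : ℝ)⁻¹ ^ j ≤ (4 : ℝ)⁻¹ ^ (i + 1) :=
      pow_le_pow_of_le_one (by norm_num) (by norm_num) hij
    rw [pow_succ] at h1
    have h2 : (0 : ℝ) < (4 : ℝ)⁻¹ ^ i := by positivity
    rw [dist_eq_norm, ← sub_smul, norm_smul, hv, mul_one, Real.norm_eq_abs]
    refine lt_of_lt_of_le ?_ (le_abs_self _)
    simp only [r]
    linarith
  -- after rescaling, the `n`-th copy contributes `ε' n` to the Sobolev energy and `1` to `G`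
  have key := exists_glue_balls hm hs hp hG hG' (ι := ι) (κ := ℕ) (a := a) (r := r)
    (T := fun _ ↦ b) (b := b) (b₀ := b) (e := fun n ↦ ε' n / c n) (g := fun n ↦ 1 / c n)
    hr (fun n x hx ↦ ?_) (fun i j hij ↦ ?_)
    (measOn_univ.2 aemeasurable_const) (fun _ _ _ ↦ rfl) (fun _ _ ↦ rfl)
    (fun n ↦ h _ (ENNReal.div_pos (hε' n).ne' (hct n)) _ (ENNReal.div_ne_top (by simp) (hc n)))
  · obtain ⟨w, hw, hwb, hwE, hwG⟩ := key
    refine ⟨w, hw, hwE.trans ?_, hwb, ?_⟩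
    · rw [sobolevEnergy_const hp0, zero_add]
      simp only [c] at hc hct
      simp only [c, ENNReal.mul_div_cancel (hc _) (hct _)]
      refine (mul_le_mul' le_rfl hsum.le).trans (le_of_eq ?_)
      exact ENNReal.mul_div_cancel h2p0 h2p
    · simp only [c] at hc hct
      simp only [c, ENNReal.mul_div_cancel (hc _) (hct _)] at hwG
      rw [ENNReal.tsum_const_eq_top_of_ne_zero one_ne_zero] at hwG
      exact top_le_iff.1 hwG
  · rw [Metric.mem_ball, dist_eq_norm] at hx
    rw [mem_oball]
    have h2 := norm_add_le (x - a n) (a n)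
    have h3 : ‖a n‖ = (4 : ℝ)⁻¹ ^ n / 4 := by
      rw [norm_smul, hv, mul_one, Real.norm_of_nonneg (by positivity)]
    rw [sub_add_cancel, h3] at h2
    have h4 := hq1 n
    simp only [r] at hx
    linarith
  · rcases lt_or_gt_of_ne hij with hlt | hlt
    · exact hdlt i j hlt
    · exact (hdlt j i hlt).symm

end

/-! ### Small Sobolev energy and large energy `G` with a prescribed value -/

section

variable {m ν : ℕ} {N : Type*} [MetricSpace N] [MeasurableSpace N] [SecondCountableTopology N]
  [BorelSpace N] {ι : N → Euc ν} {s p : ℝ} {G : MapEnergy m N}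

/-- Any two points are joined by Lipschitz paths, with all constants larger than their distance. -/
def HasLipschitzPaths (N : Type*) [PseudoEMetricSpace N] : Prop :=
  ∀ (x y : N) (δ : NNReal), edist x y < δ →
    ∃ γ : ℝ → N, γ 0 = x ∧ γ 1 = y ∧ LipschitzOnWith δ γ (Icc 0 1)

/-- The infinite values of `E` are excluded by the convention `g / ⊤ = 0`. -/
lemma eventually_ne_top_and_mul_le {E g : ℕ → ℝ≥0∞}
    (h : Tendsto (fun n ↦ g n / E n) atTop (𝓝 ⊤)) {M : ℝ≥0∞} (hM : M ≠ ⊤) :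
    ∀ᶠ n in atTop, E n ≠ ⊤ ∧ M * E n ≤ g n := by
  filter_upwards [h.eventually (lt_mem_nhds hM.lt_top)] with n hn
  refine ⟨fun htop ↦ ?_, ENNReal.mul_le_of_le_div hn.le⟩
  rw [htop, ENNReal.div_top] at hn
  exact not_lt_zero hn

/-- Opening multiplies the energy ratio by a constant factor at worst, so that it still tends to
infinity. -/
lemma eventually_exists_attains (hm : 1 ≤ m) (hs : 0 < s) (hp : 1 ≤ p)
    (hι : s = 1 → Continuous ι) (hG' : G.Scaling s p) {u : ℕ → Euc m → N}
    (hu : ∀ n, MeasOn (u n) (oball m 1)) (hE : ∀ n, 0 < sobolevEnergy ι s p (u n) (oball m 1))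
    (h : Tendsto (fun n ↦ G.on (u n) (oball m 1) / sobolevEnergy ι s p (u n) (oball m 1))
      atTop (𝓝 ⊤)) :
    ∃ A : ℝ≥0∞, A ≠ 0 ∧ A ≠ ⊤ ∧ ∀ M : ℝ≥0∞, M ≠ ⊤ → ∀ᶠ n in atTop,
      sobolevEnergy ι s p (u n) (oball m 1) ≠ ⊤ ∧
      ∃ b, Attains ι s p G b (A * sobolevEnergy ι s p (u n) (oball m 1))
        (M * (A * sobolevEnergy ι s p (u n) (oball m 1))) := by
  obtain ⟨A, B, hA, hAt, hB, hBt, hle⟩ := exists_attains (ι := ι) hm hs hp hι hG'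
  refine ⟨A, hA, hAt, fun M hM ↦ ?_⟩
  filter_upwards [eventually_ne_top_and_mul_le h (M := B⁻¹ * (M * A))
    (ENNReal.mul_ne_top (by simpa using hB) (ENNReal.mul_ne_top hM hAt))] with n hn
  obtain ⟨b, hb⟩ := hle (u n) (hu n) (hE n).ne' hn.1
  refine ⟨hn.1, b, hb.mono le_rfl ?_⟩
  calc M * (A * sobolevEnergy ι s p (u n) (oball m 1))
      = B * (B⁻¹ * (M * A) * sobolevEnergy ι s p (u n) (oball m 1)) := by
        rw [← mul_assoc B, ← mul_assoc B, ENNReal.mul_inv_cancel hB hBt, one_mul, mul_assoc]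
    _ ≤ B * G.on (u n) (oball m 1) := mul_le_mul' le_rfl hn.2

lemma tendsto_mul_natCast_rpow {A e : ℝ≥0∞} (hA : A ≠ 0) (he : e ≠ 0) {q : ℝ} (hq : 0 < q) :
    Tendsto (fun j : ℕ ↦ A * (j : ℝ≥0∞) ^ q * e) atTop (𝓝 ⊤) := by
  have t1 := (ENNReal.continuous_rpow_const (y := q)).tendsto ⊤
  rw [ENNReal.top_rpow_of_pos hq] at t1
  have t2 := ENNReal.Tendsto.mul_const (b := e) (ENNReal.Tendsto.const_mul (a := A)
    (t1.comp ENNReal.tendsto_nat_nhds_top) (Or.inl ENNReal.top_ne_zero))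
    (Or.inl (by rw [ENNReal.mul_top hA]; exact ENNReal.top_ne_zero))
  rwa [ENNReal.mul_top hA, ENNReal.top_mul he] at t2

/-- From maps of small Sobolev energy with large energy ratio, maps with small Sobolev energy and
large energy `G`: the number of copies is adjusted in order to reach the prescribed energy. -/
lemma exists_attains_of_ratio (hm : 1 ≤ m) (hs : 0 < s) (hp : 1 ≤ p) (hG : G.Superadditive)
    (hG' : G.Scaling s p)
    (h : ∀ M : ℝ≥0∞, M ≠ ⊤ → ∀ η : ℝ≥0∞, 0 < η → ∃ b e, e ≠ 0 ∧ e ≤ η ∧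
      Attains ι s p G b e (M * e)) {e₀ g₀ : ℝ≥0∞} (he₀ : 0 < e₀) (hg₀ : g₀ ≠ ⊤) :
    ∃ b, Attains ι s p G b e₀ g₀ := by
  wlog het : e₀ ≠ ⊤ generalizing e₀
  · obtain ⟨b, hb⟩ := this one_pos ENNReal.one_ne_top
    rw [not_not] at het
    exact ⟨b, hb.mono (by rw [het]; exact le_top) le_rfl⟩
  have hq : 0 < s * p := by positivity
  set q := s * p
  obtain ⟨A, B, hA, hAt, hB, hBt, hgrid⟩ := exists_attains_grid (ι := ι) hm hs hp hG hG'
  have h2q : (2 : ℝ≥0∞) ^ q ≠ ⊤ := ENNReal.rpow_ne_top_of_nonneg hq.le (by simp)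
  obtain ⟨b, e, he0, heη, hv⟩ := h (B⁻¹ * (A * 2 ^ q * g₀ / e₀))
    (ENNReal.mul_ne_top (by simpa using hB) (ENNReal.div_ne_top
      (ENNReal.mul_ne_top (ENNReal.mul_ne_top hAt h2q) hg₀) he₀.ne')) (e₀ / A)
    (ENNReal.div_pos he₀.ne' hAt)
  -- `k` is the least number of cells in each direction for which the energy bound exceeds `e₀`
  have hex : ∃ k : ℕ, e₀ < A * (k : ℝ≥0∞) ^ q * e :=
    ((tendsto_mul_natCast_rpow hA he0 hq).eventually (lt_mem_nhds het.lt_top)).exists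
  classical
  obtain ⟨k, hk, hmin⟩ : ∃ k : ℕ, e₀ < A * (k : ℝ≥0∞) ^ q * e ∧
      ∀ j < k, A * (j : ℝ≥0∞) ^ q * e ≤ e₀ :=
    ⟨Nat.find hex, Nat.find_spec hex, fun j hj ↦ not_lt.1 (Nat.find_min hex hj)⟩
  have hAe : A * e ≤ e₀ := by
    refine (mul_le_mul' le_rfl heη).trans (le_of_eq ?_)
    exact ENNReal.mul_div_cancel hA hAt
  have hk2 : 2 ≤ k := by
    by_contra! hlt
    interval_cases k
    · rw [Nat.cast_zero, ENNReal.zero_rpow_of_pos hq, mul_zero, zero_mul] at hk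
      exact not_lt_zero hk
    · rw [Nat.cast_one, ENNReal.one_rpow, mul_one] at hk
      exact absurd hk (not_lt.2 hAe)
  obtain ⟨j, rfl⟩ : ∃ j, k = j + 1 := ⟨k - 1, by omega⟩
  have hj1 : 1 ≤ j := by omega
  refine ⟨b, (hgrid b _ _ j hj1 hv).mono (hmin j (by omega)) ?_⟩
  have hkj : ((j + 1 : ℕ) : ℝ≥0∞) ^ q ≤ 2 ^ q * (j : ℝ≥0∞) ^ q := by
    rw [← ENNReal.mul_rpow_of_nonneg _ _ hq.le]
    refine ENNReal.rpow_le_rpow ?_ hq.le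
    exact_mod_cast (by omega : j + 1 ≤ 2 * j)
  have he₀le : e₀ ≤ A * 2 ^ q * ((j : ℝ≥0∞) ^ q * e) := by
    refine hk.le.trans ?_
    rw [mul_assoc, mul_assoc A, ← mul_assoc (2 ^ q)]
    exact mul_le_mul' le_rfl (mul_le_mul' hkj le_rfl)
  calc g₀ = g₀ * e₀ / e₀ := (ENNReal.mul_div_cancel_right he₀.ne' het).symm
    _ ≤ g₀ * (A * 2 ^ q * ((j : ℝ≥0∞) ^ q * e)) / e₀ :=
        ENNReal.div_le_div_right (mul_le_mul' le_rfl he₀le) _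
    _ = (B * B⁻¹) * (g₀ * (A * 2 ^ q * ((j : ℝ≥0∞) ^ q * e)) / e₀) := by
        rw [ENNReal.mul_inv_cancel hB hBt, one_mul]
    _ = B * (j : ℝ≥0∞) ^ q * (B⁻¹ * (A * 2 ^ q * g₀ / e₀) * e) := by
        simp only [div_eq_mul_inv]
        ring

omit [MeasurableSpace N] [SecondCountableTopology N] [BorelSpace N] in
lemma exists_nnreal_edist_lt (x y : N) : ∃ δ : NNReal, edist x y < δ ∧ 0 < δ := by
  obtain ⟨δ, hδ, -⟩ := ENNReal.lt_iff_exists_nnreal_btwn.1 (edist_lt_top x y)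
  exact ⟨δ, hδ, by exact_mod_cast (zero_le.trans_lt hδ : (0 : ℝ≥0∞) < δ)⟩

/-- In the subcritical case, the cost of the transition to the value `b₀` is made negligible by
taking many copies, and the result is then shrunk. -/
lemma attains_of_subcritical (hm : 1 ≤ m) (hs : 0 < s) (hs1 : s ≤ 1) (hp : 1 ≤ p)
    (hG : G.Superadditive) (hG' : G.Scaling s p) (hι : s = 1 → LipschitzWith 1 ι)
    (hN : HasLipschitzPaths N) (hsub : s * p < m)
    (h : ∀ M : ℝ≥0∞, M ≠ ⊤ → ∃ b e, e ≠ 0 ∧ e ≠ ⊤ ∧ Attains ι s p G b e (M * e))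
    (b₀ : N) {e₀ g₀ : ℝ≥0∞} (he₀ : 0 < e₀) (hg₀ : g₀ ≠ ⊤) : Attains ι s p G b₀ e₀ g₀ := by
  wlog het : e₀ ≠ ⊤ generalizing e₀
  · rw [not_not] at het
    exact (this one_pos ENNReal.one_ne_top).mono (by rw [het]; exact le_top) le_rfl
  have hp0 : 0 < p := by linarith
  have hq : 0 < s * p := by positivity
  set t₀ : ℝ := m - s * p
  have ht₀ : 0 < t₀ := by simp only [t₀]; linarith
  set q := s * p
  obtain ⟨A, B, hA, hAt, hB, hBt, hgrid⟩ := exists_attains_grid (ι := ι) hm hs hp hG hG'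
  have hb := isCutoff_bump (m := m)
  set κ : ℝ≥0∞ := 2 ^ p
  have hκt : κ ≠ ⊤ := ENNReal.rpow_ne_top_of_nonneg hp0.le (by simp)
  have hκ1 : 1 ≤ κ := ENNReal.one_le_rpow (by norm_num) hp0
  have hκ0 : κ ≠ 0 := (zero_lt_one.trans_le hκ1).ne'
  set ρ : ℝ≥0∞ := ENNReal.ofReal ((1 / 4 : ℝ) ^ t₀)
  have hρ0 : ρ ≠ 0 := ENNReal.ofReal_ne_zero_iff.2 (by positivity)
  have hρt : ρ ≠ ⊤ := ENNReal.ofReal_ne_top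
  have hρ1 : ρ ≤ 1 := ENNReal.ofReal_le_one.2 (Real.rpow_le_one (by norm_num) (by norm_num) ht₀.le)
  set η : ℝ≥0∞ := ENNReal.ofReal ((1 / 2 : ℝ) ^ t₀)
  have hη0 : η ≠ 0 := ENNReal.ofReal_ne_zero_iff.2 (by positivity)
  have hηt : η ≠ ⊤ := ENNReal.ofReal_ne_top
  set D : ℝ≥0∞ := κ * κ * 2 * A
  have hD0 : D ≠ 0 := by simp [D, hκ0, hA]
  have hDt : D ≠ ⊤ := ENNReal.mul_ne_top (ENNReal.mul_ne_top (ENNReal.mul_ne_top hκt hκt) (by simp)) hAt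
  set c : ℝ≥0∞ := e₀ * ρ * B
  have hc0 : c ≠ 0 := mul_ne_zero (mul_ne_zero he₀.ne' hρ0) hB
  have hct : c ≠ ⊤ := ENNReal.mul_ne_top (ENNReal.mul_ne_top het hρt) hBt
  -- the energy ratio which is needed, given that the copies and the transition together have energy
  -- at most `D / 2 ^ p` times that of the map, up to the factor `j ^ q`; it depends neither on the number
  -- of copies nor on the value `b`, which is only known afterwards
  set M : ℝ≥0∞ := g₀ * D / c
  have hMc : c * M = g₀ * D := ENNReal.mul_div_cancel hc0 hct
  obtain ⟨b, e, he0, het', hv⟩ := h M (ENNReal.div_ne_top (ENNReal.mul_ne_top hg₀ hDt) hc0)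
  obtain ⟨δ, hδ, -⟩ := exists_nnreal_edist_lt b₀ b
  obtain ⟨γ, hγ0, hγ1, hγ⟩ := hN b₀ b δ hδ
  set τ : ℝ≥0∞ := (δ : ℝ≥0∞) ^ p * scalarEnergy s p (bump : Euc m → ℝ)
  have hτ : τ ≠ ⊤ := ENNReal.mul_ne_top (ENNReal.rpow_ne_top_of_nonneg hp0.le (by simp))
    (hb.scalarEnergy_ne_top hm hs hs1 hp)
  have hX : max τ (e₀ / η) < ⊤ := max_lt hτ.lt_top (ENNReal.div_lt_top het hη0)
  -- there are so many copies that their energy exceeds the cost `τ` of the transition, and that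
  -- reducing the total energy to `e₀` takes a shrinking by a factor at most `1 / 2`
  obtain ⟨j, hj1, hj⟩ := ((eventually_ge_atTop 1).and
    ((tendsto_mul_natCast_rpow hA he0 hq).eventually (lt_mem_nhds hX))).exists
  have h1 := hgrid b _ _ j hj1 hv
  set Z : ℝ≥0∞ := (j : ℝ≥0∞) ^ q * e
  have hY : A * (j : ℝ≥0∞) ^ q * e = A * Z := mul_assoc _ _ _
  rw [hY] at h1 hj
  have hjq0 : (j : ℝ≥0∞) ^ q ≠ 0 := by
    have : (j : ℝ≥0∞) ≠ 0 := by exact_mod_cast (by omega : j ≠ 0)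
    simp [ENNReal.rpow_eq_zero_iff, this]
  have hZ0 : Z ≠ 0 := mul_ne_zero hjq0 he0
  have hZt : Z ≠ ⊤ := ENNReal.mul_ne_top (ENNReal.rpow_ne_top_of_nonneg hq.le (by simp)) het'
  have h2 := h1.transition hm hs hp hG hG' hι hγ0 hγ1 hγ hb (by norm_num) (by norm_num)
  set e₁ : ℝ≥0∞ := κ * (2 * (A * Z))
  have he₁ : κ * (τ + ρ * (A * Z)) ≤ e₁ := by
    refine mul_le_mul' le_rfl ?_
    rw [two_mul]
    exact add_le_add ((le_max_left _ _).trans hj.le) (mul_le_of_le_one_left' hρ1)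
  have h3 := h2.mono he₁ le_rfl
  have hDZ : κ * e₁ = D * Z := by simp only [e₁, D]; ring
  have hDZ0 : D * Z ≠ 0 := mul_ne_zero hD0 hZ0
  have hDZt : D * Z ≠ ⊤ := ENNReal.mul_ne_top hDt hZt
  set t : ℝ≥0∞ := e₀ / (D * Z)
  have htD : D * Z * t = e₀ := ENNReal.mul_div_cancel hDZ0 hDZt
  have ht0 : t ≠ 0 := (ENNReal.div_pos he₀.ne' hDZt).ne'
  have htt : t ≠ ⊤ := ENNReal.div_ne_top het hDZ0
  have htη : t ≤ η := by
    refine ENNReal.div_le_of_le_mul ?_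
    calc e₀ = η * (e₀ / η) := (ENNReal.mul_div_cancel hη0 hηt).symm
      _ ≤ η * (A * Z) := mul_le_mul' le_rfl ((le_max_right _ _).trans hj.le)
      _ ≤ η * (D * Z) := by
          refine mul_le_mul' le_rfl (mul_le_mul' ?_ le_rfl)
          exact le_mul_of_one_le_left' (one_le_mul (one_le_mul hκ1 hκ1) (by norm_num))
  have htpos : 0 < t.toReal := ENNReal.toReal_pos ht0 htt
  -- shrinking by the factor `r` multiplies the energies by `r ^ (m - s p) = t`
  set r : ℝ := t.toReal ^ (1 / t₀)
  have hr : 0 < r := Real.rpow_pos_of_pos htpos _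
  have hrt : r ^ t₀ = t.toReal := by
    rw [← Real.rpow_mul htpos.le, one_div, inv_mul_cancel₀ ht₀.ne', Real.rpow_one]
  have hr2 : r ≤ 1 / 2 := by
    have h4 : t.toReal ≤ (1 / 2 : ℝ) ^ t₀ := ENNReal.toReal_le_of_le_ofReal (by positivity) htη
    rw [← hrt] at h4
    exact (Real.rpow_le_rpow_iff hr.le (by norm_num) ht₀).1 h4
  have h5 := h3.shrink_const hm hs hp hG hG' hr hr2
  rw [show (m : ℝ) - s * p = t₀ from rfl, hrt, ENNReal.ofReal_toReal htt] at h5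
  refine h5.mono (le_of_eq ?_) ?_
  · calc κ * (t * e₁) = κ * e₁ * t := by ring
      _ = e₀ := by rw [hDZ, htD]
  · refine le_of_eq ((ENNReal.mul_left_inj hD0 hDt).1 ?_)
    calc g₀ * D = c * M := hMc.symm
      _ = (D * Z * t) * ρ * B * M := by rw [htD]
      _ = t * (ρ * (B * (j : ℝ≥0∞) ^ q * (M * e))) * D := by simp only [Z]; ring

/-- In the critical case the transition to the value `b₀` can be made as cheap as desired, and
shrinking does not change the energies, so that it is harmless that the cutoff function equals `1` on a
tiny ball only. -/
lemma attains_of_critical (hm : 1 ≤ m) (hs : 0 < s) (hs1 : s ≤ 1) (hp : 1 ≤ p)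
    (hG : G.Superadditive) (hG' : G.Scaling s p) (hι : s = 1 → LipschitzWith 1 ι)
    (hN : HasLipschitzPaths N) (hsp : s * p = m) (hsm : s < m)
    (h : ∀ e₀ : ℝ≥0∞, 0 < e₀ → ∀ g₀ : ℝ≥0∞, g₀ ≠ ⊤ → ∃ b, Attains ι s p G b e₀ g₀)
    (b₀ : N) {e₀ g₀ : ℝ≥0∞} (he₀ : 0 < e₀) (hg₀ : g₀ ≠ ⊤) : Attains ι s p G b₀ e₀ g₀ := by
  have hp0 : 0 < p := by linarith
  have hκt : (2 : ℝ≥0∞) ^ p ≠ ⊤ := ENNReal.rpow_ne_top_of_nonneg hp0.le (by simp)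
  have hκ0 : (2 : ℝ≥0∞) ^ p ≠ 0 := by simp [ENNReal.rpow_eq_zero_iff]
  set e₁ : ℝ≥0∞ := e₀ / 2 ^ p / 2
  have he₁ : 0 < e₁ := ENNReal.half_pos (ENNReal.div_pos he₀.ne' hκt).ne'
  obtain ⟨b, hb⟩ := h e₁ he₁ g₀ hg₀
  obtain ⟨δ, hδ, hδ0⟩ := exists_nnreal_edist_lt b₀ b
  obtain ⟨γ, hγ0, hγ1, hγ⟩ := hN b₀ b δ hδ
  have hδpt : (δ : ℝ≥0∞) ^ p ≠ ⊤ := ENNReal.rpow_ne_top_of_nonneg hp0.le (by simp)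
  have hδp0 : (δ : ℝ≥0∞) ^ p ≠ 0 := by simp [ENNReal.rpow_eq_zero_iff, hδ0.ne']
  obtain ⟨K, ρ, θ, hρ, hθ, hθe⟩ := exists_isCutoff_scalarEnergy_le hm hs hs1 hp hsp hsm
    (ENNReal.div_pos he₁.ne' hδpt)
  have hθ' : IsCutoff K (min ρ (1 / 2)) θ :=
    { hθ with eq_one := fun x hx ↦ hθ.eq_one x (hx.trans (min_le_left _ _)) }
  refine (hb.transition hm hs hp hG hG' hι hγ0 hγ1 hγ hθ' (lt_min hρ (by norm_num))
    (min_le_right _ _)).mono ?_ ?_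
  · rw [hsp, sub_self, Real.rpow_zero, ENNReal.ofReal_one, one_mul]
    calc 2 ^ p * ((δ : ℝ≥0∞) ^ p * scalarEnergy s p θ + e₁)
        ≤ 2 ^ p * (e₁ + e₁) := by
          refine mul_le_mul' le_rfl (add_le_add ?_ le_rfl)
          refine (mul_le_mul' le_rfl hθe).trans (le_of_eq ?_)
          exact ENNReal.mul_div_cancel hδp0 hδpt
      _ = e₀ := by
          rw [ENNReal.add_halves]
          exact ENNReal.mul_div_cancel hκ0 hκt
  · rw [hsp, sub_self, Real.rpow_zero, ENNReal.ofReal_one, one_mul]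

/-- When `N` is compact, the values `b` accumulate, and transitions between close values are
cheap. -/
lemma exists_attains_of_compactSpace [CompactSpace N] (hm : 1 ≤ m) (hs : 0 < s) (hs1 : s ≤ 1)
    (hp : 1 ≤ p) (hG : G.Superadditive) (hG' : G.Scaling s p) (hι : s = 1 → LipschitzWith 1 ι)
    (hN : HasLipschitzPaths N)
    (h : ∀ e₀ : ℝ≥0∞, 0 < e₀ → ∀ g₀ : ℝ≥0∞, g₀ ≠ ⊤ → ∃ b, Attains ι s p G b e₀ g₀) :
    ∃ b₀, ∀ e₀ : ℝ≥0∞, 0 < e₀ → ∀ g₀ : ℝ≥0∞, g₀ ≠ ⊤ → Attains ι s p G b₀ e₀ g₀ := by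
  have hp0 : 0 < p := by linarith
  have hκt : (2 : ℝ≥0∞) ^ p ≠ ⊤ := ENNReal.rpow_ne_top_of_nonneg hp0.le (by simp)
  have hκ0 : (2 : ℝ≥0∞) ^ p ≠ 0 := by simp [ENNReal.rpow_eq_zero_iff]
  choose b hb using fun k : ℕ ↦ h (k : ℝ≥0∞)⁻¹ (by simp) k (by simp)
  obtain ⟨b₀, φ, hφ, hlim⟩ := CompactSpace.tendsto_subseq b
  refine ⟨b₀, fun e₀ he₀ g₀ hg₀ ↦ ?_⟩
  have hcut := isCutoff_bump (m := m)
  set c := scalarEnergy s p (bump : Euc m → ℝ)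
  have hc : c ≠ ⊤ := hcut.scalarEnergy_ne_top hm hs hs1 hp
  set e₁ : ℝ≥0∞ := e₀ / 2 ^ p / 2
  have he₁ : 0 < e₁ := ENNReal.half_pos (ENNReal.div_pos he₀.ne' hκt).ne'
  set ρ : ℝ≥0∞ := ENNReal.ofReal ((1 / 4 : ℝ) ^ ((m : ℝ) - s * p))
  have hρ0 : ρ ≠ 0 := ENNReal.ofReal_ne_zero_iff.2 (by positivity)
  have hρt : ρ ≠ ⊤ := ENNReal.ofReal_ne_top
  obtain ⟨δ, hδ0, hδ⟩ : ∃ δ : NNReal, 0 < δ ∧ (δ : ℝ≥0∞) ^ p * c ≤ e₁ := by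
    have t1 := (ENNReal.continuous_rpow_const (y := p)).tendsto 0
    rw [ENNReal.zero_rpow_of_pos hp0] at t1
    have t2 := ENNReal.Tendsto.mul_const (b := c) (t1.comp ENNReal.tendsto_inv_nat_nhds_zero)
      (Or.inr hc)
    rw [zero_mul] at t2
    obtain ⟨n, hn1, hn⟩ := ((eventually_ge_atTop 1).and
      ((ENNReal.tendsto_nhds_zero.1 t2) _ he₁)).exists
    have hn0 : (n : NNReal) ≠ 0 := by exact_mod_cast (by omega : n ≠ 0)
    refine ⟨(n : NNReal)⁻¹, by positivity, ?_⟩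
    rw [ENNReal.coe_inv hn0]
    exact hn
  have t1 : Tendsto (fun k ↦ ρ * ((φ k : ℕ) : ℝ≥0∞)⁻¹) atTop (𝓝 0) := by
    have := ENNReal.Tendsto.const_mul (a := ρ)
      (ENNReal.tendsto_inv_nat_nhds_zero.comp hφ.tendsto_atTop) (Or.inr hρt)
    rwa [mul_zero] at this
  have t2 : Tendsto (fun k ↦ ρ * ((φ k : ℕ) : ℝ≥0∞)) atTop (𝓝 ⊤) := by
    have := ENNReal.Tendsto.const_mul (a := ρ)
      (ENNReal.tendsto_nat_nhds_top.comp hφ.tendsto_atTop) (Or.inl ENNReal.top_ne_zero)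
    rwa [ENNReal.mul_top hρ0] at this
  have t3 : ∀ᶠ k in atTop, edist b₀ (b (φ k)) < δ := by
    have := (EMetric.tendsto_nhds.1 hlim) δ (by exact_mod_cast hδ0)
    filter_upwards [this] with k hk
    rwa [edist_comm]
  obtain ⟨k, ⟨hk1, hk2⟩, hk3⟩ := (((ENNReal.tendsto_nhds_zero.1 t1 _ he₁).and
    (t2.eventually (lt_mem_nhds hg₀.lt_top))).and t3).exists
  obtain ⟨γ, hγ0, hγ1, hγ⟩ := hN b₀ (b (φ k)) δ hk3
  refine ((hb (φ k)).transition hm hs hp hG hG' hι hγ0 hγ1 hγ hcut (by norm_num)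
    (by norm_num)).mono ?_ hk2.le
  refine (mul_le_mul' le_rfl (add_le_add hδ hk1)).trans (le_of_eq ?_)
  rw [ENNReal.add_halves]
  exact ENNReal.mul_div_cancel hκ0 hκt

end

theorem mainTheorem2
    (m : ℕ) (hm : 1 ≤ m) (s p : ℝ) (hs : 0 < s) (hs1 : s ≤ 1) (hp : 1 ≤ p)
    -- `N` is a connected Riemannian manifold, with its geodesic distance
    (d : ℕ) (N : Type*) [MetricSpace N] [SecondCountableTopology N] [ConnectedSpace N]
    [MeasurableSpace N] [BorelSpace N]
    [ChartedSpace (Euc d) N] [IsManifold (𝓡 d) ∞ N]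
    [RiemannianBundle (fun x : N ↦ TangentSpace (𝓡 d) x)]
    [IsContMDiffRiemannianBundle (𝓡 d) ∞ (Euc d) (fun x : N ↦ TangentSpace (𝓡 d) x)]
    [IsRiemannianManifold (𝓡 d) N]
    -- the isometric embedding through which `ℰ_{1,p}` is defined
    (ν : ℕ) (ι : N → Euc ν) (hι : s = 1 → IsIsometricEmbedding (d := d) ι)
    (G : MapEnergy m N) (hG : G.Superadditive) (hG' : G.Scaling s p) :
    -- subcritical case
    (s * p < m →
      ∀ u : ℕ → Euc m → N,
        (∀ n, MeasOn (u n) (oball m 1)) →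
        (∀ n, 0 < sobolevEnergy ι s p (u n) (oball m 1)) →
        (∀ n, G.on (u n) (oball m 1) < ⊤) →
        Tendsto (fun n ↦ G.on (u n) (oball m 1) / sobolevEnergy ι s p (u n) (oball m 1))
          atTop (𝓝 ⊤) →
        ∀ (b : N) (ε : ℝ), 0 < ε → ∃ w : Euc m → N, MeasOn w univ ∧
          sobolevEnergy ι s p w univ ≤ ENNReal.ofReal ε ∧
          (∀ x, x ∉ oball m (1 / 2) → w x = b) ∧
          G.on w (oball m 1) = ⊤) ∧
    -- critical case
    (s * p = m → s < m →
      ∀ u : ℕ → Euc m → N,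
        (∀ n, MeasOn (u n) (oball m 1)) →
        (∀ n, 0 < sobolevEnergy ι s p (u n) (oball m 1)) →
        (∀ n, G.on (u n) (oball m 1) < ⊤) →
        Tendsto (fun n ↦ sobolevEnergy ι s p (u n) (oball m 1)) atTop (𝓝 0) →
        Tendsto (fun n ↦ G.on (u n) (oball m 1) / sobolevEnergy ι s p (u n) (oball m 1))
          atTop (𝓝 ⊤) →
        ∀ (b : N) (ε : ℝ), 0 < ε → ∃ w : Euc m → N, MeasOn w univ ∧
          sobolevEnergy ι s p w univ ≤ ENNReal.ofReal ε ∧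
          (∀ x, x ∉ oball m (1 / 2) → w x = b) ∧
          G.on w (oball m 1) = ⊤) ∧
    -- supercritical case
    (((m : ℝ) < s * p ∨ (s = 1 ∧ p = 1 ∧ m = 1)) → CompactSpace N →
      ∀ u : ℕ → Euc m → N,
        (∀ n, MeasOn (u n) (oball m 1)) →
        (∀ n, 0 < sobolevEnergy ι s p (u n) (oball m 1)) →
        (∀ n, G.on (u n) (oball m 1) < ⊤) →
        Tendsto (fun n ↦ sobolevEnergy ι s p (u n) (oball m 1)) atTop (𝓝 0) →
        Tendsto (fun n ↦ G.on (u n) (oball m 1) / sobolevEnergy ι s p (u n) (oball m 1))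
          atTop (𝓝 ⊤) →
        ∀ ε : ℝ, 0 < ε → ∃ (b : N) (w : Euc m → N), MeasOn w univ ∧
          sobolevEnergy ι s p w univ ≤ ENNReal.ofReal ε ∧
          (∀ x, x ∉ oball m (1 / 2) → w x = b) ∧
          G.on w (oball m 1) = ⊤) := by
  have hιL : s = 1 → LipschitzWith 1 ι := fun h ↦ (hι h).lipschitzWith
  have hιc : s = 1 → Continuous ι := fun h ↦ (hιL h).continuous
  have hN : HasLipschitzPaths N := fun x y δ hδ ↦ exists_lipschitzOnWith_path d hδ
  -- maps of small Sobolev energy and large energy `G`, with uncontrolled value near infinity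
  have hsmall : ∀ u : ℕ → Euc m → N,
      (∀ n, MeasOn (u n) (oball m 1)) →
      (∀ n, 0 < sobolevEnergy ι s p (u n) (oball m 1)) →
      Tendsto (fun n ↦ sobolevEnergy ι s p (u n) (oball m 1)) atTop (𝓝 0) →
      Tendsto (fun n ↦ G.on (u n) (oball m 1) / sobolevEnergy ι s p (u n) (oball m 1))
        atTop (𝓝 ⊤) →
      ∀ e₀ : ℝ≥0∞, 0 < e₀ → ∀ g₀ : ℝ≥0∞, g₀ ≠ ⊤ → ∃ b, Attains ι s p G b e₀ g₀ := by
    intro u hu hE h0 hlim e₀ he₀ g₀ hg₀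
    obtain ⟨A, hA, hAt, hev⟩ := eventually_exists_attains hm hs hp hιc hG' hu hE hlim
    refine exists_attains_of_ratio hm hs hp hG hG' (fun M hM η hη ↦ ?_) he₀ hg₀
    have h1 := ENNReal.Tendsto.const_mul (a := A) h0 (Or.inr hAt)
    rw [mul_zero] at h1
    obtain ⟨n, ⟨-, b, hb⟩, hn⟩ := ((hev M hM).and (ENNReal.tendsto_nhds_zero.1 h1 η hη)).exists
    exact ⟨b, _, mul_ne_zero hA (hE n).ne', hn, hb⟩
  refine ⟨fun hsub u hu hE _ hlim b ε hε ↦ ?_, fun hsp hsm u hu hE _ h0 hlim b ε hε ↦ ?_,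
    fun _ hK u hu hE _ h0 hlim ε hε ↦ ?_⟩
  · obtain ⟨A, hA, hAt, hev⟩ := eventually_exists_attains hm hs hp hιc hG' hu hE hlim
    refine exists_on_eq_top hm hs hp hG hG' (fun e he g hg ↦ attains_of_subcritical hm hs hs1 hp hG
      hG' hιL hN hsub (fun M hM ↦ ?_) b he hg) hε
    obtain ⟨n, hn, b', hb'⟩ := (hev M hM).exists
    exact ⟨b', _, mul_ne_zero hA (hE n).ne', ENNReal.mul_ne_top hAt hn, hb'⟩
  · exact exists_on_eq_top hm hs hp hG hG' (fun e he g hg' ↦ attains_of_critical hm hs hs1 hp hG hG'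
      hιL hN hsp hsm (hsmall u hu hE h0 hlim) b he hg') hε
  · obtain ⟨b, hb⟩ := exists_attains_of_compactSpace hm hs hs1 hp hG hG' hιL hN
      (hsmall u hu hE h0 hlim)
    exact ⟨b, exists_on_eq_top hm hs hp hG hG' hb hε⟩
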